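/- **Setting.** Let $M$ be a matroid on $E=\{0,\dots,n\}$, with rank function $r$. Work in $\mathbb R^{n+1}/\mathbb R\mathbf 1\cong\mathbb R^n$, where $\mathbf 1=(1,\dots,1)$, with lattice the image of $\mathbb Z^{n+1}$. For a flag $\mathcal F=(\emptyset=F_0\subsetneq F_1\subsetneq\dots\subsetneq F_k\subsetneq F_{k+1}=E)$ of flats of $M$ let $\sigma_{\mathcal F}$ be the image of $-\operatorname{cone}(e_{F_1},\dots,e_{F_k})$, where $e_S=\sum_{i\in S}e_i$. The matroidal cycle $Z_M$ has as support $|Z_M|$ the union of all the cones $\sigma_{\mathcal F}$, with multiplicity $1$ on the maximal cones. The Chern–Schwartz–MacPherson cycle $\operatorname{csm}_k(Z_M)=\operatorname{csm}_k(M)$ is the $k$-dimensional weighted fan whose facets are the cones $\sigma_{\mathcal F}$ of dimension $k$, with weights $$(-1)^{r(M)-1-k}\prod_{i=0}^{k}\beta(M|F_{i+1}/F_i),\qquad \beta(N)=(-1)^{r(N)}\sum_{S\subseteq E(N)}(-1)^{|S|}r_N(S).$$ (If $M$ has loops there are no such flags, so $Z_M$ and $\operatorname{csm}_k(M)$ are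 empty.) Two weighted polyhedral complexes of pure dimension $k$ are equal as tropical cycles if they agree up to common refinement and facets of weight $0$, i.e. if their weights agree at all points outside finitely many affine subspaces of dimension less than $k$. **Proposition 3.2.** Let $Y'=Z_{M'}\subset\mathbb R^{n'}$ and $Y=Z_M\subset\mathbb R^{n}$ be matroidal cycles, and let $\varphi:\mathbb R^{n'}\to\mathbb R^n$ be an affine map that restricts to a bijection $|Y'|\to|Y|$. Then for every $k\ge 0$ $$\varphi(\operatorname{csm}_k(Y'))=\operatorname{csm}_k(Y)\quad\text{as tropical cycles},$$ where $\varphi(\operatorname{csm}_k(Y'))$ consists of the images $\varphi(\sigma)$ of the facets $\sigma$ of $\operatorname{csm}_k(Y')$, with unchanged weights. If moreover $\varphi$ is an integer affine map (integral linear part, arbitrary real translation) and the inverse $|Y|\to|Y'|$ is also induced by an integer affine map $\mathbb R^n\to\mathbb R^{n'}$, then also $$\varphi_*(\operatorname{csm}_k(Y'))=\operatorname{csm}_k(Y)\quad\text{as tropical cycles},$$ where the push-forward $\varphi_*$ multiplies the weight of each facet $\sigma$ by the lattice index $[\Lambda_{\varphi(\sigma)}:\varphi(\Lambda_\sigma)]$.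 Here $\Lambda_\sigma$ is the group of lattice points in the linear space parallel to $\sigma$, and $\Lambda_{\varphi(\sigma)}$ is defined likewise. -/

import Mathlib

open scoped Classical Matroid

/-- The ambient space `ℝ^α / ℝ·𝟏`, where `𝟏 = (1,…,1)`. For `α = {0,…,n}` this is the
`n`-dimensional space `ℝ^{n+1} / ℝ·𝟏 ≅ ℝ^n`. -/
abbrev TropAmbient (α : Type*) : Type _ :=
  (α → ℝ) ⧸ (Submodule.span ℝ {(1 : α → ℝ)})

/-- The lattice of `ℝ^α / ℝ·𝟏`: the image of `ℤ^α`. -/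
def tropLattice (α : Type*) : AddSubgroup (TropAmbient α) where
  carrier := {x | ∃ z : α → ℤ, x = Submodule.Quotient.mk (fun i => (z i : ℝ))}
  zero_mem' := ⟨0, by
    rw [← Submodule.Quotient.mk_zero]; congr 1; funext i; simp⟩
  add_mem' := by
    rintro _ _ ⟨z, rfl⟩ ⟨w, rfl⟩
    refine ⟨z + w, ?_⟩
    rw [← Submodule.Quotient.mk_add]; congr 1; funext i; simp
  neg_mem' := by
    rintro _ ⟨z, rfl⟩
    refine ⟨-z, ?_⟩
    rw [← Submodule.Quotient.mk_neg]; congr 1; funext i; simp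

/-- The class in `ℝ^α / ℝ·𝟏` of `e_S = ∑_{i ∈ S} e_i`. -/
noncomputable def indicatorClass {α : Type*} (S : Set α) : TropAmbient α :=
  Submodule.Quotient.mk (S.indicator (1 : α → ℝ))

/-! Matroids and their Bergman fans -/

/-- Flags of flats `∅ = F₀ ⊊ F₁ ⊊ ⋯ ⊊ F_k ⊊ F_{k+1} = E` of `M`.
If `M` has a loop then `∅` is not a flat and there are no such flags. -/
@[ext] structure FlagOfFlats {α : Type*} (M : Matroid α) (k : ℕ) where
  flat : Fin (k + 2) → Set α
  isFlat : ∀ i, M.IsFlat (flat i)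
  strictMono : StrictMono flat
  first : flat 0 = ∅
  last : flat (Fin.last (k + 1)) = M.E

instance {α : Type*} [Finite α] (M : Matroid α) (k : ℕ) : Finite (FlagOfFlats M k) :=
  Finite.of_injective (fun F => F.flat) (fun _ _ h => FlagOfFlats.ext h)

noncomputable instance {α : Type*} [Finite α] (M : Matroid α) (k : ℕ) :
    Fintype (FlagOfFlats M k) := Fintype.ofFinite _

/-- The cone `σ_F = -cone(e_{F₁}, …, e_{F_k})` in `ℝ^α / ℝ·𝟏`, of dimension `k`. -/
def FlagOfFlats.cone {α : Type*} {M : Matroid α} {k : ℕ} (F : FlagOfFlats M k) :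
    Set (TropAmbient α) :=
  {x | ∃ c : Fin k → ℝ, (∀ i, 0 ≤ c i) ∧
    x = -∑ i : Fin k, c i • indicatorClass (F.flat i.succ.castSucc)}

/-- The support of the (projective) Bergman fan of `M`, that is, of the matroidal tropical
cycle `Z_M`: the union of all the cones `σ_F`. It is empty if `M` has loops. -/
def bergmanSupport {α : Type*} (M : Matroid α) : Set (TropAmbient α) :=
  ⋃ (k : ℕ) (F : FlagOfFlats M k), F.cone

/-- Crapo's beta invariant `β(M) = (-1)^{r(M)} ∑_{S ⊆ E} (-1)^{|S|} r(S)`. -/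
noncomputable def betaInvariant {α : Type*} [Fintype α] (M : Matroid α) : ℤ :=
  (-1) ^ M.eRank.toNat *
    ∑ S ∈ Finset.univ.filter (fun S : Finset α => (S : Set α) ⊆ M.E),
      (-1) ^ S.card * ((M.eRk (S : Set α)).toNat : ℤ)

/-- The weight `(-1)^{d-k} ∏_{i=0}^k β(M|F_{i+1}/F_i)` of the cone `σ_F` in the `k`-th CSM cycle
of `M`, where `d + 1` is the rank of `M`. (If there is a flag of this length then `k ≤ d`.) -/
noncomputable def FlagOfFlats.csmWeight {α : Type*} [Fintype α] {M : Matroid α} {k : ℕ}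
    (F : FlagOfFlats M k) : ℤ :=
  (-1) ^ (M.eRank.toNat - 1 - k) *
    ∏ i : Fin (k + 1), betaInvariant ((M ↾ F.flat i.succ) ／ F.flat i.castSucc)

/-! Weighted polyhedral sets and their equality as tropical cycles -/

/-- Finite formal sums of subsets of `V` with integer coefficients. A weighted polyhedral complex
of pure dimension `k` is such a sum: its facets, with their weights as coefficients. -/
abbrev WeightedCells (V : Type*) : Type _ := Set V →₀ ℤ

/-- The total weight of the cells that contain the point `x`. -/
noncomputable def WeightedCells.weightAt {V : Type*} (c : WeightedCells V) (x : V) : ℤ :=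
  c.sum fun σ w => if x ∈ σ then w else 0

/-- Equality of weighted polyhedral complexes of pure dimension `k` as `k`-dimensional
cycles, i.e. up to refinement and up to facets of weight zero: the weights agree at generic points,
which means at all points outside finitely many affine subspaces of dimension less than `k`
(in particular at every point, if `k = 0`). -/
def SameCycle {V : Type*} [AddCommGroup V] [Module ℝ V] (k : ℕ) (c c' : WeightedCells V) : Prop :=
  ∃ A : Finset (AffineSubspace ℝ V), (∀ a ∈ A, Module.finrank ℝ a.direction < k) ∧
    ∀ x : V, (∀ a ∈ A, x ∉ a) → c.weightAt x = c'.weightAt x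

/-- The `k`-th Chern-Schwartz-MacPherson cycle of the matroid `M`
(and of its matroidal tropical cycle). -/
noncomputable def csmCycle {α : Type*} [Fintype α] (M : Matroid α) (k : ℕ) :
    WeightedCells (TropAmbient α) :=
  ∑ F : FlagOfFlats M k, Finsupp.single F.cone F.csmWeight

/-- The image of a weighted complex under an affine map that is injective on the cells:
each cell is replaced by its image, with the same weight. -/
noncomputable def WeightedCells.image {V W : Type*} (φ : V → W) (c : WeightedCells V) :
    WeightedCells W :=
  c.mapDomain fun σ => φ '' σ

/-- An affine map `x ↦ A x + b` with `A` integral, i.e. mapping the lattice to the lattice. -/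
def IsIntegerAffine {α β : Type*} (φ : TropAmbient α →ᵃ[ℝ] TropAmbient β) : Prop :=
  ∀ v ∈ tropLattice α, φ.linear v ∈ tropLattice β

/-- The lattice points in the linear space parallel to a cell `σ`. -/
def cellLattice {α : Type*} (σ : Set (TropAmbient α)) : AddSubgroup (TropAmbient α) :=
  tropLattice α ⊓ (vectorSpan ℝ σ).toAddSubgroup

/-- The lattice index `[Λ_{φ(σ)} : φ(Λ_σ)]` of an integer affine map on a rational cell `σ`. -/
noncomputable def latticeIndex {α β : Type*} (φ : TropAmbient α →ᵃ[ℝ] TropAmbient β)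
    (σ : Set (TropAmbient α)) : ℕ :=
  ((cellLattice σ).map φ.linear.toAddMonoidHom).relIndex (cellLattice (φ '' σ))

/-- The push-forward of cycles along an integer affine map: each cell is replaced by its image, with
its weight multiplied by the lattice index. (Cells of dimension `k` whose image has dimension less
than `k` do not contribute to a `k`-dimensional cycle.) -/
noncomputable def WeightedCells.pushforward {α β : Type*}
    (φ : TropAmbient α →ᵃ[ℝ] TropAmbient β) (c : WeightedCells (TropAmbient α)) :
    WeightedCells (TropAmbient β) :=
  c.sum fun σ w => Finsupp.single (φ '' σ) (w * (latticeIndex φ σ : ℤ))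

/-! The weights of the CSM cycles are read off a polynomial attached to each point of the support,
and this polynomial depends only on the support as a subset of a real vector space, up to affine
maps with an affine inverse on it.

Let x be a point of the affine Bergman fan `berg`, the preimage of the support in ℝ^α. Its
localization, with rank function `locRank`, is the direct sum of the minors between consecutive
sublevel sets of x. Let P_x = ∑_S (-1)^|S| (-X)^(r(S) - r(∅)) be its `charPolyIn`, the Poincaré
polynomial of the Orlik–Solomon algebra. It is a product over the levels of x; each factor vanishes
at X = -1 and has there, up to sign, the beta invariant of the minor as derivative. So the
coefficient of X^(k+1) in P_x(X - 1) is the signed product of beta invariants if x has k + 1 levels,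
and 0 if it has more. This is the weight of the k-th CSM cycle at x (`weightAt_csmCycle_mk`); points
with fewer levels lie in finitely many subspaces of dimension less than k (`exists_exceptional`).

The coefficient of X^p in P_x is the dimension of the space of p-forms after restriction to the
p-tuples tangent to the fan at x (`tangentRank_berg`). Near x the fan is a translate of the fan of
the localization, and tangent tuples lie in spans of chains of its flats; so this is a statement
about forms evaluated on chains of flats (`formsRank_eq_coeff`). Deletion and contraction of an
element e, with P(E ∪ e) = P(E) + X · P(E / e), give an upper bound through cochains on flags of
flats and a lower bound through forms.

It remains to see that an affine bijection of supports has an inverse induced by a linear map, after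
passing to linear parts (`bijOn_linear_of_affine`, `exists_linear_leftInverse`). The bijection
induces bijections of tangent cones (`bijOn_berg_locRank`), and a Bergman fan mapped bijectively
onto a linear space is linear (`neg_mem_berg_of_image_eq`). So the inverse is locally affine inside
the maximal cones, hence additive on each cone (`inverse_add`). To extend it linearly it must
respect the relations between indicator vectors of flats coming from intervals of rank two. These
are preserved because they are balancing relations at cones of codimension one, unique up to scaling
(`sum_inverse_coversIn`).

In the integral case both maps preserve lattices, so all lattice indices are 1 and the push-forward
is the plain image. -/

/-! ### Rank functions on finite sets -/

section RankFunctions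

variable {α : Type*} [DecidableEq α]

/-- A (not necessarily normalized) matroid rank function: monotone, submodular, and growing by at
most one when an element is added. Ranks are measured relative to the value at `∅`. -/
structure IsRankFn (r : Finset α → ℕ) : Prop where
  mono : Monotone r
  insert_le : ∀ i S, r (insert i S) ≤ r S + 1
  submod : ∀ S T, r (S ∪ T) + r (S ∩ T) ≤ r S + r T

/-- Flats of the rank function `r` on the ground set `E`. -/
def FlatIn (E : Finset α) (r : Finset α → ℕ) (F : Finset α) : Prop :=
  F ⊆ E ∧ ∀ i ∈ E, i ∉ F → r F < r (insert i F)

/-- The closure of `S` in the ground set `E`. -/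
def clIn (E : Finset α) (r : Finset α → ℕ) (S : Finset α) : Finset α :=
  E.filter fun i => r (insert i S) = r S

namespace IsRankFn

variable {r : Finset α → ℕ} (hr : IsRankFn r) {E F G S T : Finset α} {i e : α}

/-- Submodularity for `insert i S` and `T`, whose intersection contains `S`. -/
theorem insert_eq_of_subset (hr : IsRankFn r) (hST : S ⊆ T) (h : r (insert i S) = r S) :
    r (insert i T) = r T := by
  by_cases hi : i ∈ T
  · rw [Finset.insert_eq_of_mem hi]
  have h1 := hr.submod (insert i S) T
  have h2 : insert i S ∪ T = insert i T := by
    rw [Finset.insert_union, Finset.union_eq_right.2 hST]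
  have h3 : r S ≤ r (insert i S ∩ T) :=
    hr.mono (Finset.subset_inter (Finset.subset_insert _ _) hST)
  have h4 : r T ≤ r (insert i T) := hr.mono (Finset.subset_insert _ _)
  rw [h2] at h1
  omega

theorem union_eq (hr : IsRankFn r) (h : ∀ i ∈ T, r (insert i S) = r S) : r (S ∪ T) = r S := by
  induction T using Finset.induction_on with
  | empty => simp
  | insert i T _ ih =>
    rw [Finset.union_insert, hr.insert_eq_of_subset Finset.subset_union_left
      (h i (Finset.mem_insert_self _ _))]
    exact ih fun j hj => h j (Finset.mem_insert_of_mem hj)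

theorem contract (hr : IsRankFn r) (e : α) : IsRankFn fun S => r (insert e S) where
  mono := fun _ _ h => hr.mono (Finset.insert_subset_insert _ h)
  insert_le := fun i S => by
    have := hr.insert_le i (insert e S)
    rwa [Finset.insert_comm] at this
  submod := fun S T => by
    have := hr.submod (insert e S) (insert e T)
    rwa [← Finset.insert_union_distrib, ← Finset.insert_inter_distrib] at this

theorem subset_clIn (hS : S ⊆ E) : S ⊆ clIn E r S := fun i hi =>
  Finset.mem_filter.2 ⟨hS hi, by rw [Finset.insert_eq_of_mem hi]⟩

theorem clIn_subset : clIn E r S ⊆ E := Finset.filter_subset _ _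

theorem rank_clIn (hr : IsRankFn r) (hS : S ⊆ E) : r (clIn E r S) = r S := by
  have h := hr.union_eq (S := S) (T := clIn E r S) fun i hi => (Finset.mem_filter.1 hi).2
  rwa [Finset.union_eq_right.2 (subset_clIn hS)] at h

theorem flatIn_clIn (hr : IsRankFn r) (hS : S ⊆ E) : FlatIn E r (clIn E r S) := by
  refine ⟨clIn_subset, fun i hi hiS => ?_⟩
  by_contra hlt
  apply hiS
  refine Finset.mem_filter.2 ⟨hi, ?_⟩
  have h1 : r (insert i S) ≤ r (insert i (clIn E r S)) :=
    hr.mono (Finset.insert_subset_insert _ (subset_clIn hS))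
  have h2 := hr.rank_clIn hS
  have h3 : r S ≤ r (insert i S) := hr.mono (Finset.subset_insert _ _)
  omega

theorem clIn_mono (hr : IsRankFn r) (h : S ⊆ T) : clIn E r S ⊆ clIn E r T := fun i hi => by
  obtain ⟨h1, h2⟩ := Finset.mem_filter.1 hi
  exact Finset.mem_filter.2 ⟨h1, hr.insert_eq_of_subset h h2⟩

end IsRankFn

namespace FlatIn

variable {r : Finset α → ℕ} {E F G S T : Finset α} {i e : α}

theorem mem_of_rank (hF : FlatIn E r F) (hi : i ∈ E) (h : r (insert i F) ≤ r F) : i ∈ F := by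
  by_contra hn
  exact absurd (hF.2 i hi hn) (not_lt.2 h)

theorem clIn_eq (hF : FlatIn E r F) : clIn E r F = F := by
  refine Finset.Subset.antisymm (fun i hi => ?_) (IsRankFn.subset_clIn hF.1)
  obtain ⟨h1, h2⟩ := Finset.mem_filter.1 hi
  exact hF.mem_of_rank h1 h2.le

theorem clIn_subset (hr : IsRankFn r) (hF : FlatIn E r F) (h : S ⊆ F) : clIn E r S ⊆ F := by
  rw [← hF.clIn_eq]
  exact hr.clIn_mono h

theorem eq_of_rank_le (hr : IsRankFn r) (hF : FlatIn E r F) (hGE : G ⊆ E) (h : F ⊆ G)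
    (hle : r G ≤ r F) : F = G := by
  refine Finset.Subset.antisymm h fun i hi => hF.mem_of_rank (hGE hi) ?_
  exact (hr.mono (Finset.insert_subset hi h)).trans hle

theorem rank_lt (hr : IsRankFn r) (hF : FlatIn E r F) (hGE : G ⊆ E) (h : F ⊂ G) : r F < r G := by
  by_contra hn
  exact h.ne (hF.eq_of_rank_le hr hGE h.subset (not_lt.1 hn))

theorem rank_insert (hr : IsRankFn r) (hF : FlatIn E r F) (hi : i ∈ E) (hiF : i ∉ F) :
    r (insert i F) = r F + 1 :=
  le_antisymm (hr.insert_le _ _) (hF.2 i hi hiF)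

theorem ground : FlatIn E r E := ⟨subset_rfl, fun _ h h' => absurd h h'⟩

/-- A flat covering `F` is determined by any of its elements outside `F`. -/
theorem eq_clIn_insert (hr : IsRankFn r) (hF : FlatIn E r F) (hG : FlatIn E r G) (hFG : F ⊆ G)
    (hrk : r G = r F + 1) (hi : i ∈ G) (hiF : i ∉ F) : clIn E r (insert i F) = G := by
  have hsub : insert i F ⊆ E := Finset.insert_subset (hG.1 hi) hF.1
  refine (hr.flatIn_clIn hsub).eq_of_rank_le hr hG.1
    (hG.clIn_subset hr (Finset.insert_subset hi hFG)) ?_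
  rw [hr.rank_clIn hsub, hF.rank_insert hr (hG.1 hi) hiF, hrk]

theorem contract_iff (he : e ∉ E) (hG : G ⊆ E) :
    FlatIn E (fun S => r (insert e S)) G ↔ FlatIn (insert e E) r (insert e G) := by
  constructor
  · rintro ⟨_, h⟩
    refine ⟨Finset.insert_subset_insert _ hG, fun i hi hiG => ?_⟩
    rw [Finset.mem_insert, not_or] at hiG
    rw [Finset.insert_comm]
    exact h i (Finset.mem_of_mem_insert_of_ne hi hiG.1) hiG.2
  · rintro ⟨_, h⟩
    refine ⟨hG, fun i hi hiG => ?_⟩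
    have hie : i ≠ e := fun h => he (h ▸ hi)
    have := h i (Finset.mem_insert_of_mem hi) (by simp [hie, hiG])
    rwa [Finset.insert_comm] at this

theorem erase (hr : IsRankFn r) (he : e ∉ E) (hG : FlatIn (insert e E) r G) :
    FlatIn E r (G.erase e) := by
  refine ⟨fun i hi => ?_, fun i hi hiG => ?_⟩
  · obtain ⟨h1, h2⟩ := Finset.mem_erase.1 hi
    exact Finset.mem_of_mem_insert_of_ne (hG.1 h2) h1
  · have hie : i ≠ e := fun h => he (h ▸ hi)
    have hiG' : i ∉ G := fun h => hiG (Finset.mem_erase.2 ⟨hie, h⟩)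
    have h1 := hG.2 i (Finset.mem_insert_of_mem hi) hiG'
    refine lt_of_le_of_ne (hr.mono (Finset.subset_insert _ _)) fun h => ?_
    exact h1.ne (hr.insert_eq_of_subset (Finset.erase_subset _ _) h.symm).symm

/-- Closure thus embeds the flats of the deletion into those of `insert e E`, with erasing `e` as a
retraction. The deletion arguments for cochains and for forms both rest on this. -/
theorem clIn_insert_erase {H : Finset α} (he : e ∉ E) (hH : FlatIn E r H) :
    (clIn (insert e E) r H).erase e = H := by
  have heH : e ∉ H := fun h => he (hH.1 h)
  ext i
  rw [Finset.mem_erase, clIn, Finset.mem_filter, Finset.mem_insert]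
  constructor
  · rintro ⟨h1, h2, h3⟩
    exact hH.mem_of_rank (h2.resolve_left h1) h3.le
  · intro h
    exact ⟨fun h' => heH (h' ▸ h), Or.inr (hH.1 h), by rw [Finset.insert_eq_of_mem h]⟩

end FlatIn

/-- The flats of `E` that cover `F` and are contained in `G`. -/
noncomputable def coversIn (E : Finset α) (r : Finset α → ℕ) (F G : Finset α) :
    Finset (Finset α) :=
  G.powerset.filter fun A => FlatIn E r A ∧ F ⊆ A ∧ r A = r F + 1

theorem mem_coversIn {E F G A : Finset α} {r : Finset α → ℕ} :
    A ∈ coversIn E r F G ↔ A ⊆ G ∧ FlatIn E r A ∧ F ⊆ A ∧ r A = r F + 1 := by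
  simp [coversIn]

/-- The real indicator vector of a finite set. -/
def indVec (S : Finset α) : α → ℝ := fun i => if i ∈ S then 1 else 0

@[simp] theorem indVec_apply (S : Finset α) (i : α) : indVec S i = if i ∈ S then 1 else 0 := rfl

@[simp] theorem indVec_empty : indVec (∅ : Finset α) = 0 := by ext; simp

theorem clIn_insert_mem_coversIn {E F G : Finset α} {r : Finset α → ℕ} (hr : IsRankFn r)
    (hF : FlatIn E r F) (hG : FlatIn E r G) (hFG : F ⊆ G) {i : α} (hiG : i ∈ G) (hiF : i ∉ F) :
    clIn E r (insert i F) ∈ coversIn E r F G := by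
  have hsub : insert i F ⊆ E := Finset.insert_subset (hG.1 hiG) hF.1
  exact mem_coversIn.2 ⟨hG.clIn_subset hr (Finset.insert_subset hiG hFG), hr.flatIn_clIn hsub,
    (Finset.subset_insert _ _).trans (IsRankFn.subset_clIn hsub),
    by rw [hr.rank_clIn hsub, hF.rank_insert hr (hG.1 hiG) hiF]⟩

/-- The flats covering `F` inside `G` partition `G \ F`. -/
theorem sum_coversIn_indVec {E F G : Finset α} {r : Finset α → ℕ} (hr : IsRankFn r)
    (hF : FlatIn E r F) (hG : FlatIn E r G) (hFG : F ⊆ G) :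
    ∑ A ∈ coversIn E r F G, (indVec A - indVec F) = indVec G - indVec F := by
  ext i
  rw [Finset.sum_apply]
  by_cases hiF : i ∈ F
  · rw [Finset.sum_eq_zero]
    · simp [hiF, hFG hiF]
    · intro A hA
      simp [hiF, (mem_coversIn.1 hA).2.2.1 hiF]
  by_cases hiG : i ∈ G
  · rw [Finset.sum_eq_single_of_mem _ (clIn_insert_mem_coversIn hr hF hG hFG hiG hiF)]
    · have : i ∈ clIn E r (insert i F) :=
        IsRankFn.subset_clIn (Finset.insert_subset (hG.1 hiG) hF.1) (Finset.mem_insert_self _ _)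
      simp [this, hiF, hiG]
    · intro A hA hne
      obtain ⟨_, h2, h3, h4⟩ := mem_coversIn.1 hA
      have : i ∉ A := fun h => hne (hF.eq_clIn_insert hr h2 h3 h4 h hiF).symm
      simp [this, hiF]
  · rw [Finset.sum_eq_zero]
    · simp [hiF, hiG]
    · intro A hA
      have : i ∉ A := fun h => hiG ((mem_coversIn.1 hA).1 h)
      simp [this, hiF]

/-! ### The characteristic polynomial -/

open Polynomial in
/-- `∑_{S ⊆ E} (-1)^|S| (-X)^{r(S) - r(∅)}`, a version of the characteristic polynomial. -/
noncomputable def charPolyIn (E : Finset α) (r : Finset α → ℕ) : ℤ[X] :=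
  ∑ S ∈ E.powerset, (-1) ^ S.card * (-X) ^ (r S - r ∅)

-- The subsets containing `e` give the contraction. The factor `X` combines a sign from the
-- cardinality with a factor `-X` from the rank of `e`.
open Polynomial in
theorem charPolyIn_insert {E : Finset α} {r : Finset α → ℕ} {e : α} (hr : IsRankFn r) (he : e ∉ E)
    (hrk : r {e} = r ∅ + 1) :
    charPolyIn (insert e E) r = charPolyIn E r + X * charPolyIn E (fun S => r (insert e S)) := by
  unfold charPolyIn
  rw [Finset.sum_powerset_insert he, Finset.mul_sum]
  congr 1
  refine Finset.sum_congr rfl fun S hS => ?_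
  have heS : e ∉ S := fun h => he (Finset.mem_powerset.1 hS h)
  have h1 : r {e} ≤ r (insert e S) := hr.mono (by simp)
  have h2 : r (insert e S) - r ∅ = (r (insert e S) - r (insert e ∅)) + 1 := by
    simp only [insert_empty_eq]; omega
  rw [h2, Finset.card_insert_of_notMem heS]
  ring

/-- Subsets with and without the loop have the same rank and opposite signs, so they cancel in
pairs. -/
theorem charPolyIn_loop {E : Finset α} {r : Finset α → ℕ} {e : α} (hr : IsRankFn r) (he : e ∈ E)
    (hrk : r {e} = r ∅) : charPolyIn E r = 0 := by
  unfold charPolyIn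
  rw [← Finset.insert_erase he, Finset.sum_powerset_insert (Finset.notMem_erase _ _),
    ← Finset.sum_add_distrib]
  refine Finset.sum_eq_zero fun S hS => ?_
  have heS : e ∉ S := fun h => Finset.notMem_erase e E (Finset.mem_powerset.1 hS h)
  have h : r (insert e S) = r S :=
    hr.insert_eq_of_subset (Finset.empty_subset S) (by simpa using hrk)
  rw [h, Finset.card_insert_of_notMem heS]
  ring

theorem charPolyIn_empty (r : Finset α → ℕ) : charPolyIn ∅ r = 1 := by
  simp [charPolyIn]

end RankFunctions

/-! ### Cochains on initial flags of flats -/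

section FlagCochains

set_option linter.unusedSectionVars false

variable {α : Type*} [DecidableEq α] [Fintype α]

/-- Flags of flats of ranks `1, …, p`, under the assumption that there are no loops. -/
def IsInitialFlag (E : Finset α) (r : Finset α → ℕ) {p : ℕ} (G : Fin p → Finset α) : Prop :=
  FlatIn E r ∅ ∧ Monotone G ∧ ∀ i, FlatIn E r (G i) ∧ r (G i) = r ∅ + i + 1

/-- Functions on the initial flags of length `p` that sum to zero over all flags which agree outside
a given position other than the last. -/
def flagCochains (E : Finset α) (r : Finset α → ℕ) (p : ℕ) :
    Submodule ℝ ((Fin p → Finset α) → ℝ) where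
  carrier := {z | (∀ G, z G ≠ 0 → IsInitialFlag E r G) ∧
    ∀ (G : Fin p → Finset α) (i : Fin p), (i : ℕ) + 1 < p →
      ∑ A, z (Function.update G i A) = 0}
  zero_mem' := by simp
  add_mem' := by
    rintro z w ⟨h1, h2⟩ ⟨h3, h4⟩
    refine ⟨fun G h => ?_, fun G i hi => ?_⟩
    · by_cases hz : z G = 0
      · exact h3 G fun hw => h (by simp [hz, hw])
      · exact h1 G hz
    · simp [Finset.sum_add_distrib, h2 G i hi, h4 G i hi]
  smul_mem' := by
    rintro c z ⟨h1, h2⟩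
    refine ⟨fun G h => h1 G fun hz => h (by simp [hz]), fun G i hi => ?_⟩
    simp [← Finset.mul_sum, h2 G i hi]

variable {E : Finset α} {r : Finset α → ℕ} {e : α} {p : ℕ}

/-! ### Contraction: flags starting with a given point -/

/-- The cochain on flags of the contraction that is obtained by restricting a cochain to the flags
starting with `{e}`. -/
def restrictToFirst (e : α) (p : ℕ) :
    ((Fin (p + 1) → Finset α) → ℝ) →ₗ[ℝ] ((Fin p → Finset α) → ℝ) where
  toFun z G := if ∀ i, e ∉ G i then
    z (Fin.cons (α := fun _ => Finset α) {e} fun i => insert e (G i)) else 0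
  map_add' z w := by ext G; by_cases h : ∀ i, e ∉ G i <;> simp [h]
  map_smul' c z := by ext G; by_cases h : ∀ i, e ∉ G i <;> simp [h]

theorem IsInitialFlag.of_cons (he : e ∉ E) {G : Fin p → Finset α} (hG : ∀ i, e ∉ G i)
    (h : IsInitialFlag (insert e E) r
      (Fin.cons (α := fun _ => Finset α) {e} fun i => insert e (G i))) :
    IsInitialFlag E (fun S => r (insert e S)) G := by
  obtain ⟨h0, hm, hf⟩ := h
  have hGE : ∀ i, G i ⊆ E := fun i j hj => by
    have h1 := (hf i.succ).1.1
    rw [Fin.cons_succ] at h1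
    refine Finset.mem_of_mem_insert_of_ne (h1 (Finset.mem_insert_of_mem hj)) ?_
    rintro rfl
    exact hG i hj
  have h1 := hf 0
  rw [Fin.cons_zero] at h1
  refine ⟨?_, fun i j hij => ?_, fun i => ⟨?_, ?_⟩⟩
  · rw [FlatIn.contract_iff he (Finset.empty_subset _)]
    exact h1.1
  · have := hm (Fin.succ_le_succ_iff.2 hij)
    simp only [Fin.cons_succ] at this
    intro x hx
    refine Finset.mem_of_mem_insert_of_ne (this (Finset.mem_insert_of_mem hx)) ?_
    rintro rfl
    exact hG i hx
  · rw [FlatIn.contract_iff he (hGE i)]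
    have := (hf i.succ).1
    rwa [Fin.cons_succ] at this
  · have := (hf i.succ).2
    rw [Fin.cons_succ] at this
    have h2 := h1.2
    simp only [Fin.val_zero, insert_empty_eq, Fin.val_succ] at *
    omega

/-- Position `i` of a flag of the contraction is position `i + 1` of the flag starting with `{e}`.
All flats of the latter contain `e`, so `A ↦ insert e A` matches the nonzero terms of the two
relations. -/
theorem restrictToFirst_mem (he : e ∉ E) {z : (Fin (p + 1) → Finset α) → ℝ}
    (hz : z ∈ flagCochains (insert e E) r (p + 1)) :
    restrictToFirst e p z ∈ flagCochains E (fun S => r (insert e S)) p := by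
  obtain ⟨hz1, hz2⟩ := hz
  refine ⟨fun G hG => ?_, fun G i hi => ?_⟩
  · by_cases h : ∀ i, e ∉ G i
    · simp only [restrictToFirst, LinearMap.coe_mk, AddHom.coe_mk, if_pos h] at hG
      exact (hz1 _ hG).of_cons he h
    · simp [restrictToFirst, h] at hG
  · by_cases h : ∀ j, j ≠ i → e ∉ G j
    · have key := hz2 (Fin.cons (α := fun _ => Finset α) {e} fun j => insert e (G j)) i.succ
        (by simpa using hi)
      have hcond : ∀ A, (∀ j, e ∉ Function.update G i A j) ↔ e ∉ A := fun A =>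
        ⟨fun h' => by simpa using h' i, fun h' j => by
          by_cases hj : j = i
          · subst hj; simpa using h'
          · simpa [hj] using h j hj⟩
      have hupd : ∀ A, (Fin.cons (α := fun _ => Finset α) {e}
            fun j => insert e (Function.update G i A j)) =
          Function.update (Fin.cons (α := fun _ => Finset α) {e} fun j => insert e (G j)) i.succ
            (insert e A) := by
        intro A; ext1 j
        refine Fin.cases ?_ (fun j => ?_) j
        · rw [Function.update_of_ne (Fin.succ_ne_zero i).symm]; simp
        · by_cases hj : j = i
          · subst hj; simp
          · rw [Function.update_of_ne (by simpa using hj)]; simp [hj]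
      rw [← key]
      simp only [restrictToFirst, LinearMap.coe_mk, AddHom.coe_mk, hcond, hupd]
      rw [← Finset.sum_filter]
      refine Finset.sum_of_injOn (fun A => insert e A) ?_ (by simp) ?_ (by simp)
      · intro A hA B hB hAB
        simp only [Finset.coe_filter, Finset.mem_univ, true_and, Set.mem_ofPred_eq] at hA hB
        rw [← Finset.erase_insert hA, ← Finset.erase_insert hB]
        exact congrArg (fun S => S.erase e) hAB
      · intro B _ hB
        by_contra hne
        obtain ⟨-, hm, -⟩ := hz1 _ hne
        have := hm (Fin.zero_le i.succ)
        rw [Function.update_self, Function.update_of_ne (Fin.succ_ne_zero i).symm,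
          Fin.cons_zero, Finset.singleton_subset_iff] at this
        exact hB ⟨B.erase e, by simp, Finset.insert_erase this⟩
    · push Not at h
      obtain ⟨j, hj, hej⟩ := h
      refine Finset.sum_eq_zero fun A _ => ?_
      have : ¬ ∀ k, e ∉ Function.update G i A k := fun h => h j (by simpa [hj] using hej)
      simp only [restrictToFirst, LinearMap.coe_mk, AddHom.coe_mk, if_neg this]

/-- The flat that precedes `G i` in the flag `G`. -/
def prevFlat (G : Fin p → Finset α) (i : Fin p) : Finset α :=
  if h : (i : ℕ) = 0 then ∅ else G ⟨i - 1, by omega⟩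

theorem IsInitialFlag.prevFlat_spec {G : Fin p → Finset α} (h : IsInitialFlag E r G) (i : Fin p) :
    FlatIn E r (prevFlat G i) ∧ r (prevFlat G i) = r ∅ + i ∧ prevFlat G i ⊆ G i := by
  unfold prevFlat
  split_ifs with hi
  · exact ⟨h.1, by omega, Finset.empty_subset _⟩
  · refine ⟨(h.2.2 _).1, ?_, h.2.1 (Fin.mk_le_of_le_val (by simp))⟩
    have := (h.2.2 ⟨i - 1, by omega⟩).2
    simp only at this
    omega

theorem prevFlat_update (G : Fin p → Finset α) (i : Fin p) (A : Finset α) :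
    prevFlat (Function.update G i A) i = prevFlat G i := by
  unfold prevFlat
  split_ifs with hi
  · rfl
  · rw [Function.update_of_ne]
    intro h
    have := congrArg Fin.val h
    simp only at this
    omega

/-! ### Deletion: cochains avoiding a given point -/

/-- The cochains that vanish on all flags starting with `{e}`. -/
def flagCochainsAvoiding (E : Finset α) (r : Finset α → ℕ) (e : α) (p : ℕ) :
    Submodule ℝ ((Fin p → Finset α) → ℝ) where
  carrier := {z | z ∈ flagCochains (insert e E) r p ∧
    ∀ (G : Fin p → Finset α) (h : 0 < p), G ⟨0, h⟩ = {e} → z G = 0}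
  zero_mem' := ⟨Submodule.zero_mem _, by simp⟩
  add_mem' := by
    rintro z w ⟨h1, h2⟩ ⟨h3, h4⟩
    exact ⟨Submodule.add_mem _ h1 h3, fun G h h' => by simp [h2 G h h', h4 G h h']⟩
  smul_mem' := by
    rintro c z ⟨h1, h2⟩
    exact ⟨Submodule.smul_mem _ c h1, fun G h h' => by simp [h2 G h h']⟩

/-- The vanishing on flags that begin by adding `e` alone propagates to flags that add `e` alone at
a later step. If a flat is its predecessor `G i` together with `e`, the flats that can replace `G i`
are `G i` itself and possibly `insert e (prevFlat G i)`. The second one adds `e` alone one step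
earlier, so the relation at position `i` leaves only `z G`. -/
theorem flagCochainsAvoiding_eq_zero_of_insert (hr : IsRankFn r) {z : (Fin p → Finset α) → ℝ}
    (hz : z ∈ flagCochainsAvoiding E r e p) (n : ℕ) :
    ∀ (hn : n < p) (G : Fin p → Finset α), e ∉ prevFlat G ⟨n, hn⟩ →
      G ⟨n, hn⟩ = insert e (prevFlat G ⟨n, hn⟩) → z G = 0 := by
  obtain ⟨⟨hz1, hz2⟩, hz3⟩ := hz
  induction n with
  | zero =>
    intro hn G _ hG
    exact hz3 G hn (by simpa [prevFlat] using hG)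
  | succ n ih =>
    intro hn G he hG
    by_contra hne
    have hfl := hz1 G hne
    have hprev : prevFlat G ⟨n + 1, hn⟩ = G ⟨n, by omega⟩ := by simp [prevFlat]
    rw [hprev] at he hG
    set i : Fin p := ⟨n, by omega⟩ with hi
    obtain ⟨hp1, hp2, hp3⟩ := hfl.prevFlat_spec i
    apply hne
    rw [← hz2 G i hn, Finset.sum_eq_single_of_mem (G i) (Finset.mem_univ _),
      Function.update_eq_self]
    intro A _ hA
    by_contra hAne
    have hfA := hz1 _ hAne
    have hlt : i < (⟨n + 1, hn⟩ : Fin p) := Fin.mk_lt_mk.2 (by omega)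
    have hA1 : FlatIn (insert e E) r A := by simpa using (hfA.2.2 i).1
    have hA2 : r A = r ∅ + n + 1 := by simpa using (hfA.2.2 i).2
    have hA3 : A ⊆ insert e (G i) := by
      have := hfA.2.1 hlt.le
      rwa [Function.update_self, Function.update_of_ne hlt.ne', hG] at this
    have hA4 : prevFlat G i ⊆ A := by
      have := (hfA.prevFlat_spec i).2.2
      rwa [prevFlat_update, Function.update_self] at this
    by_cases heA : e ∈ A
    · refine hAne (ih (by omega) (Function.update G i A) ?_ ?_)
      · rw [prevFlat_update]
        exact fun h => he (hp3 h)
      · rw [prevFlat_update, Function.update_self]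
        refine Finset.Subset.antisymm (fun f hf => ?_) (Finset.insert_subset heA hA4)
        by_contra hfn
        rw [Finset.mem_insert, not_or] at hfn
        have hfG : f ∈ G i := Finset.mem_of_mem_insert_of_ne (hA3 hf) hfn.1
        have h1 := hp1.eq_clIn_insert hr hA1 hA4 (by rw [hA2, hp2]) hf hfn.2
        rw [← h1] at heA
        exact he ((hfl.2.2 i).1.clIn_subset hr (Finset.insert_subset hfG hp3) heA)
    · refine hA (hA1.eq_of_rank_le hr (hfl.2.2 i).1.1 (fun f hf => ?_) ?_)
      · exact Finset.mem_of_mem_insert_of_ne (hA3 hf) fun h => heA (h ▸ hf)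
      · rw [hA2, (hfl.2.2 i).2]

/-- On a flag in the support, `e` is never a coloop of a flat. If `e` lies in the preceding flat, it
is already spanned there by other elements; otherwise, a coloop `e` would make the flat equal to the
preceding one plus `e`, which is excluded. -/
theorem rank_erase_of_flagCochainsAvoiding (hr : IsRankFn r) {z : (Fin p → Finset α) → ℝ}
    (hz : z ∈ flagCochainsAvoiding E r e p) {G : Fin p → Finset α} (hG : z G ≠ 0) (n : ℕ) :
    ∀ hn : n < p, r ((G ⟨n, hn⟩).erase e) = r (G ⟨n, hn⟩) := by
  have hfl := hz.1.1 G hG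
  have key : ∀ (n : ℕ) (hn : n < p), (e ∈ prevFlat G ⟨n, hn⟩ →
      r ((prevFlat G ⟨n, hn⟩).erase e) = r (prevFlat G ⟨n, hn⟩)) →
      r ((G ⟨n, hn⟩).erase e) = r (G ⟨n, hn⟩) := by
    intro n hn hprev
    set i : Fin p := ⟨n, hn⟩
    obtain ⟨hp1, hp2, hp3⟩ := hfl.prevFlat_spec i
    obtain ⟨hG1, hG2⟩ := hfl.2.2 i
    by_contra hne
    have heG : e ∈ G i := by
      by_contra h
      exact hne (by rw [Finset.erase_eq_of_notMem h])
    have hins : insert e ((G i).erase e) = G i := Finset.insert_erase heG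
    have hlt : r ((G i).erase e) < r (G i) :=
      lt_of_le_of_ne (hr.mono (Finset.erase_subset _ _)) hne
    have hrk : r (G i) = r ((G i).erase e) + 1 := by
      have := hr.insert_le e ((G i).erase e)
      rw [hins] at this
      omega
    by_cases hep : e ∈ prevFlat G i
    · have h1 := hprev hep
      have h2 : r (insert e ((prevFlat G i).erase e)) = r ((prevFlat G i).erase e) := by
        rw [Finset.insert_erase hep, h1]
      have h3 := hr.insert_eq_of_subset (Finset.erase_subset_erase e hp3) h2
      rw [hins] at h3
      omega
    · have hsub : prevFlat G i ⊆ (G i).erase e := fun x hx =>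
        Finset.mem_erase.2 ⟨fun h => hep (h ▸ hx), hp3 hx⟩
      have heq := hp1.eq_of_rank_le hr ((Finset.erase_subset _ _).trans hG1.1) hsub (by omega)
      exact hG (flagCochainsAvoiding_eq_zero_of_insert hr hz n hn G hep
        (by rw [heq, hins]))
  induction n with
  | zero => exact fun hn => key 0 hn (by simp [prevFlat])
  | succ n ih =>
    intro hn
    refine key (n + 1) hn fun _ => ?_
    simpa [prevFlat] using ih (by omega)

theorem erase_of_flagCochainsAvoiding (hr : IsRankFn r) (he : e ∉ E)
    {z : (Fin p → Finset α) → ℝ} (hz : z ∈ flagCochainsAvoiding E r e p) {G : Fin p → Finset α}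
    (hG : z G ≠ 0) :
    IsInitialFlag E r (fun i => (G i).erase e) ∧
      ∀ i, clIn (insert e E) r ((G i).erase e) = G i := by
  have hfl := hz.1.1 G hG
  have hrk : ∀ i : Fin p, r ((G i).erase e) = r (G i) := fun i =>
    rank_erase_of_flagCochainsAvoiding hr hz hG i i.2
  refine ⟨⟨by simpa using hfl.1.erase hr he, fun i j hij =>
    Finset.erase_subset_erase e (hfl.2.1 hij), fun i => ⟨(hfl.2.2 i).1.erase hr he, ?_⟩⟩, fun i => ?_⟩
  · rw [hrk, (hfl.2.2 i).2]
  · have hsub := (Finset.erase_subset e (G i)).trans (hfl.2.2 i).1.1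
    refine (hr.flatIn_clIn hsub).eq_of_rank_le hr (hfl.2.2 i).1.1
      ((hfl.2.2 i).1.clIn_subset hr (Finset.erase_subset _ _)) ?_
    rw [hr.rank_clIn hsub, hrk]

/-- Pull-back of cochains along the closure map from flags of the deletion. -/
noncomputable def closurePullback (E : Finset α) (r : Finset α → ℕ) (e : α) (p : ℕ) :
    ((Fin p → Finset α) → ℝ) →ₗ[ℝ] ((Fin p → Finset α) → ℝ) where
  toFun z H := if IsInitialFlag E r H then z fun i => clIn (insert e E) r (H i) else 0
  map_add' z w := by ext H; by_cases h : IsInitialFlag E r H <;> simp [h]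
  map_smul' c z := by ext H; by_cases h : IsInitialFlag E r H <;> simp [h]

theorem closurePullback_injOn (hr : IsRankFn r) (he : e ∉ E) {z : (Fin p → Finset α) → ℝ}
    (hz : z ∈ flagCochainsAvoiding E r e p) (h0 : closurePullback E r e p z = 0) : z = 0 := by
  ext G
  by_contra hG
  obtain ⟨h1, h2⟩ := erase_of_flagCochainsAvoiding hr he hz hG
  have := congrFun h0 fun i => (G i).erase e
  simp only [closurePullback, LinearMap.coe_mk, AddHom.coe_mk, if_pos h1, h2] at this
  exact hG this

/-- Closure matches the terms of the relation for the deletion with those of the relation for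
`insert e E`. The terms not reached vanish, since every flag in the support of `z` is the closure of
its erasure. -/
theorem closurePullback_mem (hr : IsRankFn r) (he : e ∉ E) {z : (Fin p → Finset α) → ℝ}
    (hz : z ∈ flagCochainsAvoiding E r e p) : closurePullback E r e p z ∈ flagCochains E r p := by
  refine ⟨fun H hH => ?_, fun H i hi => ?_⟩
  · by_contra h
    simp [closurePullback, h] at hH
  -- An admissible entry `A₀` certifies that the other entries of `H` are flats, so that erasing `e`
  -- undoes their closure. Without one, all terms vanish.
  · by_cases hex : ∃ A₀, IsInitialFlag E r (Function.update H i A₀)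
    · obtain ⟨A₀, hA₀⟩ := hex
      rw [← hz.1.2 (fun j => clIn (insert e E) r (H j)) i hi]
      simp only [closurePullback, LinearMap.coe_mk, AddHom.coe_mk]
      rw [← Finset.sum_filter]
      have hcl : ∀ A, (fun j => clIn (insert e E) r (Function.update H i A j)) =
          Function.update (fun j => clIn (insert e E) r (H j)) i (clIn (insert e E) r A) := by
        intro A; ext1 j
        by_cases hj : j = i
        · subst hj; simp
        · simp [hj]
      refine Finset.sum_of_injOn (clIn (insert e E) r) ?_ (by simp) ?_ (by simp [hcl])
      · intro A hA B hB hAB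
        simp only [Finset.coe_filter, Finset.mem_univ, true_and, Set.mem_ofPred_eq] at hA hB
        have hA' := (hA.2.2 i).1
        have hB' := (hB.2.2 i).1
        rw [Function.update_self] at hA' hB'
        rw [← hA'.clIn_insert_erase he, ← hB'.clIn_insert_erase he, hAB]
      · intro B _ hB
        by_contra hne
        obtain ⟨h1, h2⟩ := erase_of_flagCochainsAvoiding hr he hz hne
        have heq : (fun j => (Function.update (fun j => clIn (insert e E) r (H j)) i B j).erase e) =
            Function.update H i (B.erase e) := by
          ext1 j
          by_cases hj : j = i
          · subst hj; simp
          · have := (hA₀.2.2 j).1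
            simp only [Function.update_of_ne hj] at this ⊢
            exact this.clIn_insert_erase he
        rw [heq] at h1
        have h3 := h2 i
        rw [Function.update_self] at h3
        exact hB ⟨B.erase e, by simpa using h1, h3⟩
    · push Not at hex
      exact Finset.sum_eq_zero fun A _ => by simp [closurePullback, hex A]

theorem finrank_flagCochainsAvoiding_le (hr : IsRankFn r) (he : e ∉ E) :
    Module.finrank ℝ (flagCochainsAvoiding E r e p) ≤ Module.finrank ℝ (flagCochains E r p) := by
  let f : flagCochainsAvoiding E r e p →ₗ[ℝ] flagCochains E r p :=
    (closurePullback E r e p).restrict fun z hz => closurePullback_mem hr he hz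
  refine LinearMap.finrank_le_finrank_of_injective (f := f) ?_
  rw [← LinearMap.ker_eq_bot, LinearMap.ker_eq_bot']
  intro z hz
  exact Subtype.ext (closurePullback_injOn hr he z.2 (congrArg Subtype.val hz))

theorem finrank_flagCochains_insert_zero (hr : IsRankFn r) (he : e ∉ E) :
    Module.finrank ℝ (flagCochains (insert e E) r 0) ≤ Module.finrank ℝ (flagCochains E r 0) := by
  refine le_trans (Submodule.finrank_mono (t := flagCochainsAvoiding E r e 0) ?_)
    (finrank_flagCochainsAvoiding_le hr he)
  exact fun z hz => ⟨hz, fun G h => absurd h (lt_irrefl _)⟩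

/-- Rank-nullity for the restriction to flags starting with `{e}`: its kernel consists of cochains
avoiding `{e}`, which embed into the cochains of the deletion. -/
theorem finrank_flagCochains_insert_succ (hr : IsRankFn r) (he : e ∉ E) :
    Module.finrank ℝ (flagCochains (insert e E) r (p + 1)) ≤
      Module.finrank ℝ (flagCochains E r (p + 1)) +
        Module.finrank ℝ (flagCochains E (fun S => r (insert e S)) p) := by
  let f : flagCochains (insert e E) r (p + 1) →ₗ[ℝ] flagCochains E (fun S => r (insert e S)) p :=
    (restrictToFirst e p).restrict fun z hz => restrictToFirst_mem he hz
  rw [← f.finrank_range_add_finrank_ker, add_comm]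
  refine add_le_add (le_trans ?_ (finrank_flagCochainsAvoiding_le hr he))
    (Submodule.finrank_le _)
  have hmem : ∀ z : LinearMap.ker f, (z : (Fin (p + 1) → Finset α) → ℝ) ∈
      flagCochainsAvoiding E r e (p + 1) := by
    rintro ⟨⟨z, hz⟩, hk⟩
    refine ⟨hz, fun G _ hG0 => ?_⟩
    by_contra hne
    have hfl := hz.1 G hne
    have hG0' : G 0 = {e} := hG0
    have heq : (Fin.cons (α := fun _ => Finset α) {e}
        fun i : Fin p => insert e ((G i.succ).erase e)) = G := by
      ext1 j
      refine Fin.cases (by simp [hG0']) (fun j => ?_) j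
      rw [Fin.cons_succ, Finset.insert_erase]
      have := hfl.2.1 (Fin.zero_le j.succ)
      rwa [hG0', Finset.singleton_subset_iff] at this
    have h1 := congrFun (congrArg Subtype.val (LinearMap.mem_ker.1 hk))
      fun i => (G i.succ).erase e
    have h2 : restrictToFirst e p z (fun i => (G i.succ).erase e) = 0 := h1
    simp only [restrictToFirst, LinearMap.coe_mk, AddHom.coe_mk, Finset.notMem_erase,
      not_false_eq_true, implies_true, if_true] at h2
    rw [heq] at h2
    exact hne h2
  let g : LinearMap.ker f →ₗ[ℝ] flagCochainsAvoiding E r e (p + 1) :=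
    LinearMap.codRestrict _ ((Submodule.subtype _).comp (Submodule.subtype _)) hmem
  refine LinearMap.finrank_le_finrank_of_injective (f := g) fun z w h => ?_
  have h' := congrArg Subtype.val h
  exact Subtype.ext (Subtype.ext h')

/-- Deletion-contraction induction, with `r` varying since contraction changes it. A loop makes both
sides zero: `∅` is then not a flat and there are no initial flags. -/
theorem finrank_flagCochains_le (E : Finset α) : ∀ {r : Finset α → ℕ}, IsRankFn r → ∀ p,
    (Module.finrank ℝ (flagCochains E r p) : ℤ) ≤ (charPolyIn E r).coeff p := by
  induction E using Finset.induction_on with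
  | empty =>
    intro r hr p
    rw [charPolyIn_empty]
    cases p with
    | zero =>
      have h : Module.finrank ℝ (flagCochains (∅ : Finset α) r 0) ≤ 1 :=
        (Submodule.finrank_le _).trans (by simp)
      simpa using h
    | succ p =>
      have : flagCochains (∅ : Finset α) r (p + 1) = ⊥ := by
        rw [eq_bot_iff]
        rintro z ⟨hz, -⟩
        ext G
        by_contra hG
        obtain ⟨-, -, h⟩ := hz G hG
        obtain ⟨h1, h2⟩ := h 0
        rw [Finset.subset_empty.1 h1.1] at h2
        simp at h2
      rw [this]
      simp [Polynomial.coeff_one]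
  | insert e E he ih =>
    intro r hr p
    by_cases hloop : r {e} = r ∅
    · rw [charPolyIn_loop hr (Finset.mem_insert_self e E) hloop]
      have : flagCochains (insert e E) r p = ⊥ := by
        rw [eq_bot_iff]
        rintro z ⟨hz, -⟩
        ext G
        by_contra hG
        have := (hz G hG).1.2 e (Finset.mem_insert_self e E) (Finset.notMem_empty e)
        rw [insert_empty_eq, hloop] at this
        exact lt_irrefl _ this
      rw [this]
      simp
    · have hrk : r {e} = r ∅ + 1 := by
        have h1 := hr.insert_le e ∅
        have h2 : r ∅ ≤ r {e} := hr.mono (Finset.empty_subset _)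
        rw [insert_empty_eq] at h1
        omega
      rw [charPolyIn_insert hr he hrk, Polynomial.coeff_add]
      cases p with
      | zero =>
        rw [Polynomial.coeff_X_mul_zero, add_zero]
        exact (Int.ofNat_le.2 (finrank_flagCochains_insert_zero hr he)).trans (ih hr 0)
      | succ p =>
        rw [Polynomial.coeff_X_mul]
        have h1 := finrank_flagCochains_insert_succ (p := p) hr he
        have h2 := ih hr (p + 1)
        have h3 := ih (hr.contract e) p
        zify at h1
        linarith

end FlagCochains

/-! ### Alternating forms restricted to flags of flats -/

section FlagForms

set_option linter.unusedSectionVars false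

instance alternatingForms_finite {V : Type*} [AddCommGroup V] [Module ℝ V] [Module.Finite ℝ V]
    (p : ℕ) : Module.Finite ℝ (V [⋀^Fin p]→ₗ[ℝ] ℝ) :=
  Module.Finite.equiv (exteriorPower.alternatingMapLinearEquiv (R := ℝ) (M := V) (N := ℝ)
    (n := p)).symm

/-- Pull-back of alternating forms, as a linear map. -/
def pullbackForms {V W : Type*} [AddCommGroup V] [Module ℝ V] [AddCommGroup W] [Module ℝ W]
    (f : V →ₗ[ℝ] W) (p : ℕ) : (W [⋀^Fin p]→ₗ[ℝ] ℝ) →ₗ[ℝ] (V [⋀^Fin p]→ₗ[ℝ] ℝ) where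
  toFun ω := ω.compLinearMap f
  map_add' ω η := by ext v; simp
  map_smul' c ω := by ext v; simp

variable {α : Type*} [DecidableEq α] [Fintype α]

/-- The alternating forms that vanish on the indicator vectors of all families of pairwise
comparable flats. If there is a loop, these are all forms. -/
def formsVanishing (E : Finset α) (r : Finset α → ℕ) (p : ℕ) :
    Submodule ℝ ((α → ℝ) [⋀^Fin p]→ₗ[ℝ] ℝ) where
  carrier := {ω | FlatIn E r ∅ → ∀ G : Fin p → Finset α, (∀ i, FlatIn E r (G i)) →
    (∀ i j, G i ⊆ G j ∨ G j ⊆ G i) → ω (fun i => indVec (G i)) = 0}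
  zero_mem' := by simp
  add_mem' := fun h1 h2 h G hG hc => by simp [h1 h G hG hc, h2 h G hG hc]
  smul_mem' := fun c ω h1 h G hG hc => by simp [h1 h G hG hc]

variable {E : Finset α} {r : Finset α → ℕ} {e : α} {p : ℕ}

theorem subset_prevFlat {G : Fin p → Finset α} (hG : Monotone G) {i j : Fin p} (h : j < i) :
    G j ⊆ prevFlat G i := by
  have h' : (j : ℕ) < i := h
  unfold prevFlat
  rw [dif_neg (by omega)]
  exact hG (Fin.mk_le_mk.2 (by omega))

theorem monotone_update {G : Fin p → Finset α} (hG : Monotone G) {i : Fin p} {A : Finset α}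
    (h1 : prevFlat G i ⊆ A) (h2 : ∀ j, i < j → A ⊆ G j) : Monotone (Function.update G i A) := by
  intro j k hjk
  rcases eq_or_ne j i with rfl | hj
  · rcases eq_or_ne k j with rfl | hk
    · exact subset_rfl
    · rw [Function.update_self, Function.update_of_ne hk]
      exact h2 k (lt_of_le_of_ne hjk hk.symm)
  · rcases eq_or_ne k i with rfl | hk
    · rw [Function.update_self, Function.update_of_ne hj]
      exact (subset_prevFlat hG (lt_of_le_of_ne hjk hj)).trans h1
    · rw [Function.update_of_ne hj, Function.update_of_ne hk]
      exact hG hjk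

/-- Either an argument is repeated or, at the first position, the inserted vector is zero. -/
theorem map_update_prevFlat (ω : (α → ℝ) [⋀^Fin p]→ₗ[ℝ] ℝ) (G : Fin p → Finset α) (i : Fin p) :
    ω (Function.update (fun j => indVec (G j)) i (indVec (prevFlat G i))) = 0 := by
  unfold prevFlat
  split_ifs with hi
  · rw [indVec_empty]
    exact ω.map_update_zero _ _
  · exact ω.map_update_self (fun j => indVec (G j)) (i := i) (j := ⟨i - 1, by omega⟩) (by
      intro h
      have := congrArg Fin.val h
      simp only at this
      omega)

theorem indVec_comp_update (G : Fin p → Finset α) (i : Fin p) (A : Finset α) :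
    (fun j => indVec (Function.update G i A j)) =
      Function.update (fun j => indVec (G j)) i (indVec A) := by
  ext1 j
  by_cases hj : j = i
  · subst hj; simp
  · simp [hj]

/-- Expanding a form at a flat in terms of the covers of the preceding flat. -/
theorem sum_coversIn_map (hr : IsRankFn r) (ω : (α → ℝ) [⋀^Fin p]→ₗ[ℝ] ℝ) (G : Fin p → Finset α)
    (i : Fin p) {H : Finset α} (hp : FlatIn E r (prevFlat G i)) (hH : FlatIn E r H)
    (hpH : prevFlat G i ⊆ H) :
    ∑ A ∈ coversIn E r (prevFlat G i) H, ω (fun j => indVec (Function.update G i A j)) =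
      ω (Function.update (fun j => indVec (G j)) i (indVec H)) := by
  have h1 := sum_coversIn_indVec hr hp hH hpH
  have h2 := congrArg (fun v => ω (Function.update (fun j => indVec (G j)) i v)) h1
  simp only [ω.map_update_sum, ω.map_update_sub, map_update_prevFlat, sub_zero] at h2
  rw [← h2]
  exact Finset.sum_congr rfl fun A _ => by rw [indVec_comp_update]

/-- Evaluation of forms on initial flags. -/
noncomputable def evalInitialFlags (E : Finset α) (r : Finset α → ℕ) (p : ℕ) :
    ((α → ℝ) [⋀^Fin p]→ₗ[ℝ] ℝ) →ₗ[ℝ] ((Fin p → Finset α) → ℝ) where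
  toFun ω G := if IsInitialFlag E r G then ω (fun i => indVec (G i)) else 0
  map_add' ω η := by ext G; by_cases h : IsInitialFlag E r G <;> simp [h]
  map_smul' c ω := by ext G; by_cases h : IsInitialFlag E r G <;> simp [h]

/-- The covers of the preceding flat partition the difference to the next flat. So summing over
position `i` inserts the indicator of the next flat, which already occurs as an argument. The last
position has no next flat, hence no relation. -/
theorem evalInitialFlags_mem (hr : IsRankFn r) (ω : (α → ℝ) [⋀^Fin p]→ₗ[ℝ] ℝ) :
    evalInitialFlags E r p ω ∈ flagCochains E r p := by
  refine ⟨fun G hG => ?_, fun G i hi => ?_⟩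
  · by_contra h
    simp [evalInitialFlags, h] at hG
  by_cases hex : ∃ A₀, IsInitialFlag E r (Function.update G i A₀)
  swap
  · push Not at hex
    exact Finset.sum_eq_zero fun A _ => by simp [evalInitialFlags, hex A]
  obtain ⟨A₀, hA₀⟩ := hex
  -- The sum does not see the entry `G i`, so `G` may be replaced by an initial flag that differs
  -- from it only there.
  suffices ∀ H, IsInitialFlag E r H →
      ∑ A, evalInitialFlags E r p ω (Function.update H i A) = 0 by simpa using this _ hA₀
  clear hA₀ A₀
  intro H hA₀
  obtain ⟨hp1, hp2, hp3⟩ := hA₀.prevFlat_spec i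
  have hlt : i < (⟨i + 1, hi⟩ : Fin p) := Fin.lt_def.2 (by simp)
  have hiff : ∀ A, IsInitialFlag E r (Function.update H i A) ↔
      A ∈ coversIn E r (prevFlat H i) (H ⟨i + 1, hi⟩) := by
    intro A
    rw [mem_coversIn]
    constructor
    · intro h
      have h1 := h.prevFlat_spec i
      have h2 := h.2.2 i
      have h3 := h.2.1 hlt.le
      rw [prevFlat_update, Function.update_self] at h1
      rw [Function.update_self] at h2
      rw [Function.update_self, Function.update_of_ne hlt.ne'] at h3
      exact ⟨h3, h2.1, h1.2.2, by rw [h2.2, hp2]⟩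
    · rintro ⟨h1, h2, h3, h4⟩
      refine ⟨hA₀.1, monotone_update hA₀.2.1 h3 fun j hj => h1.trans (hA₀.2.1 ?_), fun j => ?_⟩
      · exact Fin.le_def.2 hj
      · by_cases hj : j = i
        · subst hj
          rw [Function.update_self]
          exact ⟨h2, by rw [h4, hp2]⟩
        · rw [Function.update_of_ne hj]
          exact hA₀.2.2 j
  simp only [evalInitialFlags, LinearMap.coe_mk, AddHom.coe_mk, hiff]
  rw [← Finset.sum_filter, Finset.filter_mem_eq_inter, Finset.univ_inter,
    sum_coversIn_map hr ω H i hp1 (hA₀.2.2 _).1 (hp3.trans (hA₀.2.1 hlt.le))]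
  exact ω.map_update_self (fun j => indVec (H j)) hlt.ne

theorem exists_perm_monotone {G : Fin p → Finset α} (hc : ∀ i j, G i ⊆ G j ∨ G j ⊆ G i) :
    ∃ σ : Equiv.Perm (Fin p), Monotone (G ∘ σ) := by
  refine ⟨Tuple.sort fun i => (G i).card, fun i j hij => ?_⟩
  have h := Tuple.monotone_sort (fun i => (G i).card) hij
  rcases hc (Tuple.sort (fun i => (G i).card) i) (Tuple.sort (fun i => (G i).card) j) with h1 | h1
  · exact h1
  · exact (Finset.eq_of_subset_of_card_le h1 h).symm.subset

/-- Chains of arbitrary flats reduce to initial flags by expanding one entry at a time into the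
covers of the preceding flat. -/
theorem ker_evalInitialFlags_le (hr : IsRankFn r) :
    LinearMap.ker (evalInitialFlags E r p) ≤ formsVanishing E r p := by
  intro ω hω h0 G hG hc
  have hω' : ∀ H : Fin p → Finset α, IsInitialFlag E r H → ω (fun i => indVec (H i)) = 0 := by
    intro H hH
    have := congrFun (LinearMap.mem_ker.1 hω) H
    simpa [evalInitialFlags, hH] using this
  -- Here `m` bounds the number of final entries whose rank is not yet the one required; the
  -- induction step expands the first of them.
  have key : ∀ m ≤ p, ∀ H : Fin p → Finset α, Monotone H → (∀ i, FlatIn E r (H i)) →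
      (∀ i : Fin p, (i : ℕ) < p - m → r (H i) = r ∅ + i + 1) → ω (fun i => indVec (H i)) = 0 := by
    intro m hm
    induction m with
    | zero => exact fun H h1 h2 h3 => hω' H ⟨h0, h1, fun i => ⟨h2 i, h3 i (by omega)⟩⟩
    | succ m ih =>
      intro H h1 h2 h3
      have hp : FlatIn E r (prevFlat H ⟨p - (m + 1), by omega⟩) ∧
          r (prevFlat H ⟨p - (m + 1), by omega⟩) = r ∅ + (p - (m + 1)) ∧
          prevFlat H ⟨p - (m + 1), by omega⟩ ⊆ H ⟨p - (m + 1), by omega⟩ := by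
        unfold prevFlat
        split_ifs with hi
        · simp only at hi
          exact ⟨h0, by omega, Finset.empty_subset _⟩
        · simp only at hi
          refine ⟨h2 _, ?_, h1 (Fin.mk_le_mk.2 (by simp))⟩
          rw [h3 _ (by simp only; omega)]
          simp only
          omega
      set i : Fin p := ⟨p - (m + 1), by omega⟩ with hi
      have h4 := sum_coversIn_map hr ω H i hp.1 (h2 i) hp.2.2
      rw [Function.update_eq_self i (fun j => indVec (H j))] at h4
      rw [← h4]
      refine Finset.sum_eq_zero fun A hA => ?_
      obtain ⟨hA1, hA2, hA3, hA4⟩ := mem_coversIn.1 hA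
      refine ih (by omega) _ (monotone_update h1 hA3 fun j hj => hA1.trans (h1 hj.le))
        (fun j => ?_) (fun j hj => ?_)
      · by_cases hji : j = i
        · subst hji; simpa using hA2
        · rw [Function.update_of_ne hji]
          exact h2 j
      · by_cases hji : j = i
        · rw [hji, Function.update_self, hA4, hp.2.1]
        · rw [Function.update_of_ne hji]
          refine h3 j ?_
          have : (j : ℕ) ≠ p - (m + 1) := fun h => hji (Fin.ext h)
          omega
  obtain ⟨σ, hσ⟩ := exists_perm_monotone hc
  have h1 := key p le_rfl (G ∘ σ) hσ (fun i => hG _) (fun i hi => by omega)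
  have h2 := ω.map_perm (fun i => indVec (G i)) σ
  have h3 : ((fun i => indVec (G i)) ∘ σ : Fin p → α → ℝ) = fun i => indVec ((G ∘ σ) i) := rfl
  rw [h3, h1] at h2
  rcases Int.units_eq_one_or (Equiv.Perm.sign σ) with h | h
  · rw [h, one_smul] at h2
    exact h2.symm
  · rw [h, Units.neg_smul, one_smul] at h2
    linarith

theorem finrank_quotient_formsVanishing_le (hr : IsRankFn r) :
    Module.finrank ℝ (((α → ℝ) [⋀^Fin p]→ₗ[ℝ] ℝ) ⧸ formsVanishing E r p) ≤
      Module.finrank ℝ (flagCochains E r p) := by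
  have h1 := (formsVanishing E r p).finrank_quotient_add_finrank
  have h2 := (evalInitialFlags E r p).finrank_range_add_finrank_ker
  have h3 := Submodule.finrank_mono (ker_evalInitialFlags_le (E := E) (p := p) hr)
  have h4 : Module.finrank ℝ (LinearMap.range (evalInitialFlags E r p)) ≤
      Module.finrank ℝ (flagCochains E r p) := by
    refine Submodule.finrank_mono ?_
    rintro _ ⟨ω, rfl⟩
    exact evalInitialFlags_mem hr ω
  omega

/-! ### Deletion and contraction for forms -/

/-- The projection that sets the coordinate `e` to zero. -/
def killCoord (e : α) : (α → ℝ) →ₗ[ℝ] (α → ℝ) where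
  toFun v i := if i = e then 0 else v i
  map_add' v w := by ext i; by_cases h : i = e <;> simp [h]
  map_smul' c v := by ext i; by_cases h : i = e <;> simp [h]

theorem killCoord_indVec (e : α) (S : Finset α) : killCoord e (indVec S) = indVec (S.erase e) := by
  ext i
  by_cases h : i = e <;> simp [killCoord, h]

theorem comp_killCoord_mem (hr : IsRankFn r) (he : e ∉ E) {ω : (α → ℝ) [⋀^Fin p]→ₗ[ℝ] ℝ}
    (hω : ω ∈ formsVanishing E r p) :
    ω.compLinearMap (killCoord e) ∈ formsVanishing (insert e E) r p := by
  intro h0 G hG hc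
  simp only [AlternatingMap.compLinearMap_apply, killCoord_indVec]
  refine hω (by simpa using h0.erase hr he) (fun i => (G i).erase e) (fun i => (hG i).erase hr he)
    fun i j => ?_
  exact (hc i j).imp (Finset.erase_subset_erase e) (Finset.erase_subset_erase e)

theorem mem_of_comp_killCoord_mem (hr : IsRankFn r) (he : e ∉ E) (hrk : r {e} = r ∅ + 1)
    {ω : (α → ℝ) [⋀^Fin p]→ₗ[ℝ] ℝ}
    (hω : ω.compLinearMap (killCoord e) ∈ formsVanishing (insert e E) r p) :
    ω ∈ formsVanishing E r p := by
  intro h0 G hG hc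
  have h1 : FlatIn (insert e E) r ∅ := by
    refine ⟨Finset.empty_subset _, fun i hi hi0 => ?_⟩
    rcases Finset.mem_insert.1 hi with rfl | hi
    · rw [insert_empty_eq, hrk]
      exact Nat.lt_succ_self _
    · exact h0.2 i hi hi0
  have h2 := hω h1 (fun i => clIn (insert e E) r (G i))
    (fun i => hr.flatIn_clIn ((hG i).1.trans (Finset.subset_insert _ _)))
    fun i j => (hc i j).imp hr.clIn_mono hr.clIn_mono
  simpa only [AlternatingMap.compLinearMap_apply, killCoord_indVec,
    (hG _).clIn_insert_erase he] using h2

/-- An alternating form that vanishes when an argument is `a` does not see multiples of `a`. -/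
theorem alternating_add_smul {V : Type*} [AddCommGroup V] [Module ℝ V]
    (η : V [⋀^Fin p]→ₗ[ℝ] ℝ) (a : V) (h : ∀ v i, v i = a → η v = 0) (v : Fin p → V)
    (c : Fin p → ℝ) : η (fun i => v i + c i • a) = η v := by
  have h1 := η.toMultilinearMap.map_add_univ (fun i => c i • a) v
  have h2 : (fun i => v i + c i • a) = (fun i => c i • a) + v := by
    ext1 i; simp [add_comm]
  rw [h2]
  refine h1.trans ?_
  rw [Finset.sum_eq_single_of_mem ∅ (Finset.mem_univ _)]
  · simp
  · intro s _ hs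
    obtain ⟨i, hi⟩ := Finset.nonempty_iff_ne_empty.2 hs
    have h3 : s.piecewise (fun i => c i • a) v =
        Function.update (s.piecewise (fun i => c i • a) v) i (c i • a) := by
      rw [eq_comm, Function.update_eq_self_iff]
      simp [hi]
    rw [h3, MultilinearMap.map_update_smul]
    have h4 := h (Function.update (s.piecewise (fun i => c i • a) v) i a) i (by simp)
    have h5 : η.toMultilinearMap (Function.update (s.piecewise (fun i => c i • a) v) i a) = 0 := h4
    rw [h5, smul_zero]

/-- A chain of flats of the contraction becomes, after adding `e` to each, a chain of flats
containing `{e}`. With `indVec {e}` as first argument the form does not notice the added multiples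
of this vector. -/
theorem curryLeft_indVec_mem (hr : IsRankFn r) (he : e ∉ E) (hrk : r {e} = r ∅ + 1)
    {ω : (α → ℝ) [⋀^Fin (p + 1)]→ₗ[ℝ] ℝ}
    (hω : ω ∈ formsVanishing (insert e E) r (p + 1)) :
    ω.curryLeft (indVec {e}) ∈ formsVanishing E (fun S => r (insert e S)) p := by
  intro h0 G hG hc
  rw [FlatIn.contract_iff he (Finset.empty_subset _), insert_empty_eq] at h0
  have hl : FlatIn (insert e E) r ∅ := by
    refine ⟨Finset.empty_subset _, fun i hi _ => ?_⟩
    refine lt_of_le_of_ne (hr.mono (Finset.empty_subset _)) fun h => ?_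
    have hie : i ≠ e := fun h' => by
      rw [h', insert_empty_eq] at h
      omega
    have h2 := h0.2 i hi (by simpa using hie)
    rw [hr.insert_eq_of_subset (Finset.empty_subset {e}) h.symm] at h2
    exact lt_irrefl _ h2
  have h1 := hω hl (Fin.cons (α := fun _ => Finset α) {e} fun i => insert e (G i))
    (fun i => Fin.cases (by simpa using h0)
      (fun i => by simpa using (FlatIn.contract_iff he (hG i).1).1 (hG i)) i)
    (fun i j => by
      refine Fin.cases ?_ (fun i => ?_) i <;> refine Fin.cases ?_ (fun j => ?_) j
      · simp
      · left; simp
      · right; simp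
      · simpa using (hc i j).imp (Finset.insert_subset_insert e) (Finset.insert_subset_insert e))
  have h2 := alternating_add_smul (ω.curryLeft (indVec {e})) (indVec {e}) (fun v i hi => by
    rw [AlternatingMap.curryLeft_apply_apply]
    exact ω.map_eq_zero_of_eq _ (i := 0) (j := i.succ) (by simp [hi])
      (Fin.succ_ne_zero i).symm) (fun i => indVec (G i)) (fun _ => 1)
  rw [← h2, AlternatingMap.curryLeft_apply_apply, ← h1]
  congr 1
  ext1 i
  refine Fin.cases (by simp) (fun i => ?_) i
  have hei : e ∉ G i := fun h => he ((hG i).1 h)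
  ext j
  by_cases hj : j = e
  · subst hj; simp [hei]
  · simp [hj]

/-- The exterior product of the coordinate form of `e` with a form that does not involve `e`. -/
noncomputable def coordWedge (e : α) (γ : (α → ℝ) [⋀^Fin p]→ₗ[ℝ] ℝ) :
    (α → ℝ) [⋀^Fin (p + 1)]→ₗ[ℝ] ℝ :=
  AlternatingMap.alternatizeUncurryFin
    ((LinearMap.proj e : (α → ℝ) →ₗ[ℝ] ℝ).smulRight (γ.compLinearMap (killCoord e)))

theorem killCoord_self (e : α) : killCoord e (indVec {e}) = 0 := by
  rw [killCoord_indVec]; simp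

/-- In the alternating sum only the term with the first argument in the coordinate form survives. In
the others `indVec {e}` is an argument of the pulled-back `γ` and is killed by the projection. -/
theorem curryLeft_coordWedge (e : α) (γ : (α → ℝ) [⋀^Fin p]→ₗ[ℝ] ℝ) :
    (coordWedge e γ).curryLeft (indVec {e}) = γ.compLinearMap (killCoord e) := by
  ext v
  rw [AlternatingMap.curryLeft_apply_apply, coordWedge,
    AlternatingMap.alternatizeUncurryFin_apply, Fin.sum_univ_succ]
  rw [Finset.sum_eq_zero]
  · simp
  · intro i _
    have h : (γ.compLinearMap (killCoord e))
        (i.succ.removeNth (Matrix.vecCons (indVec {e}) v)) = 0 := by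
      rw [AlternatingMap.compLinearMap_apply]
      have hp : 0 < p := i.pos
      refine γ.map_coord_zero (i := ⟨0, hp⟩) ?_
      have : i.succ.removeNth (Matrix.vecCons (indVec {e}) v) ⟨0, hp⟩ = indVec {e} := by
        rw [Fin.removeNth_apply, Fin.succAbove_of_castSucc_lt]
        · rfl
        · exact Fin.lt_def.2 (by simp)
      rw [this, killCoord_self]
    simp only [LinearMap.smulRight_apply, AlternatingMap.smul_apply, h, smul_zero]

theorem comp_killCoord_sub_mem (he : e ∉ E) (γ : (α → ℝ) [⋀^Fin p]→ₗ[ℝ] ℝ) :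
    γ.compLinearMap (killCoord e) - γ ∈ formsVanishing E r p := by
  intro _ G hG _
  have h : ∀ i, (G i).erase e = G i := fun i =>
    Finset.erase_eq_of_notMem fun h => he ((hG i).1 h)
  simp [AlternatingMap.compLinearMap_apply, killCoord_indVec, h]

/-- The number of linearly independent restrictions of `p`-forms to the flags of flats. -/
noncomputable def formsRank (E : Finset α) (r : Finset α → ℕ) (p : ℕ) : ℕ :=
  Module.finrank ℝ (((α → ℝ) [⋀^Fin p]→ₗ[ℝ] ℝ) ⧸ formsVanishing E r p)

/-- The map induced by pulling back forms along `killCoord e`. -/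
noncomputable def pullbackQuot (hr : IsRankFn r) (he : e ∉ E) (p : ℕ) :
    (((α → ℝ) [⋀^Fin p]→ₗ[ℝ] ℝ) ⧸ formsVanishing E r p) →ₗ[ℝ]
      (((α → ℝ) [⋀^Fin p]→ₗ[ℝ] ℝ) ⧸ formsVanishing (insert e E) r p) :=
  Submodule.mapQ _ _ (pullbackForms (killCoord e) p) fun _ hω =>
    comp_killCoord_mem hr he hω

theorem pullbackQuot_injective (hr : IsRankFn r) (he : e ∉ E) (hrk : r {e} = r ∅ + 1) :
    Function.Injective (pullbackQuot hr he p) := by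
  rw [← LinearMap.ker_eq_bot, LinearMap.ker_eq_bot']
  intro x hx
  obtain ⟨ω, rfl⟩ := Submodule.Quotient.mk_surjective _ x
  change Submodule.Quotient.mk (ω.compLinearMap (killCoord e)) = _ at hx
  rw [Submodule.Quotient.mk_eq_zero] at hx
  rw [Submodule.Quotient.mk_eq_zero]
  exact mem_of_comp_killCoord_mem hr he hrk hx

theorem formsRank_insert_zero (hr : IsRankFn r) (he : e ∉ E) (hrk : r {e} = r ∅ + 1) :
    formsRank E r p ≤ formsRank (insert e E) r p :=
  LinearMap.finrank_le_finrank_of_injective (pullbackQuot_injective hr he hrk)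

/-- Contraction with the basis vector of `e`, as a linear map. -/
def contractForm (e : α) (p : ℕ) :
    ((α → ℝ) [⋀^Fin (p + 1)]→ₗ[ℝ] ℝ) →ₗ[ℝ] ((α → ℝ) [⋀^Fin p]→ₗ[ℝ] ℝ) where
  toFun ω := ω.curryLeft (indVec {e})
  map_add' ω η := by ext v; simp
  map_smul' c ω := by ext v; simp

/-- Forms of the deletion inject by pull-back, contraction with the basis vector of `e` is onto the
forms of the contraction, and the composite is zero. Exactness in the middle is not needed for the
lower bound. -/
theorem formsRank_insert_succ (hr : IsRankFn r) (he : e ∉ E) (hrk : r {e} = r ∅ + 1) :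
    formsRank E r (p + 1) + formsRank E (fun S => r (insert e S)) p ≤
      formsRank (insert e E) r (p + 1) := by
  let c : (((α → ℝ) [⋀^Fin (p + 1)]→ₗ[ℝ] ℝ) ⧸ formsVanishing (insert e E) r (p + 1)) →ₗ[ℝ]
      (((α → ℝ) [⋀^Fin p]→ₗ[ℝ] ℝ) ⧸ formsVanishing E (fun S => r (insert e S)) p) :=
    Submodule.mapQ _ _ (contractForm e p) fun _ hω => curryLeft_indVec_mem hr he hrk hω
  have hc : Function.Surjective c := by
    intro x
    obtain ⟨γ, rfl⟩ := Submodule.Quotient.mk_surjective _ x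
    refine ⟨Submodule.Quotient.mk (coordWedge e γ), ?_⟩
    change Submodule.Quotient.mk ((coordWedge e γ).curryLeft (indVec {e})) = _
    rw [Submodule.Quotient.eq]
    change (coordWedge e γ).curryLeft (indVec {e}) - γ ∈ _
    rw [curryLeft_coordWedge]
    exact comp_killCoord_sub_mem he γ
  have hle : LinearMap.range (pullbackQuot hr he (p + 1)) ≤ LinearMap.ker c := by
    rintro _ ⟨x, rfl⟩
    obtain ⟨ω, rfl⟩ := Submodule.Quotient.mk_surjective _ x
    rw [LinearMap.mem_ker]
    change Submodule.Quotient.mk (contractForm e p (pullbackForms (killCoord e) (p + 1) ω)) = _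
    have : contractForm e p (pullbackForms (killCoord e) (p + 1) ω) = 0 := by
      ext v
      change ω.compLinearMap (killCoord e) (Matrix.vecCons (indVec {e}) v) = 0
      rw [AlternatingMap.compLinearMap_apply]
      exact ω.map_coord_zero 0 (by simp [killCoord_self])
    rw [this, Submodule.Quotient.mk_zero]
  have h1 := c.finrank_range_add_finrank_ker
  rw [LinearMap.range_eq_top.2 hc, finrank_top] at h1
  have h2 := Submodule.finrank_mono hle
  rw [LinearMap.finrank_range_of_inj (pullbackQuot_injective hr he hrk)] at h2
  unfold formsRank
  omega

theorem coeff_charPolyIn_le (E : Finset α) : ∀ {r : Finset α → ℕ}, IsRankFn r → ∀ p,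
    (charPolyIn E r).coeff p ≤ (formsRank E r p : ℤ) := by
  induction E using Finset.induction_on with
  | empty =>
    intro r hr p
    rw [charPolyIn_empty, Polynomial.coeff_one]
    split_ifs with hp
    · subst hp
      have hne : formsVanishing (∅ : Finset α) r 0 ≠ ⊤ := by
        intro h
        have h1 : AlternatingMap.constOfIsEmpty ℝ (α → ℝ) (Fin 0) (1 : ℝ) ∈
            formsVanishing (∅ : Finset α) r 0 := h ▸ Submodule.mem_top
        have h2 := h1 ⟨subset_rfl, by simp⟩ (fun _ => ∅) (fun i => i.elim0) (fun i => i.elim0)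
        simp at h2
      have := Submodule.Quotient.nontrivial_iff.2 hne
      have h := Module.finrank_pos (R := ℝ)
        (M := ((α → ℝ) [⋀^Fin 0]→ₗ[ℝ] ℝ) ⧸ formsVanishing (∅ : Finset α) r 0)
      unfold formsRank
      omega
    · positivity
  | insert e E he ih =>
    intro r hr p
    by_cases hloop : r {e} = r ∅
    · rw [charPolyIn_loop hr (Finset.mem_insert_self e E) hloop]
      simp
    · have hrk : r {e} = r ∅ + 1 := by
        have h1 := hr.insert_le e ∅
        have h2 : r ∅ ≤ r {e} := hr.mono (Finset.empty_subset _)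
        rw [insert_empty_eq] at h1
        omega
      rw [charPolyIn_insert hr he hrk, Polynomial.coeff_add]
      cases p with
      | zero =>
        rw [Polynomial.coeff_X_mul_zero, add_zero]
        exact (ih hr 0).trans (Int.ofNat_le.2 (formsRank_insert_zero hr he hrk))
      | succ p =>
        rw [Polynomial.coeff_X_mul]
        have h1 := formsRank_insert_succ (p := p) hr he hrk
        have h2 := ih hr (p + 1)
        have h3 := ih (hr.contract e) p
        zify at h1
        linarith

/-- The bound through flag cochains from above and the deletion-contraction bound from below meet.
-/
theorem formsRank_eq_coeff (hr : IsRankFn r) (E : Finset α) (p : ℕ) :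
    (formsRank E r p : ℤ) = (charPolyIn E r).coeff p :=
  le_antisymm ((Int.ofNat_le.2 (finrank_quotient_formsVanishing_le hr)).trans
    (finrank_flagCochains_le E hr p)) (coeff_charPolyIn_le E hr p)

end FlagForms

/-! ### Bergman fans of rank functions -/

section BergmanFan

set_option linter.unusedSectionVars false

variable {α : Type*} [DecidableEq α] [Fintype α]

/-- The set of coordinates at which `x` is at most `t`. -/
noncomputable def sublevel (x : α → ℝ) (t : ℝ) : Finset α := Finset.univ.filter fun i => x i ≤ t

@[simp] theorem mem_sublevel {x : α → ℝ} {t : ℝ} {i : α} : i ∈ sublevel x t ↔ x i ≤ t := by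
  simp [sublevel]

theorem sublevel_mono (x : α → ℝ) {s t : ℝ} (h : s ≤ t) : sublevel x s ⊆ sublevel x t :=
  fun _ hi => mem_sublevel.2 ((mem_sublevel.1 hi).trans h)

/-- The affine Bergman fan: vectors all of whose sublevel sets are flats. -/
def berg (r : Finset α → ℕ) : Set (α → ℝ) := {x | ∀ t, FlatIn Finset.univ r (sublevel x t)}

/-- The closed cone of all vectors that are weakly ordered like `x`. -/
def orderCone (x : α → ℝ) : Set (α → ℝ) := {v | ∀ i j, x i ≤ x j → v i ≤ v j}

/-- The linear span of the cone of all vectors ordered like `x`. -/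
def orderSpan (x : α → ℝ) : Submodule ℝ (α → ℝ) where
  carrier := {v | ∀ i j, x i = x j → v i = v j}
  zero_mem' := by simp
  add_mem' := fun h1 h2 i j h => by simp [h1 i j h, h2 i j h]
  smul_mem' := fun c v h1 i j h => by simp [h1 i j h]

theorem self_mem_orderCone (x : α → ℝ) : x ∈ orderCone x := fun _ _ h => h

theorem orderCone_subset_orderSpan (x : α → ℝ) : orderCone x ⊆ orderSpan x :=
  fun _ hv i j h => le_antisymm (hv i j h.le) (hv j i h.ge)

theorem add_mem_orderCone {x v w : α → ℝ} (hv : v ∈ orderCone x) (hw : w ∈ orderCone x) :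
    v + w ∈ orderCone x := fun i j h => add_le_add (hv i j h) (hw i j h)

theorem smul_mem_orderCone {x v : α → ℝ} {c : ℝ} (hc : 0 ≤ c) (hv : v ∈ orderCone x) :
    c • v ∈ orderCone x := fun i j h => mul_le_mul_of_nonneg_left (hv i j h) hc

theorem const_mem_orderCone (x : α → ℝ) (c : ℝ) : (fun _ => c) ∈ orderCone x :=
  fun _ _ _ => le_rfl

theorem orderCone_trans {x v w : α → ℝ} (hv : v ∈ orderCone x) (hw : w ∈ orderCone v) :
    w ∈ orderCone x := fun i j h => hw i j (hv i j h)

theorem neg_indVec_sublevel_mem_orderCone (x : α → ℝ) (t : ℝ) :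
    -indVec (sublevel x t) ∈ orderCone x := by
  intro i j h
  simp only [Pi.neg_apply, indVec_apply, mem_sublevel]
  split_ifs with h1 h2 h2 <;> linarith

theorem exists_sublevel_eq {x v : α → ℝ} (hv : v ∈ orderCone x) {s : ℝ}
    (hs : (sublevel v s).Nonempty) : ∃ t, sublevel v s = sublevel x t := by
  obtain ⟨i, hi, hmax⟩ := Finset.exists_max_image _ x hs
  refine ⟨x i, ?_⟩
  ext j
  rw [mem_sublevel]
  refine ⟨fun h => by simpa using hmax j (mem_sublevel.2 h), fun h => ?_⟩
  exact (hv j i (mem_sublevel.1 h)).trans (mem_sublevel.1 hi)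

variable {r : Finset α → ℕ}

theorem exists_forall_lt (x : α → ℝ) : ∃ t, ∀ i, t < x i := by
  obtain ⟨B, hB⟩ := (Set.finite_range x).bddBelow
  exact ⟨B - 1, fun i => by linarith [hB ⟨i, rfl⟩]⟩

theorem sublevel_eq_empty {x : α → ℝ} {t : ℝ} (h : ∀ i, t < x i) : sublevel x t = ∅ := by
  ext i; simpa using h i

theorem flatIn_empty_of_mem_berg {x : α → ℝ} (hx : x ∈ berg r) : FlatIn Finset.univ r ∅ := by
  obtain ⟨t, ht⟩ := exists_forall_lt x
  rw [← sublevel_eq_empty ht]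
  exact hx t

theorem orderCone_subset_berg {x : α → ℝ} (hx : x ∈ berg r) : orderCone x ⊆ berg r := by
  intro v hv s
  rcases (sublevel v s).eq_empty_or_nonempty with h | h
  · rw [h]; exact flatIn_empty_of_mem_berg hx
  · obtain ⟨t, ht⟩ := exists_sublevel_eq hv h
    rw [ht]; exact hx t

theorem smul_mem_berg {x : α → ℝ} (hx : x ∈ berg r) {c : ℝ} (hc : 0 ≤ c) : c • x ∈ berg r :=
  orderCone_subset_berg hx (smul_mem_orderCone hc (self_mem_orderCone x))

theorem sublevel_neg_smul_indVec {c : ℝ} (hc : 0 < c) (F : Finset α) (t : ℝ) :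
    sublevel (-(c • indVec F)) t = if t < -c then ∅ else if t < 0 then F else Finset.univ := by
  ext i
  by_cases hi : i ∈ F <;> split_ifs with h1 h2 <;> simp [hi] <;> linarith

theorem neg_smul_indVec_mem_berg (h0 : FlatIn Finset.univ r ∅) {F : Finset α}
    (hF : FlatIn Finset.univ r F) {c : ℝ} (hc : 0 < c) : -(c • indVec F) ∈ berg r := by
  intro t
  rw [sublevel_neg_smul_indVec hc]
  split_ifs
  exacts [h0, hF, FlatIn.ground]

/-- The cone of vectors ordered like `x` is generated by constants and negative indicator vectors
of sublevel sets of `x`. -/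
theorem orderCone_induction (x : α → ℝ) {P : (α → ℝ) → Prop}
    (hadd : ∀ v ∈ orderCone x, ∀ w ∈ orderCone x, P v → P w → P (v + w))
    (hconst : ∀ c : ℝ, P fun _ => c)
    (hind : ∀ c : ℝ, 0 < c → ∀ t, P (-(c • indVec (sublevel x t)))) :
    ∀ v ∈ orderCone x, P v := by
  suffices ∀ n : ℕ, ∀ v ∈ orderCone x, (Finset.univ.image v).card = n → P v from
    fun v hv => this _ v hv rfl
  intro n
  induction n using Nat.strong_induction_on with
  | _ n ih =>
  intro v hv hn
  by_cases hc : ∃ c, v = fun _ => c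
  · obtain ⟨c, rfl⟩ := hc; exact hconst c
  have hne : Nonempty α := by
    by_contra h
    rw [not_nonempty_iff] at h
    exact hc ⟨0, Subsingleton.elim _ _⟩
  obtain ⟨i₁, -, h1⟩ := Finset.exists_max_image Finset.univ v Finset.univ_nonempty
  have hS : (Finset.univ.filter fun i => v i < v i₁).Nonempty := by
    by_contra hS
    refine hc ⟨v i₁, funext fun i => le_antisymm (h1 i (Finset.mem_univ _)) ?_⟩
    by_contra hlt
    exact hS ⟨i, by simpa using hlt⟩
  obtain ⟨i₂, hi₂, h2⟩ := Finset.exists_max_image _ v hS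
  have hlt : v i₂ < v i₁ := by simpa using hi₂
  have hval : ∀ i, v i ≤ v i₂ ∨ v i = v i₁ := fun i => by
    rcases (h1 i (Finset.mem_univ _)).lt_or_eq with h | h
    · exact Or.inl (h2 i (by simpa using h))
    · exact Or.inr h
  obtain ⟨t, ht⟩ := exists_sublevel_eq hv (s := v i₂) ⟨i₂, by simp⟩
  -- Cutting `v` off at its second largest value `v i₂` removes one value. The difference is a
  -- constant minus a multiple of the indicator of a sublevel set.
  set w : α → ℝ := fun i => min (v i) (v i₂) with hw
  have hwc : w ∈ orderCone x := fun i j h => min_le_min (hv i j h) le_rfl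
  have hcard : (Finset.univ.image w).card < n := by
    rw [← hn]
    refine Finset.card_lt_card ⟨?_, fun hsub => ?_⟩
    · intro c hc
      obtain ⟨i, -, rfl⟩ := Finset.mem_image.1 hc
      rcases min_choice (v i) (v i₂) with h | h
      · simp [hw, h]
      · simp [hw, h]
    · obtain ⟨i, -, hi⟩ := Finset.mem_image.1 (hsub (Finset.mem_image_of_mem v (Finset.mem_univ i₁)))
      have : w i ≤ v i₂ := min_le_right _ _
      linarith
  have hdecomp : v = w + ((fun _ => v i₁ - v i₂) + -((v i₁ - v i₂) • indVec (sublevel x t))) := by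
    ext i
    rw [← ht]
    simp only [hw, Pi.add_apply, Pi.neg_apply, Pi.smul_apply, indVec_apply, mem_sublevel,
      smul_eq_mul]
    rcases hval i with h | h
    · rw [if_pos h, min_eq_left h]; ring
    · rw [if_neg (by rw [h]; exact not_le.2 hlt), h, min_eq_right hlt.le]; ring
  have hd : 0 < v i₁ - v i₂ := by linarith
  have hm : -((v i₁ - v i₂) • indVec (sublevel x t)) ∈ orderCone x := by
    rw [← smul_neg]
    exact smul_mem_orderCone hd.le (neg_indVec_sublevel_mem_orderCone x t)
  rw [hdecomp]
  exact hadd _ hwc _ (add_mem_orderCone (const_mem_orderCone x _) hm) (ih _ hcard w hwc rfl)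
    (hadd _ (const_mem_orderCone x _) _ hm (hconst _) (hind _ hd t))

/-- A lower bound for the gaps between distinct values of a vector. -/
theorem exists_gap (x : α → ℝ) : ∃ δ : ℝ, 0 < δ ∧ ∀ i j, x i < x j → x i + 3 * δ ≤ x j := by
  obtain ⟨ε, hε, h⟩ := Pi.exists_forall_pos_add_lt
    (x := fun p : {p : α × α // x p.1 < x p.2} => x p.1.1) (y := fun p => x p.1.2) fun p => p.2
  -- Moving two coordinates by at most `δ` each costs `2 * δ`, so a gap of `3 * δ` survives such
  -- perturbations.
  refine ⟨ε / 3, by positivity, fun i j hij => ?_⟩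
  have := h ⟨(i, j), hij⟩
  simp only at this
  linarith

theorem exists_bound (v : α → ℝ) : ∃ B : ℝ, 0 < B ∧ ∀ i, |v i| < B := by
  obtain ⟨B, hB⟩ := (Set.finite_range fun i => |v i|).bddAbove
  refine ⟨max B 0 + 1, by positivity, fun i => ?_⟩
  have := hB ⟨i, rfl⟩
  have := le_max_left B 0
  simp only at *
  linarith

/-- Small perturbations of `x` in its order span stay in the open cone of `x`. -/
theorem exists_perturb {x v : α → ℝ} (hv : v ∈ orderSpan x) :
    ∃ δ : ℝ, 0 < δ ∧ ∀ ε, |ε| ≤ δ → x + ε • v ∈ orderCone x ∧ x ∈ orderCone (x + ε • v) := by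
  obtain ⟨δ, hδ, hgap⟩ := exists_gap x
  obtain ⟨B, hB, hbd⟩ := exists_bound v
  refine ⟨δ / B, by positivity, fun ε hε => ?_⟩
  have hsm : ∀ i, |ε * v i| ≤ δ := fun i => by
    rw [abs_mul]
    calc |ε| * |v i| ≤ δ / B * B := mul_le_mul hε (hbd i).le (abs_nonneg _) (by positivity)
      _ = δ := by field_simp
  have key : ∀ i j, x i < x j → x i + ε * v i < x j + ε * v j := fun i j h => by
    have h1 := hgap i j h
    have h2 := abs_le.1 (hsm i)
    have h3 := abs_le.1 (hsm j)
    linarith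
  refine ⟨fun i j h => ?_, fun i j h => ?_⟩
  · simp only [Pi.add_apply, Pi.smul_apply, smul_eq_mul]
    rcases h.lt_or_eq with h | h
    · exact (key i j h).le
    · rw [h, hv i j h]
  · by_contra hn
    exact absurd h (not_le.2 (by simpa using key j i (not_le.1 hn)))

theorem mem_orderSpan_iff_exists {x v : α → ℝ} :
    v ∈ orderSpan x ↔ ∃ a ∈ orderCone x, ∃ b ∈ orderCone x, v = a - b := by
  constructor
  · intro hv
    obtain ⟨δ, hδ, h⟩ := exists_perturb hv
    refine ⟨δ⁻¹ • (x + δ • v), smul_mem_orderCone (by positivity) (h δ (abs_of_pos hδ).le).1,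
      δ⁻¹ • x, smul_mem_orderCone (by positivity) (self_mem_orderCone x), ?_⟩
    rw [smul_add, smul_smul, inv_mul_cancel₀ hδ.ne', one_smul, add_sub_cancel_left]
  · rintro ⟨a, ha, b, hb, rfl⟩
    exact Submodule.sub_mem _ (orderCone_subset_orderSpan x ha) (orderCone_subset_orderSpan x hb)

theorem orderSpan_le_span (x : α → ℝ) :
    orderSpan x ≤ Submodule.span ℝ (Set.range fun t => indVec (sublevel x t)) := by
  have h1 : (fun _ => (1 : ℝ)) ∈ Submodule.span ℝ (Set.range fun t => indVec (sublevel x t)) := by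
    obtain ⟨t, ht⟩ := (Set.finite_range x).bddAbove
    have : (fun _ => (1 : ℝ)) = indVec (sublevel x t) := by
      ext i; simp [ht ⟨i, rfl⟩]
    rw [this]
    exact Submodule.subset_span ⟨t, rfl⟩
  have h2 : ∀ v ∈ orderCone x, v ∈ Submodule.span ℝ (Set.range fun t => indVec (sublevel x t)) := by
    refine orderCone_induction x (fun v _ w _ => Submodule.add_mem _) (fun c => ?_)
      (fun c _ t => Submodule.neg_mem _ (Submodule.smul_mem _ _ (Submodule.subset_span ⟨t, rfl⟩)))
    have : (fun _ : α => c) = c • (fun _ => (1 : ℝ)) := by ext; simp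
    rw [this]
    exact Submodule.smul_mem _ _ h1
  intro v hv
  obtain ⟨a, ha, b, hb, rfl⟩ := mem_orderSpan_iff_exists.1 hv
  exact Submodule.sub_mem _ (h2 a ha) (h2 b hb)

/-! ### Localization -/

/-- The coordinates at which `x` is less than `c`. -/
noncomputable def strictSublevel (x : α → ℝ) (c : ℝ) : Finset α := Finset.univ.filter fun i => x i < c

@[simp] theorem mem_strictSublevel {x : α → ℝ} {t : ℝ} {i : α} :
    i ∈ strictSublevel x t ↔ x i < t := by
  simp [strictSublevel]

/-- The set of values of `x`. -/
noncomputable def values (x : α → ℝ) : Finset ℝ := Finset.univ.image x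

theorem mem_values {x : α → ℝ} {c : ℝ} : c ∈ values x ↔ ∃ i, x i = c := by simp [values]

/-- The part of `S` at which `x` takes the value `c`, together with everything below. -/
noncomputable def levelPart (x : α → ℝ) (c : ℝ) (S : Finset α) : Finset α :=
  strictSublevel x c ∪ S.filter fun i => x i = c

theorem mem_levelPart {x : α → ℝ} {c : ℝ} {S : Finset α} {i : α} :
    i ∈ levelPart x c S ↔ x i < c ∨ i ∈ S ∧ x i = c := by
  simp [levelPart]

/-- The rank function of the localization at `x`, the direct sum of the minors between consecutive
sublevel sets of `x`. -/
noncomputable def locRank (r : Finset α → ℕ) (x : α → ℝ) (S : Finset α) : ℕ :=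
  ∑ c ∈ values x, r (levelPart x c S)

theorem levelPart_insert (x : α → ℝ) (c : ℝ) (i : α) (S : Finset α) :
    levelPart x c (insert i S) = if x i = c then insert i (levelPart x c S) else levelPart x c S := by
  ext j
  split_ifs with h
  · rw [mem_levelPart, Finset.mem_insert, Finset.mem_insert, mem_levelPart]
    by_cases hj : j = i
    · subst hj; simp [h]
    · simp [hj]
  · rw [mem_levelPart, mem_levelPart, Finset.mem_insert]
    by_cases hj : j = i
    · subst hj; simp [h]
    · simp [hj]

theorem isRankFn_locRank (hr : IsRankFn r) (x : α → ℝ) : IsRankFn (locRank r x) where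
  mono := fun S T h => Finset.sum_le_sum fun c _ => hr.mono (Finset.union_subset_union subset_rfl
    (Finset.filter_subset_filter _ h))
  insert_le := fun i S => by
    have h1 : ∀ c ∈ values x, r (levelPart x c (insert i S)) ≤
        r (levelPart x c S) + if x i = c then 1 else 0 := fun c _ => by
      rw [levelPart_insert]
      split_ifs
      · exact hr.insert_le _ _
      · exact le_rfl
    refine (Finset.sum_le_sum h1).trans ?_
    rw [Finset.sum_add_distrib, Finset.sum_ite_eq]
    exact add_le_add le_rfl (by split_ifs <;> simp)
  submod := fun S T => by
    unfold locRank
    rw [← Finset.sum_add_distrib, ← Finset.sum_add_distrib]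
    refine Finset.sum_le_sum fun c _ => ?_
    have h1 : levelPart x c (S ∪ T) = levelPart x c S ∪ levelPart x c T := by
      ext i; simp only [mem_levelPart, Finset.mem_union]; tauto
    have h2 : levelPart x c (S ∩ T) = levelPart x c S ∩ levelPart x c T := by
      ext i; simp only [mem_levelPart, Finset.mem_inter]
      constructor
      · rintro (h | ⟨⟨h1, h2⟩, h3⟩)
        · exact ⟨Or.inl h, Or.inl h⟩
        · exact ⟨Or.inr ⟨h1, h3⟩, Or.inr ⟨h2, h3⟩⟩
      · rintro ⟨h1 | h1, h2 | h2⟩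
        · exact Or.inl h1
        · exact Or.inl h1
        · exact Or.inl h2
        · exact Or.inr ⟨⟨h1.1, h2.1⟩, h1.2⟩
    rw [h1, h2]
    exact hr.submod _ _

/-- Adding `i` changes only the summand of `locRank` at the level `x i`, so flatness is tested level
by level. Elements above the level `c` are no obstruction, because the sublevel set at `c` is a
flat. -/
theorem flatIn_locRank_iff (hr : IsRankFn r) {x : α → ℝ} (hx : x ∈ berg r) {F : Finset α} :
    FlatIn Finset.univ (locRank r x) F ↔
      ∀ c ∈ values x, FlatIn Finset.univ r (levelPart x c F) := by
  constructor
  · rintro ⟨-, h⟩ c hc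
    refine ⟨Finset.subset_univ _, fun i _ hi => ?_⟩
    rcases lt_trichotomy (x i) c with h1 | h1 | h1
    · exact absurd (mem_levelPart.2 (Or.inl h1)) hi
    · have hiF : i ∉ F := fun h' => hi (mem_levelPart.2 (Or.inr ⟨h', h1⟩))
      have h2 := h i (Finset.mem_univ _) hiF
      by_contra h3
      refine absurd h2 (not_lt.2 (Finset.sum_le_sum fun c' _ => ?_))
      rw [levelPart_insert]
      split_ifs with h4
      · rw [← h4, h1]; exact not_lt.1 h3
      · exact le_rfl
    · refine lt_of_le_of_ne (hr.mono (Finset.subset_insert _ _)) fun h2 => ?_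
      have hsub : levelPart x c F ⊆ sublevel x c := fun j hj => by
        rcases mem_levelPart.1 hj with h3 | h3
        · exact mem_sublevel.2 h3.le
        · exact mem_sublevel.2 h3.2.le
      have h3 := (hx c).2 i (Finset.mem_univ _) (by simpa using h1)
      exact h3.ne (hr.insert_eq_of_subset hsub h2.symm).symm
  · intro h
    refine ⟨Finset.subset_univ _, fun i _ hi => ?_⟩
    refine Finset.sum_lt_sum (fun c _ => ?_) ⟨x i, mem_values.2 ⟨i, rfl⟩, ?_⟩
    · exact hr.mono (Finset.union_subset_union subset_rfl
        (Finset.filter_subset_filter _ (Finset.subset_insert _ _)))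
    · rw [levelPart_insert, if_pos rfl]
      refine (h (x i) (mem_values.2 ⟨i, rfl⟩)).2 i (Finset.mem_univ _) fun h' => ?_
      rcases mem_levelPart.1 h' with h1 | h1
      · exact lt_irrefl _ h1
      · exact hi h1.1

/-- Near `x`, the Bergman fan is a translate of the Bergman fan of the localization at `x`. -/
theorem exists_add_mem_berg_iff (hr : IsRankFn r) {x : α → ℝ} (hx : x ∈ berg r) :
    ∃ δ : ℝ, 0 < δ ∧ ∀ v : α → ℝ, (∀ i, |v i| < δ) →
      (x + v ∈ berg r ↔ v ∈ berg (locRank r x)) := by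
  obtain ⟨δ, hδ, hgap⟩ := exists_gap x
  refine ⟨δ, hδ, fun v hv => ?_⟩
  have hv' : ∀ i, -δ < v i ∧ v i < δ := fun i => abs_lt.1 (hv i)
  constructor
  · intro h s
    rw [flatIn_locRank_iff hr hx]
    intro c hc
    obtain ⟨k, rfl⟩ := mem_values.1 hc
    -- Truncating `s` keeps the threshold within `δ` of the level `x k`. There `x` alone decides
    -- about the other levels, and on this level the truncation changes nothing because `|v| < δ`.
    have := h (x k + max (-δ) (min s δ))
    convert this using 1
    ext i
    rw [mem_levelPart, mem_sublevel, mem_sublevel, Pi.add_apply]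
    have h1 := hv' i
    have h2 : -δ ≤ max (-δ) (min s δ) := le_max_left _ _
    have h3 : max (-δ) (min s δ) ≤ δ := max_le (by linarith) (min_le_right _ _)
    rcases lt_trichotomy (x i) (x k) with h4 | h4 | h4
    · have := hgap i k h4
      exact ⟨fun _ => by linarith, fun _ => Or.inl h4⟩
    · rw [h4]
      simp only [lt_irrefl, and_true, false_or, add_le_add_iff_left, le_max_iff, le_min_iff]
      constructor
      · exact fun h5 => Or.inr ⟨h5, h1.2.le⟩
      · rintro (h5 | h5)
        · linarith
        · exact h5.1
    · have := hgap k i h4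
      constructor
      · rintro (h5 | h5)
        · linarith
        · linarith
      · intro; linarith
  · intro h t
    rcases (sublevel (x + v) t).eq_empty_or_nonempty with h0 | h0
    · rw [h0]; exact flatIn_empty_of_mem_berg hx
    -- The highest level of `x` met by the sublevel set; all lower levels are contained in it
    -- completely.
    obtain ⟨k, hk, hmax⟩ := Finset.exists_max_image _ x h0
    have h1 := (flatIn_locRank_iff hr hx).1 (h (t - x k)) (x k) (mem_values.2 ⟨k, rfl⟩)
    convert h1 using 1
    ext i
    rw [mem_levelPart, mem_sublevel, mem_sublevel]
    rw [mem_sublevel] at hk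
    simp only [Pi.add_apply] at hk ⊢
    constructor
    · intro h2
      rcases (hmax i (mem_sublevel.2 h2)).lt_or_eq with h3 | h3
      · exact Or.inl h3
      · exact Or.inr ⟨by linarith, h3⟩
    · rintro (h2 | h2)
      · have := hgap i k h2
        have := hv' i
        have := hv' k
        linarith
      · linarith [h2.1, h2.2]

end BergmanFan

/-! ### Forms on tangent directions of the Bergman fan -/

section TangentForms

set_option linter.unusedSectionVars false

/-- If a polynomial curve meets a subspace infinitely often then all of its coefficients belong to
the subspace. -/
theorem coeff_mem_of_infinite {V : Type*} [AddCommGroup V] [Module ℝ V] {W : Submodule ℝ V} {p : ℕ}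
    {v : Fin p → V} (h : {s : ℝ | ∑ i : Fin p, s ^ (i : ℕ) • v i ∈ W}.Infinite) (i : Fin p) : v i ∈ W := by
  by_contra hi
  obtain ⟨f, hf, hW⟩ := Submodule.exists_le_ker_of_notMem hi
  let P : Polynomial ℝ := ∑ j : Fin p, Polynomial.C (f (v j)) * Polynomial.X ^ (j : ℕ)
  have hP : P = 0 := by
    refine Polynomial.eq_zero_of_infinite_isRoot _ (h.mono fun s hs => ?_)
    have := hW hs
    rw [LinearMap.mem_ker, map_sum] at this
    simp only [map_smul, smul_eq_mul] at this
    simp only [P, Set.mem_ofPred_eq, Polynomial.IsRoot.def, Polynomial.eval_finsetSum,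
      Polynomial.eval_mul, Polynomial.eval_C, Polynomial.eval_pow, Polynomial.eval_X]
    rw [← this]
    exact Finset.sum_congr rfl fun j _ => mul_comm _ _
  have h1 : P.coeff i = f (v i) := by
    simp only [P, Polynomial.finsetSum_coeff, Polynomial.coeff_C_mul_X_pow]
    rw [Finset.sum_eq_single_of_mem i (Finset.mem_univ _)]
    · simp
    · intro j _ hj
      rw [if_neg]
      exact fun h => hj (Fin.ext h).symm
  rw [hP, Polynomial.coeff_zero] at h1
  exact hf h1.symm

/-- A multilinear form that vanishes on families from a set vanishes on families from its span. -/
theorem map_eq_zero_of_mem_span {V : Type*} [AddCommGroup V] [Module ℝ V] {p : ℕ}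
    (ω : V [⋀^Fin p]→ₗ[ℝ] ℝ) {B : Set V} (h : ∀ v : Fin p → V, (∀ i, v i ∈ B) → ω v = 0)
    {v : Fin p → V} (hv : ∀ i, v i ∈ Submodule.span ℝ B) : ω v = 0 := by
  have key : ∀ s : Finset (Fin p), ∀ v : Fin p → V, (∀ i ∈ s, v i ∈ Submodule.span ℝ B) →
      (∀ i ∉ s, v i ∈ B) → ω v = 0 := by
    intro s
    induction s using Finset.induction_on with
    | empty => exact fun v _ h2 => h v fun i => h2 i (Finset.notMem_empty i)
    | insert k s hk ih =>
      intro v h1 h2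
      have h3 : ∀ w ∈ Submodule.span ℝ B, ω (Function.update v k w) = 0 := by
        intro w hw
        induction hw using Submodule.span_induction with
        | mem w hw =>
          refine ih _ (fun i hi => ?_) fun i hi => ?_
          · rw [Function.update_of_ne (by rintro rfl; exact hk hi)]
            exact h1 i (Finset.mem_insert_of_mem hi)
          · by_cases hik : i = k
            · subst hik; simpa using hw
            · rw [Function.update_of_ne hik]
              exact h2 i (by simp [hik, hi])
        | zero => exact ω.map_update_zero _ _
        | add x y _ _ hx hy => rw [ω.map_update_add, hx, hy, add_zero]
        | smul c x _ hx => rw [ω.map_update_smul, hx, smul_zero]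
      simpa using h3 (v k) (h1 k (Finset.mem_insert_self _ _))
  exact key Finset.univ v (fun i _ => hv i) fun i hi => absurd (Finset.mem_univ i) hi

/-- Families `v` such that the set `X` contains a small cube at `x` spanned by `v`. -/
def IsTangentCube {V : Type*} [AddCommGroup V] [Module ℝ V] (X : Set V) (x : V) {p : ℕ}
    (v : Fin p → V) : Prop :=
  ∃ ε : ℝ, 0 < ε ∧ ∀ t : Fin p → ℝ, (∀ i, 0 ≤ t i ∧ t i ≤ ε) → x + ∑ i, t i • v i ∈ X

/-- The `p`-forms that vanish on all tangent cubes of `X` at `x`. -/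
def formsVanishingAt {V : Type*} [AddCommGroup V] [Module ℝ V] (X : Set V) (x : V) (p : ℕ) :
    Submodule ℝ (V [⋀^Fin p]→ₗ[ℝ] ℝ) where
  carrier := {ω | ∀ v : Fin p → V, IsTangentCube X x v → ω v = 0}
  zero_mem' := by simp
  add_mem' := fun h1 h2 v hv => by simp [h1 v hv, h2 v hv]
  smul_mem' := fun c ω h1 v hv => by simp [h1 v hv]

variable {α : Type*} [DecidableEq α] [Fintype α] {r : Finset α → ℕ}

/-- In a sequence of vectors infinitely many are ordered in the same way. -/
theorem exists_infinite_same_order (y : ℕ → α → ℝ) :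
    ∃ n₀, {n | ∀ i j, y n i ≤ y n j ↔ y n₀ i ≤ y n₀ j}.Infinite := by
  obtain ⟨o, ho⟩ := Finite.exists_infinite_fiber fun (n : ℕ) (i j : α) => decide (y n i ≤ y n j)
  have ho' : ((fun (n : ℕ) (i j : α) => decide (y n i ≤ y n j)) ⁻¹' {o}).Infinite :=
    Set.infinite_coe_iff.1 ho
  obtain ⟨n₀, hn₀⟩ := ho'.nonempty
  refine ⟨n₀, ho'.mono fun n hn i j => ?_⟩
  have : (fun (i j : α) => decide (y n i ≤ y n j)) = fun i j => decide (y n₀ i ≤ y n₀ j) :=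
    hn.trans hn₀.symm
  simpa using congrFun (congrFun this i) j

/-- Let `i₀` have the largest value in a nonempty sublevel set. This set is the smallest `G j` with
positive coefficient containing `i₀`, or everything if there is none. -/
theorem mem_berg_sum_neg_indVec {p : ℕ} (h0 : FlatIn Finset.univ r ∅) {G : Fin p → Finset α}
    (hG : ∀ i, FlatIn Finset.univ r (G i)) (hc : ∀ i j, G i ⊆ G j ∨ G j ⊆ G i) {t : Fin p → ℝ}
    (ht : ∀ i, 0 ≤ t i) : ∑ i, t i • -indVec (G i) ∈ berg r := by
  set w := ∑ i, t i • -indVec (G i) with hw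
  have hwi : ∀ k, w k = -∑ j, if k ∈ G j then t j else 0 := fun k => by
    simp [hw, Finset.sum_apply]
  intro s
  rcases (sublevel w s).eq_empty_or_nonempty with he | hne
  · rw [he]; exact h0
  obtain ⟨i₀, hi₀, hmax⟩ := Finset.exists_max_image _ w hne
  rw [mem_sublevel] at hi₀
  by_cases hJ : (Finset.univ.filter fun j => i₀ ∈ G j ∧ 0 < t j).Nonempty
  · obtain ⟨j, hj, hmin⟩ := Finset.exists_min_image _ (fun j => (G j).card) hJ
    simp only [Finset.mem_filter, Finset.mem_univ, true_and] at hj hmin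
    suffices sublevel w s = G j by rw [this]; exact hG j
    ext k
    rw [mem_sublevel]
    constructor
    · intro hk
      by_contra hkj
      have h1 := hmax k (mem_sublevel.2 hk)
      rw [hwi, hwi, neg_le_neg_iff] at h1
      refine absurd h1 (not_le.2 (Finset.sum_lt_sum (fun m _ => ?_) ⟨j, Finset.mem_univ _, ?_⟩))
      · by_cases hkm : k ∈ G m
        · rcases hc j m with h2 | h2
          · rw [if_pos hkm, if_pos (h2 hj.1)]
          · exact absurd (h2 hkm) hkj
        · rw [if_neg hkm]
          split_ifs
          · exact ht m
          · exact le_rfl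
      · rw [if_neg hkj, if_pos hj.1]; exact hj.2
    · intro hk
      refine le_trans ?_ hi₀
      rw [hwi, hwi, neg_le_neg_iff]
      refine Finset.sum_le_sum fun m _ => ?_
      by_cases him : i₀ ∈ G m
      · rcases (ht m).eq_or_lt with h1 | h1
        · simp [← h1]
        · have h2 := hmin m ⟨him, h1⟩
          have h3 : G j ⊆ G m := by
            rcases hc j m with h3 | h3
            · exact h3
            · exact (Finset.eq_of_subset_of_card_le h3 h2).symm.subset
          rw [if_pos him, if_pos (h3 hk)]
      · rw [if_neg him]
        split_ifs
        · exact ht m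
        · exact le_rfl
  · suffices sublevel w s = Finset.univ by rw [this]; exact FlatIn.ground
    ext k
    simp only [mem_sublevel, Finset.mem_univ, iff_true]
    have h1 : w i₀ = 0 := by
      rw [hwi, neg_eq_zero]
      refine Finset.sum_eq_zero fun j _ => ?_
      split_ifs with h2
      · by_contra h3
        exact hJ ⟨j, by simp [h2, lt_of_le_of_ne (ht j) (Ne.symm h3)]⟩
      · rfl
    have h2 : w k ≤ 0 := by
      rw [hwi, neg_nonpos]
      exact Finset.sum_nonneg fun j _ => by
        split_ifs
        · exact ht j
        · exact le_rfl
    linarith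

/-- The negative indicators of a chain of local flats span a tangent cube; replacing them by the
indicators changes a form by a sign only. -/
theorem formsVanishingAt_le (hr : IsRankFn r) {x : α → ℝ} (hx : x ∈ berg r) (p : ℕ) :
    formsVanishingAt (berg r) x p ≤ formsVanishing Finset.univ (locRank r x) p := by
  intro ω hω h0 G hG hc
  obtain ⟨δ, hδ, hloc⟩ := exists_add_mem_berg_iff hr hx
  have htan : IsTangentCube (berg r) x fun i => -indVec (G i) := by
    refine ⟨δ / (p + 1), by positivity, fun t ht => ?_⟩
    rw [hloc]
    · exact mem_berg_sum_neg_indVec h0 hG hc fun i => (ht i).1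
    · intro k
      rw [Finset.sum_apply]
      refine (Finset.abs_sum_le_sum_abs _ _).trans_lt ?_
      have h1 : ∀ i ∈ Finset.univ, |(t i • -indVec (G i)) k| ≤ δ / (p + 1) := fun i _ => by
        simp only [Pi.smul_apply, Pi.neg_apply, indVec_apply, smul_eq_mul]
        split_ifs
        · rw [mul_neg, mul_one, abs_neg, abs_of_nonneg (ht i).1]
          exact (ht i).2
        · simp only [neg_zero, mul_zero, abs_zero]; positivity
      refine (Finset.sum_le_sum h1).trans_lt ?_
      rw [Finset.sum_const, Finset.card_univ, Fintype.card_fin, nsmul_eq_mul, mul_div_assoc',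
        div_lt_iff₀ (by positivity)]
      nlinarith
  have h1 := hω _ htan
  have h2 := ω.toMultilinearMap.map_smul_univ (fun _ => (-1 : ℝ)) fun i => indVec (G i)
  have h3 : (fun i => (-1 : ℝ) • indVec (G i)) = fun i => -indVec (G i) := by ext1 i; simp
  rw [h3] at h2
  have h4 : ω.toMultilinearMap (fun i => -indVec (G i)) = 0 := h1
  rw [h4] at h2
  have h5 := smul_eq_zero.1 h2.symm
  exact h5.resolve_left (by simp [Finset.prod_const])

/-- A tangent cube of the Bergman fan is contained in the span of a single cone of the local fan. -/
theorem exists_orderSpan_of_isTangentCube (hr : IsRankFn r) {x : α → ℝ} (hx : x ∈ berg r) {p : ℕ}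
    {v : Fin p → α → ℝ} (hv : IsTangentCube (berg r) x v) :
    ∃ y ∈ berg (locRank r x), ∀ i, v i ∈ orderSpan y := by
  obtain ⟨δ, hδ, hloc⟩ := exists_add_mem_berg_iff hr hx
  obtain ⟨ε, hε, hv⟩ := hv
  choose B hB0 hB using fun i => exists_bound (v i)
  have hBs : 0 ≤ ∑ i, B i := Finset.sum_nonneg fun i _ => (hB0 i).le
  set η := min ε (δ / (∑ i, B i + 1)) with hη
  have hη0 : 0 < η := lt_min hε (by positivity)
  set s : ℕ → ℝ := fun n => 1 / ((n : ℝ) + 1) with hs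
  have hs0 : ∀ n, 0 < s n := fun n => Nat.one_div_pos_of_nat
  have hs1 : ∀ n, s n ≤ 1 := fun n => by
    rw [hs]; simp only
    rw [div_le_one (by positivity)]
    linarith [Nat.cast_nonneg (α := ℝ) n]
  have hsinj : Function.Injective s := fun m n h => by
    simpa [hs] using h
  have ht : ∀ n (i : Fin p), 0 ≤ η * s n ^ (i : ℕ) ∧ η * s n ^ (i : ℕ) ≤ η := fun n i =>
    ⟨mul_nonneg hη0.le (pow_nonneg (hs0 n).le _),
      mul_le_of_le_one_right hη0.le (pow_le_one₀ (hs0 n).le (hs1 n))⟩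
  -- These points of the cube lie on a polynomial curve in the parameter `s n`. Infinitely many are
  -- ordered alike and thus lie in one order span, so all coefficients of the curve, the vectors `v
  -- i`, lie there too.
  set y : ℕ → α → ℝ := fun n => ∑ i : Fin p, (η * s n ^ (i : ℕ)) • v i with hy
  have hyb : ∀ n, y n ∈ berg (locRank r x) := fun n => by
    rw [← hloc]
    · exact hv _ fun i => ⟨(ht n i).1, (ht n i).2.trans (min_le_left _ _)⟩
    · intro k
      simp only [hy]
      rw [Finset.sum_apply]
      refine (Finset.abs_sum_le_sum_abs _ _).trans_lt ?_
      have h1 : ∀ i ∈ (Finset.univ : Finset (Fin p)), |((η * s n ^ (i : ℕ)) • v i) k| ≤ η * B i := fun i _ => by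
        rw [Pi.smul_apply, smul_eq_mul, abs_mul, abs_of_nonneg (ht n i).1]
        exact mul_le_mul (ht n i).2 (hB i k).le (abs_nonneg _) hη0.le
      refine (Finset.sum_le_sum h1).trans_lt ?_
      rw [← Finset.mul_sum]
      calc η * ∑ i, B i ≤ δ / (∑ i, B i + 1) * ∑ i, B i :=
            mul_le_mul_of_nonneg_right (min_le_right _ _) hBs
        _ < δ := by
          rw [div_mul_eq_mul_div, div_lt_iff₀ (by positivity)]
          nlinarith
  obtain ⟨n₀, hn₀⟩ := exists_infinite_same_order y
  refine ⟨y n₀, hyb n₀, fun i => ?_⟩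
  refine coeff_mem_of_infinite (W := orderSpan (y n₀)) (v := v)
    ((hn₀.image hsinj.injOn).mono ?_) i
  rintro _ ⟨n, hn, rfl⟩
  have h1 : y n ∈ orderSpan (y n₀) := orderCone_subset_orderSpan _ fun i j h => (hn i j).2 h
  have h2 : y n = η • ∑ i : Fin p, s n ^ (i : ℕ) • v i := by
    simp only [hy, Finset.smul_sum, smul_smul]
  rw [h2] at h1
  exact (Submodule.smul_mem_iff _ hη0.ne').1 h1

theorem le_formsVanishingAt (hr : IsRankFn r) {x : α → ℝ} (hx : x ∈ berg r) (p : ℕ) :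
    formsVanishing Finset.univ (locRank r x) p ≤ formsVanishingAt (berg r) x p := by
  intro ω hω v hv
  obtain ⟨y, hy, hvy⟩ := exists_orderSpan_of_isTangentCube hr hx hv
  refine map_eq_zero_of_mem_span ω (B := Set.range fun t => indVec (sublevel y t)) (fun u hu => ?_)
    fun i => orderSpan_le_span y (hvy i)
  choose t ht using hu
  have h1 : u = fun i => indVec (sublevel y (t i)) := funext fun i => (ht i).symm
  rw [h1]
  refine hω (flatIn_empty_of_mem_berg hy) _ (fun i => hy _) fun i j => ?_
  exact (le_total (t i) (t j)).imp (sublevel_mono y) (sublevel_mono y)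

/-- The number of independent restrictions of `p`-forms to the tangent cubes of `X` at `x`. -/
noncomputable def tangentRank {V : Type*} [AddCommGroup V] [Module ℝ V] (X : Set V) (x : V)
    (p : ℕ) : ℕ :=
  Module.finrank ℝ ((V [⋀^Fin p]→ₗ[ℝ] ℝ) ⧸ formsVanishingAt X x p)

/-- The left side involves only the set `berg r` in a real vector space. This makes the polynomial
of the localization intrinsic. -/
theorem tangentRank_berg (hr : IsRankFn r) {x : α → ℝ} (hx : x ∈ berg r) (p : ℕ) :
    (tangentRank (berg r) x p : ℤ) = (charPolyIn Finset.univ (locRank r x)).coeff p := by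
  rw [← formsRank_eq_coeff (isRankFn_locRank hr x)]
  unfold tangentRank formsRank
  rw [le_antisymm (formsVanishingAt_le hr hx p) (le_formsVanishingAt hr hx p)]

/-- Functoriality of the tangent rank under affine bijections whose linear part has a left inverse on
the directions of the source. -/
theorem tangentRank_eq_of_affine {V W : Type*} [AddCommGroup V] [Module ℝ V] [AddCommGroup W]
    [Module ℝ W] [Module.Finite ℝ V] [Module.Finite ℝ W] {X : Set V} {Y : Set W} (φ : V →ᵃ[ℝ] W)
    (hφ : Set.BijOn φ X Y) (g : W →ₗ[ℝ] V) (hg : ∀ a ∈ X, ∀ b ∈ X, g (φ.linear (a - b)) = a - b)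
    {x : V} (hx : x ∈ X) (p : ℕ) : tangentRank X x p = tangentRank Y (φ x) p := by
  have hφadd : ∀ v, φ (x + v) = φ x + φ.linear v := fun v => by
    rw [add_comm, ← vadd_eq_add, φ.map_vadd, vadd_eq_add, add_comm]
  have hX : ∀ {v : Fin p → V}, IsTangentCube X x v → ∀ i, g (φ.linear (v i)) = v i := by
    rintro v ⟨ε, hε, hv⟩ i
    have h1 := hv (Pi.single i ε) fun j => by
      by_cases h : j = i
      · subst h; simp [hε.le]
      · simp [h, hε.le]
    have h2 := hg _ h1 x hx
    have h3 : ∑ j, (Pi.single i ε : Fin p → ℝ) j • v j = ε • v i := by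
      rw [Finset.sum_eq_single_of_mem i (Finset.mem_univ _)]
      · simp
      · intro j _ hj; simp [hj]
    rw [h3, add_sub_cancel_left, map_smul, map_smul] at h2
    exact smul_right_injective _ hε.ne' h2
  have hXY : ∀ {v : Fin p → V}, IsTangentCube X x v → IsTangentCube Y (φ x) (φ.linear ∘ v) := by
    rintro v ⟨ε, hε, hv⟩
    refine ⟨ε, hε, fun t ht => ?_⟩
    have := hφ.mapsTo (hv t ht)
    rw [hφadd, map_sum] at this
    simpa using this
  have hYX : ∀ {v : Fin p → W}, IsTangentCube Y (φ x) v → IsTangentCube X x (g ∘ v) ∧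
      ∀ i, φ.linear (g (v i)) = v i := by
    rintro v ⟨ε, hε, hv⟩
    have key : ∀ t : Fin p → ℝ, (∀ i, 0 ≤ t i ∧ t i ≤ ε) →
        x + ∑ i, t i • g (v i) ∈ X ∧ φ.linear (∑ i, t i • g (v i)) = ∑ i, t i • v i := by
      intro t ht
      -- The left inverse `g` forces the preimage of a point of the cube to be `x + ∑ i, t i • g (v
      -- i)`, so the preimages form a cube as well.
      obtain ⟨z, hz, hφz⟩ := hφ.surjOn (hv t ht)
      have h1 : φ.linear (z - x) = ∑ i, t i • v i := by
        have := hφadd (z - x)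
        rw [add_sub_cancel, hφz] at this
        exact (add_left_cancel this).symm
      have h2 := hg z hz x hx
      rw [h1, map_sum] at h2
      simp only [map_smul] at h2
      rw [h2, h1, add_sub_cancel]
      exact ⟨hz, rfl⟩
    refine ⟨⟨ε, hε, fun t ht => (key t ht).1⟩, fun i => ?_⟩
    have h1 := (key (Pi.single i ε) fun j => by
      by_cases h : j = i
      · subst h; simp [hε.le]
      · simp [h, hε.le]).2
    rw [Finset.sum_eq_single_of_mem i (Finset.mem_univ _),
      Finset.sum_eq_single_of_mem i (Finset.mem_univ _)] at h1
    · simp only [Pi.single_eq_same, map_smul] at h1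
      exact smul_right_injective _ hε.ne' h1
    · intro j _ hj; simp [hj]
    · intro j _ hj; simp [hj]
  unfold tangentRank
  let F : ((W [⋀^Fin p]→ₗ[ℝ] ℝ) ⧸ formsVanishingAt Y (φ x) p) →ₗ[ℝ]
      ((V [⋀^Fin p]→ₗ[ℝ] ℝ) ⧸ formsVanishingAt X x p) :=
    Submodule.mapQ _ _ (pullbackForms φ.linear p) fun ω hω v hv => hω _ (hXY hv)
  let G : ((V [⋀^Fin p]→ₗ[ℝ] ℝ) ⧸ formsVanishingAt X x p) →ₗ[ℝ]
      ((W [⋀^Fin p]→ₗ[ℝ] ℝ) ⧸ formsVanishingAt Y (φ x) p) :=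
    Submodule.mapQ _ _ (pullbackForms g p) fun ω hω v hv => hω _ (hYX hv).1
  refine (LinearEquiv.ofLinearMap F G ?_ ?_).finrank_eq.symm
  · refine LinearMap.ext fun q => ?_
    obtain ⟨ω, rfl⟩ := Submodule.Quotient.mk_surjective _ q
    change Submodule.Quotient.mk (pullbackForms φ.linear p (pullbackForms g p ω)) =
      Submodule.Quotient.mk ω
    rw [Submodule.Quotient.eq]
    intro v hv
    have : (fun i => g (φ.linear (v i))) = v := funext (hX hv)
    change ω (fun i => g (φ.linear (v i))) - ω v = 0
    rw [this, sub_self]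
  · refine LinearMap.ext fun q => ?_
    obtain ⟨ω, rfl⟩ := Submodule.Quotient.mk_surjective _ q
    change Submodule.Quotient.mk (pullbackForms g p (pullbackForms φ.linear p ω)) =
      Submodule.Quotient.mk ω
    rw [Submodule.Quotient.eq]
    intro v hv
    have : (fun i => φ.linear (g (v i))) = v := funext (hYX hv).2
    change ω (fun i => φ.linear (g (v i))) - ω v = 0
    rw [this, sub_self]

end TangentForms

/-! ### Gaps and refinements -/

section Gaps

set_option linter.unusedSectionVars false

variable {α : Type*} [DecidableEq α] [Fintype α] {r : Finset α → ℕ}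

theorem strictSublevel_subset (x : α → ℝ) (c : ℝ) : strictSublevel x c ⊆ sublevel x c :=
  fun _ hi => mem_sublevel.2 (mem_strictSublevel.1 hi).le

theorem strictSublevel_eq (x : α → ℝ) (c : ℝ) :
    strictSublevel x c = ∅ ∨ ∃ i, x i < c ∧ strictSublevel x c = sublevel x (x i) ∧
      ∀ j, x j < c → x j ≤ x i := by
  rcases (strictSublevel x c).eq_empty_or_nonempty with h | h
  · exact Or.inl h
  · obtain ⟨i, hi, hmax⟩ := Finset.exists_max_image _ x h
    have hi' := mem_strictSublevel.1 hi
    refine Or.inr ⟨i, hi', ?_, fun j hj => hmax j (by simpa using hj)⟩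
    ext j
    rw [mem_strictSublevel, mem_sublevel]
    exact ⟨fun hj => hmax j (by simpa using hj), fun hj => hj.trans_lt hi'⟩

theorem flatIn_strictSublevel {x : α → ℝ} (hx : x ∈ berg r) (c : ℝ) :
    FlatIn Finset.univ r (strictSublevel x c) := by
  rcases strictSublevel_eq x c with h | ⟨i, -, h, -⟩
  · rw [h]; exact flatIn_empty_of_mem_berg hx
  · rw [h]; exact hx _

theorem rank_strictSublevel_lt (hr : IsRankFn r) {x : α → ℝ} (hx : x ∈ berg r) (i : α) :
    r (strictSublevel x (x i)) < r (sublevel x (x i)) := by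
  refine (flatIn_strictSublevel hx _).rank_lt hr (Finset.subset_univ _)
    ⟨strictSublevel_subset _ _, fun h => ?_⟩
  exact lt_irrefl _ (mem_strictSublevel.1 (h (mem_sublevel.2 (le_refl (x i)))))

/-- A telescoping sum: the strict sublevel set at `c` is the closed one at the next lower value. -/
theorem rank_strictSublevel (x : α → ℝ) (hr : IsRankFn r) (n : ℕ) : ∀ c : ℝ,
    ((values x).filter (· < c)).card = n → r (strictSublevel x c) =
      r ∅ + ∑ d ∈ (values x).filter (· < c), (r (sublevel x d) - r (strictSublevel x d)) := by
  induction n using Nat.strong_induction_on with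
  | _ n ih =>
  intro c hn
  rcases strictSublevel_eq x c with h | ⟨i, hi, h, hmax⟩
  · have : (values x).filter (· < c) = ∅ := by
      rw [Finset.filter_eq_empty_iff]
      intro d hd hdc
      obtain ⟨j, rfl⟩ := mem_values.1 hd
      have : j ∈ strictSublevel x c := mem_strictSublevel.2 hdc
      rw [h] at this
      exact Finset.notMem_empty _ this
    rw [this, h, Finset.sum_empty, add_zero]
  · have hfil : (values x).filter (· < c) = insert (x i) ((values x).filter (· < x i)) := by
      ext d
      simp only [Finset.mem_filter, Finset.mem_insert, mem_values]
      constructor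
      · rintro ⟨⟨j, rfl⟩, hj⟩
        rcases (hmax j hj).eq_or_lt with h1 | h1
        · exact Or.inl h1
        · exact Or.inr ⟨⟨j, rfl⟩, h1⟩
      · rintro (rfl | ⟨h1, h2⟩)
        · exact ⟨⟨i, rfl⟩, hi⟩
        · exact ⟨h1, h2.trans hi⟩
    have hnot : x i ∉ (values x).filter (· < x i) := by simp
    have hlt : ((values x).filter (· < x i)).card < n := by
      rw [← hn, hfil, Finset.card_insert_of_notMem hnot]
      exact Nat.lt_succ_self _
    have := ih _ hlt (x i) rfl
    have hle := hr.mono (strictSublevel_subset x (x i))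
    rw [h, hfil, Finset.sum_insert hnot]
    omega

/-- The ranks of the gaps between consecutive sublevel sets add up to the total rank. -/
theorem sum_gaps (hr : IsRankFn r) (x : α → ℝ) :
    r Finset.univ = r ∅ + ∑ d ∈ values x, (r (sublevel x d) - r (strictSublevel x d)) := by
  obtain ⟨B, hB0, hB⟩ := exists_bound x
  have hlt : ∀ i, x i < B := fun i => (le_abs_self _).trans_lt (hB i)
  have h := rank_strictSublevel x hr _ B rfl
  have h1 : strictSublevel x B = Finset.univ := by ext i; simp [hlt i]
  have h2 : (values x).filter (· < B) = values x := by
    rw [Finset.filter_eq_self]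
    intro d hd
    obtain ⟨i, rfl⟩ := mem_values.1 hd
    exact hlt i
  rwa [h1, h2] at h

theorem finrank_orderSpan (x : α → ℝ) : Module.finrank ℝ (orderSpan x) = (values x).card := by
  let f : (values x → ℝ) →ₗ[ℝ] orderSpan x :=
    { toFun := fun g => ⟨fun i => g ⟨x i, mem_values.2 ⟨i, rfl⟩⟩, fun i j h => by simp only [h]⟩
      map_add' := fun _ _ => rfl
      map_smul' := fun _ _ => rfl }
  have hf : Function.Bijective f := by
    constructor
    · intro g h hgh
      ext ⟨c, hc⟩
      obtain ⟨i, rfl⟩ := mem_values.1 hc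
      exact congrFun (congrArg Subtype.val hgh) i
    · rintro ⟨v, hv⟩
      choose i hi using fun c : values x => mem_values.1 c.2
      refine ⟨fun c => v (i c), Subtype.ext (funext fun j => ?_)⟩
      exact hv _ _ (hi ⟨x j, mem_values.2 ⟨j, rfl⟩⟩)
  rw [← (LinearEquiv.ofBijective f hf).finrank_eq, Module.finrank_fintype_fun_eq_card,
    Fintype.card_coe]

/-- A point of the Bergman fan all of whose gaps have rank one. -/
def IsFull (r : Finset α → ℕ) (x : α → ℝ) : Prop :=
  x ∈ berg r ∧ ∀ i, r (sublevel x (x i)) = r (strictSublevel x (x i)) + 1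

/-- A point of the Bergman fan all of whose gaps have rank one, except for the gap at `i₀`, which has
rank two. -/
def IsAlmostFull (r : Finset α → ℕ) (x : α → ℝ) (i₀ : α) : Prop :=
  x ∈ berg r ∧ r (sublevel x (x i₀)) = r (strictSublevel x (x i₀)) + 2 ∧
    ∀ i, x i ≠ x i₀ → r (sublevel x (x i)) = r (strictSublevel x (x i)) + 1

theorem card_values_le (hr : IsRankFn r) {x : α → ℝ} (hx : x ∈ berg r) :
    r ∅ + (values x).card ≤ r Finset.univ := by
  rw [sum_gaps hr x, Finset.card_eq_sum_ones]
  refine Nat.add_le_add_left (Finset.sum_le_sum fun d hd => ?_) _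
  obtain ⟨i, rfl⟩ := mem_values.1 hd
  have := rank_strictSublevel_lt hr hx i
  omega

theorem IsFull.card_values (hr : IsRankFn r) {x : α → ℝ} (hx : IsFull r x) :
    r ∅ + (values x).card = r Finset.univ := by
  rw [sum_gaps hr x, Finset.card_eq_sum_ones]
  congr 1
  refine Finset.sum_congr rfl fun d hd => ?_
  obtain ⟨i, rfl⟩ := mem_values.1 hd
  have := hx.2 i
  omega

theorem IsAlmostFull.card_values (hr : IsRankFn r) {x : α → ℝ} {i₀ : α}
    (hx : IsAlmostFull r x i₀) : r ∅ + (values x).card + 1 = r Finset.univ := by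
  have h0 : x i₀ ∈ values x := mem_values.2 ⟨i₀, rfl⟩
  rw [sum_gaps hr x, ← Finset.add_sum_erase _ _ h0, ← Finset.card_erase_add_one h0,
    Finset.card_eq_sum_ones]
  have h1 : ∑ d ∈ (values x).erase (x i₀), (r (sublevel x d) - r (strictSublevel x d)) =
      ∑ d ∈ (values x).erase (x i₀), 1 := by
    refine Finset.sum_congr rfl fun d hd => ?_
    obtain ⟨h2, h3⟩ := Finset.mem_erase.1 hd
    obtain ⟨i, rfl⟩ := mem_values.1 h3
    have := hx.2.2 i h2
    omega
  have := hx.2.1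
  omega

theorem isFull_of_card (hr : IsRankFn r) {x : α → ℝ} (hx : x ∈ berg r)
    (h : r Finset.univ ≤ r ∅ + (values x).card) : IsFull r x := by
  refine ⟨hx, fun i => ?_⟩
  by_contra hne
  have hlt : ∑ d ∈ values x, 1 < ∑ d ∈ values x, (r (sublevel x d) - r (strictSublevel x d)) := by
    refine Finset.sum_lt_sum (fun d hd => ?_) ⟨x i, mem_values.2 ⟨i, rfl⟩, ?_⟩
    · obtain ⟨j, rfl⟩ := mem_values.1 hd
      have := rank_strictSublevel_lt hr hx j
      omega
    · have := rank_strictSublevel_lt hr hx i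
      omega
  have h1 := sum_gaps hr x
  rw [← Finset.card_eq_sum_ones] at hlt
  omega

theorem isAlmostFull_of_card (hr : IsRankFn r) {x : α → ℝ} (hx : x ∈ berg r)
    (h : r Finset.univ = r ∅ + (values x).card + 1) : ∃ i₀, IsAlmostFull r x i₀ := by
  have hpos : ∀ i, r (strictSublevel x (x i)) < r (sublevel x (x i)) :=
    rank_strictSublevel_lt hr hx
  have h1 : ∑ d ∈ values x, (r (sublevel x d) - r (strictSublevel x d) - 1) = 1 := by
    have h2 := sum_gaps hr x
    have h3 : ∑ d ∈ values x, (r (sublevel x d) - r (strictSublevel x d)) =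
        ∑ d ∈ values x, (r (sublevel x d) - r (strictSublevel x d) - 1) + (values x).card := by
      rw [Finset.card_eq_sum_ones, ← Finset.sum_add_distrib]
      refine Finset.sum_congr rfl fun d hd => ?_
      obtain ⟨i, rfl⟩ := mem_values.1 hd
      have := hpos i
      omega
    omega
  obtain ⟨d, hd, hd1⟩ : ∃ d ∈ values x, r (sublevel x d) - r (strictSublevel x d) - 1 ≠ 0 := by
    by_contra hn
    push Not at hn
    rw [Finset.sum_eq_zero hn] at h1
    exact zero_ne_one h1
  obtain ⟨i₀, rfl⟩ := mem_values.1 hd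
  rw [← Finset.add_sum_erase _ _ hd] at h1
  refine ⟨i₀, hx, ?_, fun i hi => ?_⟩
  · have := hpos i₀
    omega
  · have h4 : ∑ d ∈ (values x).erase (x i₀), (r (sublevel x d) - r (strictSublevel x d) - 1) = 0 := by
      omega
    have h5 := Finset.sum_eq_zero_iff.1 h4 (x i)
      (Finset.mem_erase.2 ⟨hi, mem_values.2 ⟨i, rfl⟩⟩)
    have := hpos i
    omega

/-- Vectors with the same order have the same sublevel sets. -/
theorem sublevel_congr {x y : α → ℝ} (h1 : y ∈ orderCone x) (h2 : x ∈ orderCone y) (i : α) :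
    sublevel x (x i) = sublevel y (y i) ∧ strictSublevel x (x i) = strictSublevel y (y i) := by
  constructor
  · ext j
    simp only [mem_sublevel]
    exact ⟨h1 j i, h2 j i⟩
  · ext j
    simp only [mem_strictSublevel, ← not_le]
    exact not_congr ⟨h1 i j, h2 i j⟩

theorem IsFull.congr {x y : α → ℝ} (hx : IsFull r x) (h1 : y ∈ orderCone x)
    (h2 : x ∈ orderCone y) : IsFull r y :=
  ⟨orderCone_subset_berg hx.1 h1, fun i => by
    rw [← (sublevel_congr h1 h2 i).1, ← (sublevel_congr h1 h2 i).2]; exact hx.2 i⟩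

/-- Splitting a gap of rank at least two, by lowering the coordinates in an intermediate flat. -/
theorem exists_split (hr : IsRankFn r) {x : α → ℝ} (hx : x ∈ berg r) {i : α}
    (hi : r (sublevel x (x i)) ≠ r (strictSublevel x (x i)) + 1) :
    ∃ y ∈ berg r, x ∈ orderCone y ∧ (values x).card < (values y).card ∧
      ∀ j, x j ≠ x i → sublevel y (y j) = sublevel x (x j) ∧
        strictSublevel y (y j) = strictSublevel x (x j) := by
  have hF := flatIn_strictSublevel hx (x i)
  set F := strictSublevel x (x i) with hFdef
  have hiF : i ∉ F := by simp [hFdef]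
  set A := clIn Finset.univ r (insert i F) with hA
  have hAc := clIn_insert_mem_coversIn hr hF (hx (x i)) (strictSublevel_subset x (x i))
    (mem_sublevel.2 le_rfl) hiF
  obtain ⟨hA1, hA2, hA3, hA4⟩ := mem_coversIn.1 hAc
  rw [← hA] at hA1 hA2 hA3 hA4
  have hiA : i ∈ A := IsRankFn.subset_clIn (Finset.subset_univ _) (Finset.mem_insert_self _ _)
  -- The cover `A` generated by `i` does not fill the gap, whose rank is not one. So lowering its
  -- part of the level leaves `k` behind and creates a new value.
  obtain ⟨k, hk, hkA⟩ : ∃ k ∈ sublevel x (x i), k ∉ A := by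
    by_contra hn
    push Not at hn
    refine hi ?_
    rw [Finset.Subset.antisymm (show sublevel x (x i) ⊆ A from hn) hA1, hA4]
  have hxk : x k = x i := by
    refine le_antisymm (mem_sublevel.1 hk) (not_lt.1 fun h => hkA (hA3 ?_))
    exact mem_strictSublevel.2 h
  obtain ⟨δ, hδ, hgap⟩ := exists_gap x
  have hAx : ∀ j, j ∈ A → x j = x i ∨ x j < x i := fun j hj =>
    (mem_sublevel.1 (hA1 hj)).eq_or_lt
  let y : α → ℝ := fun j => if j ∈ A ∧ x j = x i then x j - δ else x j
  have hyx : ∀ j, y j ≤ x j ∧ x j - δ ≤ y j := fun j => by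
    simp only [y]
    split_ifs
    · exact ⟨by linarith, le_rfl⟩
    · exact ⟨le_rfl, by linarith⟩
  have hxy : x ∈ orderCone y := fun a b hab => by
    by_contra hn
    have h1 := hgap b a (not_le.1 hn)
    have := hyx a
    have := hyx b
    linarith
  have hne : ∀ j, x j ≠ x i → y j = x j := fun j hj => if_neg fun h => hj h.2
  have hyi : y i = x i - δ := if_pos ⟨hiA, rfl⟩
  have hyk : y k = x i := by
    simp only [y]
    rw [if_neg fun h => hkA h.1, hxk]
  have hyA : ∀ j, x j = x i → j ∉ A → y j = x i := fun j hj hjA => by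
    simp only [y]
    rw [if_neg fun h => hjA h.1, hj]
  have hyA' : ∀ j, x j = x i → j ∈ A → y j = x i - δ := fun j hj hjA => by
    simp only [y]
    rw [if_pos ⟨hjA, hj⟩, hj]
  have hord : ∀ j, x j ≠ x i → ∀ l, (y l ≤ y j ↔ x l ≤ x j) ∧ (y l < y j ↔ x l < x j) := by
    intro j hj l
    rw [hne j hj]
    have h2 := hyx l
    rcases lt_trichotomy (x l) (x j) with h | h | h
    · exact ⟨⟨fun _ => h.le, fun _ => by linarith⟩, ⟨fun _ => h, fun _ => by linarith⟩⟩
    · have : y l = x l := hne l (by rw [h]; exact hj)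
      rw [this]
      exact ⟨Iff.rfl, Iff.rfl⟩
    · have := hgap j l h
      exact ⟨⟨fun _ => by linarith, fun _ => by linarith⟩,
        ⟨fun _ => by linarith, fun _ => by linarith⟩⟩
  refine ⟨y, fun s => ?_, hxy, ?_, fun j hj => ⟨?_, ?_⟩⟩
  · rcases (sublevel y s).eq_empty_or_nonempty with h0 | h0
    · rw [h0]; exact flatIn_empty_of_mem_berg hx
    obtain ⟨j, hj, hmax⟩ := Finset.exists_max_image _ y h0
    have hsj : sublevel y s = sublevel y (y j) := by
      ext l
      rw [mem_sublevel, mem_sublevel]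
      exact ⟨fun h => hmax l (mem_sublevel.2 h), fun h => h.trans (mem_sublevel.1 hj)⟩
    rw [hsj]
    by_cases hji : x j = x i
    · by_cases hjA : j ∈ A
      · suffices sublevel y (y j) = A by rw [this]; exact hA2
        rw [hyA' j hji hjA]
        ext l
        rw [mem_sublevel]
        constructor
        · intro hl
          by_contra hlA
          rcases lt_trichotomy (x l) (x i) with h | h | h
          · exact hlA (hA3 (mem_strictSublevel.2 h))
          · rw [hyA l h hlA] at hl; linarith
          · rw [hne l h.ne'] at hl; linarith
        · intro hl
          rcases hAx l hl with h | h
          · rw [hyA' l h hl]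
          · rw [hne l h.ne]; linarith [hgap l i h]
      · suffices sublevel y (y j) = sublevel x (x i) by rw [this]; exact hx _
        rw [hyA j hji hjA]
        ext l
        rw [mem_sublevel, mem_sublevel]
        constructor
        · intro hl
          by_contra hn
          have h1 := hgap i l (not_le.1 hn)
          have := hyx l
          linarith
        · exact fun hl => (hyx l).1.trans hl
    · have : sublevel y (y j) = sublevel x (x j) := by
        ext l; rw [mem_sublevel, mem_sublevel]; exact (hord j hji l).1
      rw [this]; exact hx _
  · refine Finset.card_lt_card ⟨fun c hc => ?_, fun hsub => ?_⟩
    · obtain ⟨j, rfl⟩ := mem_values.1 hc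
      by_cases hj : x j = x i
      · exact mem_values.2 ⟨k, by rw [hyk, hj]⟩
      · exact mem_values.2 ⟨j, hne j hj⟩
    · obtain ⟨j, hj⟩ := mem_values.1 (hsub (mem_values.2 ⟨i, rfl⟩))
      rw [hyi] at hj
      have := hgap j i (by linarith)
      linarith
  · ext l; rw [mem_sublevel, mem_sublevel]; exact (hord j hj l).1
  · ext l; rw [mem_strictSublevel, mem_strictSublevel]; exact (hord j hj l).2

/-- Splitting gaps terminates, since the number of values is bounded by the rank. -/
theorem exists_isFull (hr : IsRankFn r) {x : α → ℝ} (hx : x ∈ berg r) :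
    ∃ y, IsFull r y ∧ x ∈ orderCone y := by
  have key : ∀ n : ℕ, ∀ x ∈ berg r, r Finset.univ - (r ∅ + (values x).card) = n →
      ∃ y, IsFull r y ∧ x ∈ orderCone y := by
    intro n
    induction n using Nat.strong_induction_on with
    | _ n ih =>
    intro x hx hn
    by_cases h : ∀ i, r (sublevel x (x i)) = r (strictSublevel x (x i)) + 1
    · exact ⟨x, ⟨hx, h⟩, self_mem_orderCone x⟩
    · push Not at h
      obtain ⟨i, hi⟩ := h
      obtain ⟨y, hy, hxy, hcard, -⟩ := exists_split hr hx hi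
      have := card_values_le hr hy
      obtain ⟨z, hz, hyz⟩ := ih _ (by omega) y hy rfl
      exact ⟨z, hz, orderCone_trans hyz hxy⟩
  exact key _ x hx rfl

/-- Realizes each interval of rank two as the only large gap of a point. The start is the vector
with values 0, 1, 2 on `F`, on `G \ F` and outside `G`; splitting its other gaps does not affect the
gap of `i₀`. -/
theorem exists_isAlmostFull (hr : IsRankFn r) (h0 : FlatIn Finset.univ r ∅) {F G : Finset α}
    (hF : FlatIn Finset.univ r F) (hG : FlatIn Finset.univ r G) (hFG : F ⊆ G)
    (hrk : r G = r F + 2) :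
    ∃ x i₀, IsAlmostFull r x i₀ ∧ strictSublevel x (x i₀) = F ∧ sublevel x (x i₀) = G := by
  have hss : ∃ i₀ ∈ G, i₀ ∉ F := by
    by_contra hn
    push Not at hn
    rw [Finset.Subset.antisymm hFG hn] at hrk
    omega
  obtain ⟨i₀, hi₀G, hi₀F⟩ := hss
  have key : ∀ n : ℕ, ∀ x ∈ berg r, r Finset.univ - (r ∅ + (values x).card) = n →
      strictSublevel x (x i₀) = F → sublevel x (x i₀) = G →
      ∃ x, IsAlmostFull r x i₀ ∧ strictSublevel x (x i₀) = F ∧ sublevel x (x i₀) = G := by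
    intro n
    induction n using Nat.strong_induction_on with
    | _ n ih =>
    intro x hx hn h1 h2
    by_cases h : ∀ i, x i ≠ x i₀ → r (sublevel x (x i)) = r (strictSublevel x (x i)) + 1
    · exact ⟨x, ⟨hx, by rw [h1, h2, hrk], h⟩, h1, h2⟩
    · push Not at h
      obtain ⟨i, hne, hi⟩ := h
      obtain ⟨y, hy, hxy, hcard, hyo⟩ := exists_split hr hx hi
      have := card_values_le hr hy
      exact ih _ (by omega) y hy rfl (by rw [(hyo i₀ hne.symm).2, h1])
        (by rw [(hyo i₀ hne.symm).1, h2])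
  let x : α → ℝ := fun i => if i ∈ F then 0 else if i ∈ G then 1 else 2
  have hx0 : x i₀ = 1 := by simp [x, hi₀G, hi₀F]
  have hx : ∀ t, sublevel x t =
      if t < 0 then ∅ else if t < 1 then F else if t < 2 then G else Finset.univ := by
    intro t
    ext i
    rw [mem_sublevel]
    by_cases hiF : i ∈ F
    · have hiG := hFG hiF
      split_ifs with h1 h2 h3 <;> simp [x, hiF, hiG] <;> linarith
    · by_cases hiG : i ∈ G
      · split_ifs with h1 h2 h3 <;> simp [x, hiF, hiG] <;> linarith
      · split_ifs with h1 h2 h3 <;> simp [x, hiF, hiG] <;> linarith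
  have hxb : x ∈ berg r := fun t => by
    rw [hx]
    split_ifs
    exacts [h0, hF, hG, FlatIn.ground]
  obtain ⟨y, hy⟩ := key _ x hxb rfl (by
    rw [hx0]
    ext i
    rw [mem_strictSublevel]
    by_cases hiF : i ∈ F
    · simp [x, hiF]
    · by_cases hiG : i ∈ G <;> simp [x, hiF, hiG])
    (by rw [hx0, hx]; norm_num)
  exact ⟨y, i₀, hy⟩

end Gaps

/-! ### Local cones of the Bergman fan -/

section LocalCones

set_option linter.unusedSectionVars false

variable {α : Type*} [DecidableEq α] [Fintype α] {r : Finset α → ℕ}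

theorem exists_forall_mem_berg (hr : IsRankFn r) {x v : α → ℝ} (hx : x ∈ berg r)
    (hv : v ∈ berg (locRank r x)) :
    ∃ δ : ℝ, 0 < δ ∧ ∀ ε, 0 ≤ ε → ε ≤ δ → x + ε • v ∈ berg r := by
  obtain ⟨δ, hδ, hloc⟩ := exists_add_mem_berg_iff hr hx
  obtain ⟨B, hB, hbd⟩ := exists_bound v
  refine ⟨δ / B, by positivity, fun ε h0 hε => (hloc _ fun i => ?_).2 (smul_mem_berg hv h0)⟩
  rw [Pi.smul_apply, smul_eq_mul, abs_mul, abs_of_nonneg h0]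
  rcases h0.eq_or_lt with rfl | h0
  · simpa using hδ
  · calc ε * |v i| < ε * B := mul_lt_mul_of_pos_left (hbd i) h0
      _ ≤ δ := by rwa [le_div_iff₀ hB] at hε

theorem mem_berg_locRank (hr : IsRankFn r) {x v : α → ℝ} (hx : x ∈ berg r)
    (h : ∀ δ : ℝ, 0 < δ → ∃ ε, 0 < ε ∧ ε ≤ δ ∧ x + ε • v ∈ berg r) : v ∈ berg (locRank r x) := by
  obtain ⟨δ, hδ, hloc⟩ := exists_add_mem_berg_iff hr hx
  obtain ⟨B, hB, hbd⟩ := exists_bound v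
  obtain ⟨ε, h0, hε, hm⟩ := h (δ / B) (by positivity)
  rw [hloc] at hm
  · have := smul_mem_berg hm (inv_nonneg.2 h0.le)
    rwa [inv_smul_smul₀ h0.ne'] at this
  · intro i
    rw [Pi.smul_apply, smul_eq_mul, abs_mul, abs_of_nonneg h0.le]
    calc ε * |v i| < ε * B := mul_lt_mul_of_pos_left (hbd i) h0
      _ ≤ δ := by rwa [le_div_iff₀ hB] at hε

/-- The fan of the localization is the tangent cone at `x`. In this form it can be compared under
linear maps without reference to flats. -/
theorem mem_berg_locRank_iff (hr : IsRankFn r) {x v : α → ℝ} (hx : x ∈ berg r) :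
    v ∈ berg (locRank r x) ↔ ∃ δ : ℝ, 0 < δ ∧ ∀ ε, 0 ≤ ε → ε ≤ δ → x + ε • v ∈ berg r :=
  ⟨exists_forall_mem_berg hr hx, fun ⟨δ, hδ, h⟩ => mem_berg_locRank hr hx fun η hη =>
    ⟨min δ η, by positivity, min_le_right _ _, h _ (by positivity) (min_le_left _ _)⟩⟩

theorem orderSpan_mono {x y : α → ℝ} (h : x ∈ orderCone y) : orderSpan x ≤ orderSpan y :=
  fun _ hv i j hij => hv i j (le_antisymm (h i j hij.le) (h j i hij.ge))

theorem orderSpan_congr {x y : α → ℝ} (h : x ∈ orderCone y) (h' : y ∈ orderCone x) :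
    orderSpan x = orderSpan y := le_antisymm (orderSpan_mono h) (orderSpan_mono h')

/-- A perturbation of `x` that refines the order of `x`, in an arbitrary direction. -/
theorem exists_refines (x v : α → ℝ) :
    ∃ δ : ℝ, 0 < δ ∧ ∀ ε, |ε| ≤ δ → ∀ i j, x i < x j → (x + ε • v) i < (x + ε • v) j := by
  obtain ⟨δ, hδ, hgap⟩ := exists_gap x
  obtain ⟨B, hB, hbd⟩ := exists_bound v
  refine ⟨δ / B, by positivity, fun ε hε i j hij => ?_⟩
  have hsm : ∀ i, |ε * v i| ≤ δ := fun i => by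
    rw [abs_mul]
    calc |ε| * |v i| ≤ δ / B * B := mul_le_mul hε (hbd i).le (abs_nonneg _) (by positivity)
      _ = δ := by field_simp
  have h1 := abs_le.1 (hsm i)
  have h2 := abs_le.1 (hsm j)
  have h3 := hgap i j hij
  simp only [Pi.add_apply, Pi.smul_apply, smul_eq_mul]
  linarith

theorem self_mem_orderCone_of_lt {x y : α → ℝ} (h : ∀ i j, x i < x j → y i < y j) :
    x ∈ orderCone y := fun i j hij => le_of_not_gt fun h' => (h j i h').not_ge hij

/-- Lowering the coordinates in a flat between two consecutive sublevel sets. -/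
theorem exists_refine_flat {x : α → ℝ} (hx : x ∈ berg r) {c : ℝ} {A : Finset α}
    (hA : FlatIn Finset.univ r A) (h1 : strictSublevel x c ⊆ A) (h2 : A ⊆ sublevel x c) :
    ∃ y ∈ berg r, x ∈ orderCone y ∧ -indVec A ∈ orderCone y := by
  obtain ⟨δ, hδ, hlt⟩ := exists_refines x (-indVec A)
  have hlt := hlt δ (abs_of_pos hδ).le
  set y := x + δ • -indVec A with hy
  have hyi : ∀ i, y i = x i - if i ∈ A then δ else 0 := fun i => by
    simp [hy, sub_eq_add_neg]
  have hxy : x ∈ orderCone y := self_mem_orderCone_of_lt hlt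
  have hAy : -indVec A ∈ orderCone y := by
    intro i j hij
    have hxij := hxy i j hij
    simp only [Pi.neg_apply, indVec_apply]
    by_cases hj : j ∈ A
    · by_cases hi : i ∈ A
      · simp [hi, hj]
      · exfalso
        rcases hxij.eq_or_lt with h | h
        · rw [hyi, hyi, if_neg hi, if_pos hj, h] at hij; linarith
        · exact hi (h1 (mem_strictSublevel.2 (h.trans_le (mem_sublevel.1 (h2 hj)))))
    · split_ifs <;> linarith
  refine ⟨y, fun t => ?_, hxy, hAy⟩
  rcases (sublevel y t).eq_empty_or_nonempty with h | h
  · rw [h]; exact flatIn_empty_of_mem_berg hx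
  obtain ⟨i, hi, hmax⟩ := Finset.exists_max_image _ y h
  have hB : ∀ j, j ∈ sublevel y t ↔ y j ≤ y i := fun j =>
    ⟨hmax j, fun hj => mem_sublevel.2 (hj.trans (mem_sublevel.1 hi))⟩
  have hle : ∀ j, x j < x i → y j ≤ y i := fun j hj => (hlt _ _ hj).le
  have hle' : ∀ j, y j ≤ y i → x j ≤ x i := fun j hj => hxy _ _ hj
  by_cases hiA : x i = c ∧ i ∈ A
  · have : sublevel y t = A := by
      ext j
      rw [hB]
      constructor
      · intro hj
        rcases (hle' j hj).eq_or_lt with h' | h'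
        · by_contra hjA
          rw [hyi, hyi, if_neg hjA, if_pos hiA.2, h'] at hj; linarith
        · exact h1 (mem_strictSublevel.2 (hiA.1 ▸ h'))
      · intro hj
        rcases (mem_sublevel.1 (h2 hj)).eq_or_lt with h' | h'
        · rw [hyi, hyi, if_pos hj, if_pos hiA.2, h', hiA.1]
        · exact hle _ (hiA.1 ▸ h')
    rw [this]; exact hA
  · have : sublevel y t = sublevel x (x i) := by
      ext j
      rw [hB, mem_sublevel]
      refine ⟨hle' j, fun hj => ?_⟩
      rcases hj.eq_or_lt with h' | h'
      · rw [hyi, hyi, h']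
        by_cases hiA' : i ∈ A
        · have hlt' : x i < c := lt_of_le_of_ne (mem_sublevel.1 (h2 hiA')) fun h => hiA ⟨h, hiA'⟩
          rw [if_pos hiA', if_pos (h1 (mem_strictSublevel.2 (h' ▸ hlt')))]
        · rw [if_neg hiA']; split_ifs <;> linarith
      · exact hle _ h'
    rw [this]; exact hx _

/-- Lowering `A` slightly refines `x` to a point of the fan whose cone contains both `-indVec A` and
the small perturbations of `x` in its order span. -/
theorem add_smul_mem_berg_locRank (hr : IsRankFn r) {x : α → ℝ} (hx : x ∈ berg r) {c : ℝ}
    {A : Finset α} (hA : FlatIn Finset.univ r A) (h1 : strictSublevel x c ⊆ A)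
    (h2 : A ⊆ sublevel x c) {t : α → ℝ} (ht : t ∈ orderSpan x) {b : ℝ} (hb : 0 ≤ b) :
    t + b • -indVec A ∈ berg (locRank r x) := by
  obtain ⟨y, hy, hxy, hAy⟩ := exists_refine_flat hx hA h1 h2
  obtain ⟨δ, hδ, h⟩ := exists_perturb ht
  rw [mem_berg_locRank_iff hr hx]
  refine ⟨δ, hδ, fun ε h0 hε => orderCone_subset_berg hy ?_⟩
  rw [smul_add, ← add_assoc, smul_smul]
  exact add_mem_orderCone (orderCone_trans hxy (h ε (by rwa [abs_of_nonneg h0])).1)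
    (smul_mem_orderCone (by positivity) hAy)

theorem orderSpan_subset_berg_locRank (hr : IsRankFn r) {x : α → ℝ} (hx : x ∈ berg r) :
    (orderSpan x : Set (α → ℝ)) ⊆ berg (locRank r x) := by
  intro t ht
  obtain ⟨δ, hδ, h⟩ := exists_perturb ht
  rw [mem_berg_locRank_iff hr hx]
  exact ⟨δ, hδ, fun ε h0 hε => orderCone_subset_berg hx (h ε (by rwa [abs_of_nonneg h0])).1⟩

/-- A short move in a tangent direction can only refine the order of `x`. As `x` already has as many
values as the rank allows, the order span does not grow. -/
theorem IsFull.berg_locRank (hr : IsRankFn r) {x : α → ℝ} (hx : IsFull r x) :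
    berg (locRank r x) = orderSpan x := by
  refine subset_antisymm (fun v hv => ?_) (orderSpan_subset_berg_locRank hr hx.1)
  obtain ⟨δ, hδ, h⟩ := exists_forall_mem_berg hr hx.1 hv
  obtain ⟨η, hη, h'⟩ := exists_refines x v
  have hε : 0 < min δ η := by positivity
  set ε := min δ η
  have hm := h ε hε.le (min_le_left _ _)
  have hc := self_mem_orderCone_of_lt (h' ε (by rw [abs_of_pos hε]; exact min_le_right _ _))
  have heq : orderSpan x = orderSpan (x + ε • v) := by
    refine Submodule.eq_of_le_of_finrank_le (orderSpan_mono hc) ?_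
    rw [finrank_orderSpan, finrank_orderSpan]
    have := card_values_le hr hm
    have := hx.card_values hr
    omega
  have h3 : x + ε • v ∈ orderSpan x := by
    rw [heq]; exact orderCone_subset_orderSpan _ (self_mem_orderCone _)
  have h4 := (orderSpan x).sub_mem h3 (orderCone_subset_orderSpan _ (self_mem_orderCone x))
  rw [add_sub_cancel_left] at h4
  exact ((orderSpan x).smul_mem_iff hε.ne').1 h4

/-- At a point of codimension one the tangent cone is a union of half-spaces with common boundary
`orderSpan x`, one for each flat in the interval of rank two. -/
theorem IsAlmostFull.decomp (hr : IsRankFn r) {x : α → ℝ} {i₀ : α} (hx : IsAlmostFull r x i₀)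
    {v : α → ℝ} (hv : v ∈ berg (locRank r x)) :
    v ∈ orderSpan x ∨ ∃ A ∈ coversIn Finset.univ r (strictSublevel x (x i₀)) (sublevel x (x i₀)),
      ∃ c : ℝ, 0 < c ∧ v + c • indVec A ∈ orderSpan x := by
  refine or_iff_not_imp_left.2 fun hvs => ?_
  obtain ⟨δ, hδ, h⟩ := exists_forall_mem_berg hr hx.1 hv
  obtain ⟨η, hη, h'⟩ := exists_refines x v
  have hε : 0 < min δ η := by positivity
  set ε := min δ η
  have hm := h ε hε.le (min_le_left _ _)
  have hlt := h' ε (by rw [abs_of_pos hε]; exact min_le_right _ _)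
  set y := x + ε • v with hy
  have hyi : ∀ i, y i = x i + ε * v i := fun i => by simp [hy]
  have hyle : ∀ i j, x i = x j → (y i ≤ y j ↔ v i ≤ v j) := fun i j hij => by
    rw [hyi, hyi, hij, add_le_add_iff_left, mul_le_mul_iff_right₀ hε]
  have hc : x ∈ orderCone y := self_mem_orderCone_of_lt hlt
  -- Separating two coordinates of one level produces a flat strictly inside its gap, which is
  -- possible only in the gap of rank two.
  have key : ∀ i j, x i = x j → v i < v j → x i = x i₀ ∧
      sublevel y (y i) ∈ coversIn Finset.univ r (strictSublevel x (x i₀)) (sublevel x (x i₀)) := by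
    intro i j hij hvij
    have hA : FlatIn Finset.univ r (sublevel y (y i)) := hm _
    have h1 : strictSublevel x (x i) ⊆ sublevel y (y i) := fun k hk =>
      mem_sublevel.2 (hlt _ _ (mem_strictSublevel.1 hk)).le
    have h2 : sublevel y (y i) ⊆ sublevel x (x i) := fun k hk =>
      mem_sublevel.2 (hc _ _ (mem_sublevel.1 hk))
    have h3 : r (strictSublevel x (x i)) < r (sublevel y (y i)) :=
      (flatIn_strictSublevel hx.1 _).rank_lt hr (Finset.subset_univ _) ⟨h1, fun hs =>
        lt_irrefl _ (mem_strictSublevel.1 (hs (mem_sublevel.2 (le_refl (y i)))))⟩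
    have h4 : r (sublevel y (y i)) < r (sublevel x (x i)) := by
      refine hA.rank_lt hr (Finset.subset_univ _) ⟨h2, fun hs => ?_⟩
      have := mem_sublevel.1 (hs (mem_sublevel.2 hij.ge : j ∈ _))
      rw [hyle j i hij.symm] at this
      linarith
    have h5 : x i = x i₀ := by
      by_contra hne
      have := hx.2.2 i hne
      omega
    rw [h5] at h1 h2 h3 h4
    have := hx.2.1
    exact ⟨h5, mem_coversIn.2 ⟨h2, hA, h1, by omega⟩⟩
  have hex : ∃ i j, x i = x j ∧ v i < v j := by
    by_contra! hn
    exact hvs fun i j hij => le_antisymm (hn j i hij.symm) (hn i j hij)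
  obtain ⟨i, j, hij, hvij⟩ := hex
  obtain ⟨hi0, hA⟩ := key i j hij hvij
  -- Two such flats are comparable as sublevel sets of `y` and have equal rank, so they agree. Thus
  -- `v` takes just two values on the level of `i₀`.
  have huniq : ∀ i' j', x i' = x j' → v i' < v j' → sublevel y (y i') = sublevel y (y i) := by
    intro i' j' hij' hvij'
    obtain ⟨-, hA'⟩ := key i' j' hij' hvij'
    rw [mem_coversIn] at hA hA'
    rcases le_total (y i') (y i) with hle | hle
    · exact hA'.2.1.eq_of_rank_le hr (Finset.subset_univ _) (sublevel_mono y hle) (by omega)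
    · exact (hA.2.1.eq_of_rank_le hr (Finset.subset_univ _) (sublevel_mono y hle) (by omega)).symm
  refine ⟨_, hA, v j - v i, by linarith, ?_⟩
  have hval : ∀ k, x k = x i → v k + (v j - v i) * (if k ∈ sublevel y (y i) then 1 else 0) = v j := by
    intro k hk
    split_ifs with hkA
    · have h1 := (hyle k i hk).1 (mem_sublevel.1 hkA)
      rcases h1.eq_or_lt with h1 | h1
      · rw [h1]; ring
      · exfalso
        have h2 := huniq k i hk h1
        have h3 : i ∈ sublevel y (y k) := h2 ▸ mem_sublevel.2 le_rfl
        rw [mem_sublevel, hyle i k hk.symm] at h3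
        linarith
    · rw [mem_sublevel, hyle k i hk, not_le] at hkA
      rw [mul_zero, add_zero]
      have hjA : ∀ l, x l = x i → v i < v l → l ∉ sublevel y (y i) := fun l hl hvl hn => by
        rw [mem_sublevel, hyle l i hl] at hn; linarith
      rcases lt_trichotomy (v k) (v j) with h1 | h1 | h1
      · exact absurd (huniq k j (hk.trans hij) h1 ▸ mem_sublevel.2 le_rfl) (hjA k hk hkA)
      · exact h1
      · exact absurd (huniq j k (hij.symm.trans hk.symm) h1 ▸ mem_sublevel.2 le_rfl)
          (hjA j hij.symm hvij)
  intro k l hkl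
  simp only [Pi.add_apply, Pi.smul_apply, indVec_apply, smul_eq_mul]
  by_cases hk : x k = x i
  · rw [hval k hk, hval l (hkl.symm.trans hk)]
  · have h1 : v k = v l := by
      rcases lt_trichotomy (v k) (v l) with h1 | h1 | h1
      · exact absurd ((key k l hkl h1).1.trans hi0.symm) hk
      · exact h1
      · exact absurd (hkl.trans ((key l k hkl.symm h1).1.trans hi0.symm)) hk
    have h2 : k ∈ sublevel y (y i) ↔ l ∈ sublevel y (y i) := by
      rw [mem_sublevel, mem_sublevel]
      rcases lt_or_gt_of_ne hk with h3 | h3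
      · exact iff_of_true (hlt _ _ h3).le (hlt _ _ (hkl ▸ h3)).le
      · exact iff_of_false (hlt _ _ h3).not_ge (hlt _ _ (hkl ▸ h3)).not_ge
    rw [h1]
    simp only [h2]

end LocalCones

/-! ### Linear maps between Bergman fans -/

section LinearMaps

set_option linter.unusedSectionVars false

variable {α β : Type*} [DecidableEq α] [Fintype α] [DecidableEq β] [Fintype β]
  {r : Finset α → ℕ} {s : Finset β → ℕ}

/-- An element of the order span is a difference of two points of one cone in the fan. -/
theorem map_eq_zero_of_injOn {W : Type*} [AddCommGroup W] [Module ℝ W] {A : (α → ℝ) →ₗ[ℝ] W}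
    (hA : Set.InjOn A (berg r)) {y t : α → ℝ} (hy : y ∈ berg r) (ht : t ∈ orderSpan y)
    (h : A t = 0) : t = 0 := by
  obtain ⟨a, ha, b, hb, rfl⟩ := mem_orderSpan_iff_exists.1 ht
  rw [map_sub, sub_eq_zero] at h
  rw [hA (orderCone_subset_berg hy ha) (orderCone_subset_berg hy hb) h, sub_self]

theorem le_of_forall_basis_mem {V ι : Type*} [AddCommGroup V] [Module ℝ V] {S W : Submodule ℝ V}
    (b : Module.Basis ι ℝ S) (h : ∀ i, (b i : V) ∈ W) : S ≤ W := by
  have h1 : (⊤ : Submodule ℝ S) ≤ W.comap S.subtype := by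
    rw [← b.span_eq, Submodule.span_le]
    rintro _ ⟨i, rfl⟩
    exact h i
  exact fun v hv => h1 (Submodule.mem_top : (⟨v, hv⟩ : S) ∈ ⊤)

theorem finrank_map_orderSpan {W : Type*} [AddCommGroup W] [Module ℝ W] {A : (α → ℝ) →ₗ[ℝ] W}
    (hA : Set.InjOn A (berg r)) {y : α → ℝ} (hy : y ∈ berg r) :
    Module.finrank ℝ ((orderSpan y).map A) = (values y).card := by
  rw [← finrank_orderSpan, ← LinearMap.range_domRestrict]
  refine LinearMap.finrank_range_of_inj ((injective_iff_map_eq_zero _).2 fun t ht => ?_)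
  exact Subtype.ext (map_eq_zero_of_injOn hA hy t.2 ht)

theorem infinite_image_inv_succ {S : Set ℕ} (hS : S.Infinite) (c : ℝ) (hc : c ≠ 0) :
    ((fun n : ℕ => c * ((n : ℝ) + 1)⁻¹) '' S).Infinite := by
  refine hS.image fun a _ b _ h => ?_
  have := mul_left_cancel₀ hc h
  simpa using inv_injective this

theorem mem_map_orderSpan_of_infinite {W : Type*} [AddCommGroup W] [Module ℝ W]
    {A : (α → ℝ) →ₗ[ℝ] W} {z : ℕ → α → ℝ} {p : ℕ} {v : Fin p → W} {c : ℝ} (hc : c ≠ 0)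
    (h : ∀ n : ℕ, A (z n) = ∑ i : Fin p, (c * ((n : ℝ) + 1)⁻¹) ^ (i : ℕ) • v i) :
    ∃ n₀, {n | ∀ i j, z n i ≤ z n j ↔ z n₀ i ≤ z n₀ j}.Infinite ∧
      ∀ i, v i ∈ (orderSpan (z n₀)).map A := by
  obtain ⟨n₀, hn₀⟩ := exists_infinite_same_order z
  refine ⟨n₀, hn₀, fun i => coeff_mem_of_infinite ((infinite_image_inv_succ hn₀ c hc).mono ?_) i⟩
  rintro _ ⟨n, hn, rfl⟩
  refine Set.mem_ofPred_eq ▸ ?_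
  rw [← h]
  exact Submodule.mem_map_of_mem
    (orderCone_subset_orderSpan _ fun i j hij => (hn i j).2 hij)

/-- Lifts the limit and the direction of a sequence on a ray through `A`. Infinitely many `z n` lie
in one cone, whose span maps injectively, so there the lift is affine in `1 / (n + 1)` as well. -/
theorem exists_limit {W : Type*} [AddCommGroup W] [Module ℝ W] {A : (α → ℝ) →ₗ[ℝ] W}
    (hA : ∀ y ∈ berg r, ∀ t ∈ orderSpan y, A t = 0 → t = 0) {z : ℕ → α → ℝ}
    (hz : ∀ n, z n ∈ berg r) {x v : W} (h : ∀ n : ℕ, A (z n) = x + ((n : ℝ) + 1)⁻¹ • v) :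
    ∃ a ∈ berg r, ∃ u, A a = x ∧ A u = v ∧ {n : ℕ | z n = a + ((n : ℝ) + 1)⁻¹ • u}.Infinite := by
  obtain ⟨n₀, hn₀, hm⟩ := mem_map_orderSpan_of_infinite (v := ![x, v]) one_ne_zero (z := z) (A := A)
    fun n => by simp [Fin.sum_univ_two, h]
  obtain ⟨a, ha, hax⟩ := hm 0
  obtain ⟨u, hu, huv⟩ := hm 1
  simp only [Matrix.cons_val_zero, Matrix.cons_val_one] at hax huv
  have hinf : {n : ℕ | z n = a + ((n : ℝ) + 1)⁻¹ • u ∧ z n ∈ orderCone (z n₀)}.Infinite := by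
    refine hn₀.mono fun n hn => ?_
    have hc : z n ∈ orderCone (z n₀) := fun i j hij => (hn i j).2 hij
    refine ⟨sub_eq_zero.1 (hA _ (hz n₀) _ ((orderSpan _).sub_mem
      (orderCone_subset_orderSpan _ hc) ((orderSpan _).add_mem ha ((orderSpan _).smul_mem _ hu)))
      ?_), hc⟩
    rw [map_sub, h, map_add, map_smul, hax, huv, sub_self]
  refine ⟨a, orderCone_subset_berg (hz n₀) fun i j hij => ?_, u, hax, huv,
    hinf.mono fun n hn => hn.1⟩
  -- The limit `a` inherits the weak inequalities of the cone: a violation `a j < a i` would persist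
  -- in `z n` for large `n`.
  by_contra! hlt
  obtain ⟨N, hN⟩ := exists_nat_gt ((u j - u i) / (a i - a j))
  obtain ⟨n, hn, hnN⟩ := hinf.exists_gt N
  have h1 := hn.2 i j hij
  rw [hn.1] at h1
  simp only [Pi.add_apply, Pi.smul_apply, smul_eq_mul] at h1
  have h2 : (0 : ℝ) < a i - a j := by linarith
  rw [div_lt_iff₀ h2] at hN
  have h3 : (N : ℝ) < n := by exact_mod_cast hnN
  have h4 : (0 : ℝ) < (n : ℝ) + 1 := by positivity
  have h5 : (n + 1) * (a i - a j) ≤ u j - u i := by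
    have h6 : a i - a j ≤ ((n : ℝ) + 1)⁻¹ * (u j - u i) := by linarith
    calc (n + 1) * (a i - a j) ≤ (n + 1) * (((n : ℝ) + 1)⁻¹ * (u j - u i)) := by gcongr
      _ = u j - u i := by field_simp
  nlinarith

/-- The linear part of an affine bijection between Bergman fans is a bijection as well. -/
theorem bijOn_linear_of_affine {φ : (α → ℝ) →ᵃ[ℝ] (β → ℝ)}
    (hφ : Set.BijOn φ (berg r) (berg s)) : Set.BijOn φ.linear (berg r) (berg s) := by
  have hdec : ∀ v, φ v = φ.linear v + φ 0 := fun v => by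
    have := φ.map_vadd 0 v
    simpa using this
  have hinj : Set.InjOn φ.linear (berg r) := fun a ha b hb h =>
    hφ.injOn ha hb (by rw [hdec a, hdec b, h])
  have hn : ∀ n : ℕ, (0 : ℝ) < (n : ℝ) + 1 := fun n => by positivity
  refine ⟨fun y hy => ?_, hinj, fun v hv => ?_⟩
  -- Rescaling: `φ ((n + 1) • y) / (n + 1)` tends to `φ.linear y`, and the fan is a closed cone.
  · obtain ⟨a, ha, -, hax, -, -⟩ := exists_limit (r := s) (A := LinearMap.id)
      (fun _ _ _ _ h => h) (z := fun n : ℕ => ((n : ℝ) + 1)⁻¹ • φ (((n : ℝ) + 1) • y))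
      (fun n => smul_mem_berg (hφ.mapsTo (smul_mem_berg hy (hn n).le)) (inv_nonneg.2 (hn n).le))
      (x := φ.linear y) (v := φ 0) fun n => by
        rw [LinearMap.id_apply, hdec, smul_add, map_smul, inv_smul_smul₀ (hn n).ne']
    exact hax ▸ ha
  · choose y hy hyv using fun n : ℕ => hφ.surjOn (smul_mem_berg hv (hn n).le)
    obtain ⟨a, ha, -, hax, -, -⟩ := exists_limit (r := r) (A := φ.linear)
      (fun _ hy _ ht h => map_eq_zero_of_injOn hinj hy ht h)
      (z := fun n : ℕ => ((n : ℝ) + 1)⁻¹ • y n)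
      (fun n => smul_mem_berg (hy n) (inv_nonneg.2 (hn n).le)) (x := v) (v := -φ 0) fun n => by
        have h1 : φ.linear (y n) = ((n : ℝ) + 1) • v - φ 0 := by
          rw [← hyv n, hdec (y n), add_sub_cancel_right]
        rw [map_smul, h1, smul_sub, inv_smul_smul₀ (hn n).ne', smul_neg, sub_eq_add_neg]
    exact ⟨a, ha, hax⟩

theorem injOn_berg_locRank {W : Type*} [AddCommGroup W] [Module ℝ W] (hr : IsRankFn r)
    {A : (α → ℝ) →ₗ[ℝ] W} (hA : Set.InjOn A (berg r)) {y : α → ℝ} (hy : y ∈ berg r) :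
    Set.InjOn A (berg (locRank r y)) := by
  intro u hu v hv h
  obtain ⟨δ, hδ, h1⟩ := exists_forall_mem_berg hr hy hu
  obtain ⟨η, hη, h2⟩ := exists_forall_mem_berg hr hy hv
  have hε : 0 < min δ η := by positivity
  have := hA (h1 _ hε.le (min_le_left _ _)) (h2 _ hε.le (min_le_right _ _)) (by simp [h])
  exact smul_right_injective _ hε.ne' (add_left_cancel this)

/-- Surjectivity is the delicate part: preimages of points approaching `φ y` along a segment are
lifted by `exists_limit`. By injectivity they approach `y`, and their direction is the required
preimage. -/
theorem bijOn_berg_locRank (hr : IsRankFn r) (hs : IsRankFn s) {φ : (α → ℝ) →ₗ[ℝ] (β → ℝ)}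
    (hφ : Set.BijOn φ (berg r) (berg s)) {y : α → ℝ} (hy : y ∈ berg r) :
    Set.BijOn φ (berg (locRank r y)) (berg (locRank s (φ y))) := by
  refine ⟨fun v hv => ?_, injOn_berg_locRank hr hφ.injOn hy, fun v hv => ?_⟩
  · obtain ⟨δ, hδ, h⟩ := exists_forall_mem_berg hr hy hv
    rw [mem_berg_locRank_iff hs (hφ.mapsTo hy)]
    exact ⟨δ, hδ, fun ε h0 hε => by simpa using hφ.mapsTo (h ε h0 hε)⟩
  · obtain ⟨δ, hδ, h⟩ := exists_forall_mem_berg hs (hφ.mapsTo hy) hv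
    have hn : ∀ n : ℕ, (0 : ℝ) < (n : ℝ) + 1 := fun n => by positivity
    have hn' : ∀ n : ℕ, ((n : ℝ) + 1)⁻¹ * δ ≤ δ := fun n => by
      refine mul_le_of_le_one_left hδ.le (inv_le_one_of_one_le₀ ?_)
      have : (0 : ℝ) ≤ n := by positivity
      linarith
    choose z hz hzv using fun n : ℕ => hφ.surjOn (h (((n : ℝ) + 1)⁻¹ * δ)
      (mul_nonneg (inv_nonneg.2 (hn n).le) hδ.le) (hn' n))
    obtain ⟨a, ha, u, hau, huv, hinf⟩ := exists_limit (r := r) (A := φ)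
      (fun _ hy _ ht h => map_eq_zero_of_injOn hφ.injOn hy ht h) hz (x := φ y) (v := δ • v)
      fun n => by rw [hzv, mul_smul]
    obtain rfl := hφ.injOn ha hy hau
    refine ⟨δ⁻¹ • u, ?_, by rw [map_smul, huv, inv_smul_smul₀ hδ.ne']⟩
    refine smul_mem_berg (mem_berg_locRank hr ha fun η hη => ?_) (inv_nonneg.2 hδ.le)
    obtain ⟨N, hN⟩ := exists_nat_gt η⁻¹
    obtain ⟨n, hnz, hnN⟩ := hinf.exists_gt N
    refine ⟨((n : ℝ) + 1)⁻¹, inv_pos.2 (hn n), ?_, hnz ▸ hz n⟩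
    have h3 : (N : ℝ) < n := by exact_mod_cast hnN
    exact inv_le_of_inv_le₀ hη (by linarith)

theorem exists_perturb_sum (x : α → ℝ) {p : ℕ} {v : Fin p → α → ℝ} (hv : ∀ i, v i ∈ orderSpan x) :
    ∃ δ : ℝ, 0 < δ ∧ ∀ t : Fin p → ℝ, (∀ i, |t i| ≤ δ) →
      x + ∑ i, t i • v i ∈ orderCone x ∧ x ∈ orderCone (x + ∑ i, t i • v i) := by
  obtain ⟨δ, hδ, hgap⟩ := exists_gap x
  choose B hB0 hB using fun i => exists_bound (v i)
  have hBs : 0 ≤ ∑ i, B i := Finset.sum_nonneg fun i _ => (hB0 i).le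
  refine ⟨δ / (∑ i, B i + 1), by positivity, fun t ht => ?_⟩
  set w := ∑ i, t i • v i with hw
  have hwx : w ∈ orderSpan x := (orderSpan x).sum_mem fun i _ => (orderSpan x).smul_mem _ (hv i)
  have hsm : ∀ k, |w k| ≤ δ := fun k => by
    rw [hw, Finset.sum_apply]
    refine (Finset.abs_sum_le_sum_abs _ _).trans ?_
    calc ∑ i, |(t i • v i) k| ≤ ∑ i, δ / (∑ i, B i + 1) * B i := by
          refine Finset.sum_le_sum fun i _ => ?_
          rw [Pi.smul_apply, smul_eq_mul, abs_mul]
          exact mul_le_mul (ht i) (hB i k).le (abs_nonneg _) (by positivity)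
      _ = δ * ((∑ i, B i) / (∑ i, B i + 1)) := by rw [← Finset.mul_sum]; ring
      _ ≤ δ := mul_le_of_le_one_right hδ.le (by rw [div_le_one (by positivity)]; linarith)
  have hlt : ∀ i j, x i < x j → (x + w) i < (x + w) j := fun i j hij => by
    have h1 := abs_le.1 (hsm i)
    have h2 := abs_le.1 (hsm j)
    have h3 := hgap i j hij
    simp only [Pi.add_apply]
    linarith
  refine ⟨fun i j hij => ?_, self_mem_orderCone_of_lt hlt⟩
  rcases hij.eq_or_lt with h | h
  · exact le_of_eq (by simp only [Pi.add_apply]; rw [h, hwx i j h])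
  · exact (hlt i j h).le

/-- Up to moving `x` inside its relatively open cone, the span of this cone is contained in the image
of the span of a single cone. -/
theorem exists_orderSpan_le_map {φ : (α → ℝ) →ₗ[ℝ] (β → ℝ)}
    (hφ : Set.SurjOn φ (berg r) (berg s)) {x : β → ℝ} (hx : x ∈ berg s) :
    ∃ y ∈ berg r, φ y ∈ orderCone x ∧ x ∈ orderCone (φ y) ∧
      orderSpan x ≤ (orderSpan y).map φ := by
  set p := Module.finrank ℝ (orderSpan x)
  let b := Module.finBasis ℝ (orderSpan x)
  obtain ⟨δ, hδ, h⟩ := exists_perturb_sum x (v := fun i => (b i : β → ℝ)) fun i => (b i).2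
  have hc : 0 < min δ 1 := by positivity
  set c := min δ 1 with hcdef
  have hn : ∀ n : ℕ, (0 : ℝ) < (n : ℝ) + 1 := fun n => by positivity
  have ht0 : ∀ n : ℕ, 0 ≤ c * ((n : ℝ) + 1)⁻¹ := fun n => mul_nonneg hc.le (inv_nonneg.2 (hn n).le)
  have htc : ∀ n : ℕ, c * ((n : ℝ) + 1)⁻¹ ≤ c := fun n => by
    refine mul_le_of_le_one_right hc.le (inv_le_one_of_one_le₀ ?_)
    have : (0 : ℝ) ≤ n := by positivity
    linarith
  have hpow : ∀ (n : ℕ) (i : Fin p), |(c * ((n : ℝ) + 1)⁻¹) ^ ((i : ℕ) + 1)| ≤ δ := fun n i => by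
    rw [abs_of_nonneg (pow_nonneg (ht0 n) _), pow_succ]
    calc (c * ((n : ℝ) + 1)⁻¹) ^ (i : ℕ) * (c * ((n : ℝ) + 1)⁻¹) ≤ 1 * c :=
          mul_le_mul (pow_le_one₀ (ht0 n) ((htc n).trans (min_le_right _ _))) (htc n) (ht0 n)
            zero_le_one
      _ ≤ δ := by rw [one_mul]; exact min_le_left _ _
  -- Points on a polynomial curve with constant term `x` and the basis vectors as higher
  -- coefficients. Infinitely many have preimages ordered alike, so all coefficients lie in the
  -- image of one order span.
  have h' := fun n : ℕ => h (fun i => (c * ((n : ℝ) + 1)⁻¹) ^ ((i : ℕ) + 1)) (hpow n)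
  choose z hz hzx using fun n : ℕ => hφ (orderCone_subset_berg hx (h' n).1)
  obtain ⟨n₀, -, hm⟩ := mem_map_orderSpan_of_infinite (A := φ) (z := z)
    (v := Fin.cons x fun i => (b i : β → ℝ)) hc.ne' fun n => by
      rw [hzx, Fin.sum_univ_succ]
      simp
  exact ⟨z n₀, hz n₀, hzx n₀ ▸ (h' n₀).1, hzx n₀ ▸ (h' n₀).2,
    le_of_forall_basis_mem b fun i => by simpa using hm i.succ⟩

theorem locRank_univ (hr : IsRankFn r) (x : α → ℝ) :
    r Finset.univ + locRank r x ∅ = r ∅ + locRank r x Finset.univ := by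
  rw [sum_gaps hr x, locRank, locRank, add_assoc, ← Finset.sum_add_distrib]
  congr 1
  refine Finset.sum_congr rfl fun c _ => ?_
  have h1 : levelPart x c ∅ = strictSublevel x c := by ext i; simp [mem_levelPart]
  have h2 : levelPart x c Finset.univ = sublevel x c := by
    ext i; simp [mem_levelPart, le_iff_lt_or_eq]
  rw [h1, h2]
  exact Nat.sub_add_cancel (hr.mono (strictSublevel_subset x c))

/-- The image of a maximal cone contains a cube of the same dimension, which must lie in the span of
a single cone of the target. -/
theorem rank_le_of_injOn (hr : IsRankFn r) (hs : IsRankFn s) {φ : (α → ℝ) →ₗ[ℝ] (β → ℝ)}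
    (hm : Set.MapsTo φ (berg r) (berg s)) (hi : Set.InjOn φ (berg r)) (hne : (berg r).Nonempty) :
    r Finset.univ + s ∅ ≤ s Finset.univ + r ∅ := by
  obtain ⟨x, hx⟩ := hne
  obtain ⟨y, hy, -⟩ := exists_isFull hr hx
  let b := Module.finBasis ℝ (orderSpan y)
  obtain ⟨δ, hδ, h⟩ := exists_perturb_sum y (v := fun i => (b i : α → ℝ)) fun i => (b i).2
  obtain ⟨z, hz, hzb⟩ := exists_orderSpan_of_isTangentCube hs (hm hy.1)
    (v := fun i => φ (b i)) ⟨δ, hδ, fun t ht => by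
      have := hm (orderCone_subset_berg hy.1 (h t fun i => by
        rw [abs_of_nonneg (ht i).1]; exact (ht i).2).1)
      simpa using this⟩
  have h1 := Submodule.finrank_mono (Submodule.map_le_iff_le_comap.2
    (le_of_forall_basis_mem (W := (orderSpan z).comap φ) b hzb))
  rw [finrank_map_orderSpan hi hy.1, finrank_orderSpan] at h1
  have h3 := card_values_le (isRankFn_locRank hs (φ y)) hz
  have h4 := hy.card_values hr
  have h5 := locRank_univ hs (φ y)
  omega

theorem rank_le_of_surjOn (hr : IsRankFn r) (hs : IsRankFn s) {φ : (α → ℝ) →ₗ[ℝ] (β → ℝ)}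
    (hφ : Set.SurjOn φ (berg r) (berg s)) (hne : (berg s).Nonempty) :
    s Finset.univ + r ∅ ≤ r Finset.univ + s ∅ := by
  obtain ⟨x, hx⟩ := hne
  obtain ⟨x, hx, -⟩ := exists_isFull hs hx
  obtain ⟨y, hy, -, -, hle⟩ := exists_orderSpan_le_map hφ hx.1
  have h1 := (Submodule.finrank_mono hle).trans (Submodule.finrank_map_le φ (orderSpan y))
  rw [finrank_orderSpan, finrank_orderSpan] at h1
  have h3 := card_values_le hr hy
  have h4 := hx.card_values hs
  omega

end LinearMaps

/-! ### Linear images that are linear spaces -/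

section LinearImage

set_option linter.unusedSectionVars false

variable {α : Type*} [DecidableEq α] [Fintype α] {r : Finset α → ℕ}

theorem coversIn_eq_of_mem {E F G A B : Finset α} (hr : IsRankFn r) (hF : FlatIn E r F)
    (hA : A ∈ coversIn E r F G) (hB : B ∈ coversIn E r F G) {i : α} (hiA : i ∈ A) (hiB : i ∈ B)
    (hiF : i ∉ F) : A = B := by
  rw [mem_coversIn] at hA hB
  rw [← hF.eq_clIn_insert hr hA.2.1 hA.2.2.1 hA.2.2.2 hiA hiF]
  exact hF.eq_clIn_insert hr hB.2.1 hB.2.2.1 hB.2.2.2 hiB hiF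

theorem exists_mem_of_mem_coversIn {E F G A : Finset α} (hA : A ∈ coversIn E r F G) :
    ∃ i ∈ A, i ∉ F := by
  rw [mem_coversIn] at hA
  by_contra! hn
  have : A = F := subset_antisymm hn hA.2.2.1
  have h2 := hA.2.2.2
  rw [this] at h2
  omega

/-- If all intervals of rank two contain at most two intermediate flats, then there are not more
covers than the corank. -/
theorem card_coversIn_le (hr : IsRankFn r)
    (h : ∀ F G, FlatIn Finset.univ r F → FlatIn Finset.univ r G → F ⊆ G → r G = r F + 2 →
      (coversIn Finset.univ r F G).card ≤ 2) {F : Finset α} (hF : FlatIn Finset.univ r F) :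
    (coversIn Finset.univ r F Finset.univ).card + r F ≤ r Finset.univ := by
  have key : ∀ n : ℕ, ∀ F, FlatIn Finset.univ r F → r Finset.univ - r F = n →
      (coversIn Finset.univ r F Finset.univ).card + r F ≤ r Finset.univ := by
    intro n
    induction n using Nat.strong_induction_on with
    | _ n ih =>
    intro F hF hn
    have hle : r F ≤ r Finset.univ := hr.mono (Finset.subset_univ _)
    rcases (coversIn Finset.univ r F Finset.univ).eq_empty_or_nonempty with he | ⟨A, hA⟩
    · rw [he]; simpa using hle
    have hA' := mem_coversIn.1 hA
    have hAle : r A ≤ r Finset.univ := hr.mono (Finset.subset_univ _)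
    have h1 := ih (r Finset.univ - r A) (by omega) A hA'.2.1 rfl
    have : Nonempty α := ⟨(exists_mem_of_mem_coversIn hA).choose⟩
    have hb : ∀ B ∈ (coversIn Finset.univ r F Finset.univ).erase A, ∃ b ∈ B, b ∉ F :=
      fun B hB => exists_mem_of_mem_coversIn (Finset.mem_of_mem_erase hB)
    choose! b hbB hbF using hb
    have hbA : ∀ B ∈ (coversIn Finset.univ r F Finset.univ).erase A, b B ∉ A := fun B hB hn =>
      Finset.ne_of_mem_erase hB (coversIn_eq_of_mem hr hF (Finset.mem_of_mem_erase hB) hA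
        (hbB B hB) hn (hbF B hB))
    have hBsub : ∀ B ∈ (coversIn Finset.univ r F Finset.univ).erase A,
        B ⊆ clIn Finset.univ r (insert (b B) A) := fun B hB => by
      have hB' := mem_coversIn.1 (Finset.mem_of_mem_erase hB)
      exact (hF.eq_clIn_insert hr hB'.2.1 hB'.2.2.1 hB'.2.2.2 (hbB B hB) (hbF B hB)).superset.trans
        (hr.clIn_mono (Finset.insert_subset_insert _ hA'.2.2.1))
    have hcov : ∀ B ∈ (coversIn Finset.univ r F Finset.univ).erase A,
        clIn Finset.univ r (insert (b B) A) ∈ coversIn Finset.univ r A Finset.univ := fun B hB =>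
      clIn_insert_mem_coversIn hr hA'.2.1 FlatIn.ground (Finset.subset_univ _)
        (Finset.mem_univ _) (hbA B hB)
    -- Joining with `A` is injective on the other covers of `F`. If `B` and `C` had the same join
    -- with `A`, then `A`, `B`, `C` would be three flats in an interval of rank two.
    have h2 : ((coversIn Finset.univ r F Finset.univ).erase A).card ≤
        (coversIn Finset.univ r A Finset.univ).card := by
      refine Finset.card_le_card_of_injOn (fun B => clIn Finset.univ r (insert (b B) A)) hcov ?_
      intro B hB C hC hBC
      simp only at hBC
      by_contra hne
      have hG := mem_coversIn.1 (hcov B hB)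
      set G := clIn Finset.univ r (insert (b B) A) with hGdef
      have hmem : ∀ D ∈ (coversIn Finset.univ r F Finset.univ), D ⊆ G →
          D ∈ coversIn Finset.univ r F G := fun D hD hDG => by
        have hD' := mem_coversIn.1 hD
        exact mem_coversIn.2 ⟨hDG, hD'.2⟩
      have h3 := h F G hF hG.2.1 (hA'.2.2.1.trans hG.2.2.1) (by omega)
      have h4 : 2 < (coversIn Finset.univ r F G).card := by
        rw [Finset.two_lt_card]
        exact ⟨A, hmem A hA hG.2.2.1, B, hmem B (Finset.mem_of_mem_erase hB) (hBsub B hB), C,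
          hmem C (Finset.mem_of_mem_erase hC) (hBC ▸ hBsub C hC),
          (Finset.ne_of_mem_erase hB).symm, (Finset.ne_of_mem_erase hC).symm, hne⟩
      omega
    rw [Finset.card_erase_of_mem hA] at h2
    have := hA'.2.2.2
    omega
  exact key _ F hF rfl

theorem span_berg_le (hr : IsRankFn r) :
    Submodule.span ℝ (berg r) ≤
      Submodule.span ℝ (indVec '' (coversIn Finset.univ r ∅ Finset.univ : Set (Finset α))) := by
  rw [Submodule.span_le]
  intro x hx
  refine Submodule.span_le.2 ?_ (orderSpan_le_span x (orderCone_subset_orderSpan x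
    (self_mem_orderCone x)))
  rintro _ ⟨t, rfl⟩
  have h := sum_coversIn_indVec hr (flatIn_empty_of_mem_berg hx) (hx t) (Finset.empty_subset _)
  simp only [indVec_empty, sub_zero] at h
  simp only [← h]
  refine Submodule.sum_mem _ fun A hA => Submodule.subset_span ⟨A, ?_, rfl⟩
  have hA := mem_coversIn.1 hA
  exact Finset.mem_coe.2 (mem_coversIn.2 ⟨Finset.subset_univ _, hA.2⟩)

/-- At an almost full point for the interval, the span of its cone maps to a hyperplane `T` of `U`.
Each flat of the interval spans a half-space on one side of `T`, and by injectivity no two of them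
share a side. -/
theorem card_coversIn_le_two_of_image_eq {W : Type*} [AddCommGroup W] [Module ℝ W]
    [Module.Finite ℝ W] (hr : IsRankFn r) {φ : (α → ℝ) →ₗ[ℝ] W} (hφ : Set.InjOn φ (berg r))
    {U : Submodule ℝ W} (hU : φ '' berg r ⊆ U) (hdim : r ∅ + Module.finrank ℝ U = r Finset.univ)
    (h0 : FlatIn Finset.univ r ∅) {F G : Finset α} (hF : FlatIn Finset.univ r F)
    (hG : FlatIn Finset.univ r G) (hFG : F ⊆ G) (hrk : r G = r F + 2) :
    (coversIn Finset.univ r F G).card ≤ 2 := by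
  obtain ⟨x, i₀, hx, rfl, rfl⟩ := exists_isAlmostFull hr h0 hF hG hFG hrk
  by_contra! hcard
  obtain ⟨A, hA, B, hB, C, hC, hAB, hAC, hBC⟩ := Finset.two_lt_card.1 hcard
  have hTdim := finrank_map_orderSpan hφ hx.1
  set T := (orderSpan x).map φ with hT
  have hTU : T ≤ U := by
    rintro _ ⟨t, ht, rfl⟩
    obtain ⟨a, ha, b, hb, rfl⟩ := mem_orderSpan_iff_exists.1 ht
    rw [map_sub]
    exact U.sub_mem (hU ⟨a, orderCone_subset_berg hx.1 ha, rfl⟩)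
      (hU ⟨b, orderCone_subset_berg hx.1 hb, rfl⟩)
  have hcv := hx.card_values hr
  obtain ⟨w, hwU, hwT⟩ : ∃ w ∈ U, w ∉ T := by
    by_contra! hn
    have := Submodule.finrank_mono hn
    omega
  obtain ⟨f, hfw, hfT⟩ := Submodule.exists_le_ker_of_notMem hwT
  have hker : T = LinearMap.ker f ⊓ U := by
    refine Submodule.eq_of_le_of_finrank_le (le_inf hfT hTU) ?_
    have : LinearMap.ker f ⊓ U < U := lt_of_le_of_ne inf_le_right fun h => hfw (by
      have := h.ge hwU
      exact LinearMap.mem_ker.1 this.1)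
    have := Submodule.finrank_lt_finrank_of_lt this
    omega
  have hu : ∀ D ∈ coversIn Finset.univ r (strictSublevel x (x i₀)) (sublevel x (x i₀)),
      φ (indVec D) ∈ U := fun D hD => by
    have := hU ⟨_, neg_smul_indVec_mem_berg h0 (mem_coversIn.1 hD).2.1 one_pos, rfl⟩
    rw [one_smul, map_neg] at this
    exact (U.neg_mem_iff).1 this
  have key : ∀ D ∈ coversIn Finset.univ r (strictSublevel x (x i₀)) (sublevel x (x i₀)),
      ∀ D' ∈ coversIn Finset.univ r (strictSublevel x (x i₀)) (sublevel x (x i₀)), D ≠ D' →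
      ¬ 0 ≤ f (φ (indVec D)) * f (φ (indVec D')) := by
    intro D hD D' hD' hne hpos
    -- On the same side of `T`, nonnegative multiples of the two vectors, not both zero, have equal
    -- distance from `T`, so they agree modulo `T`.
    obtain ⟨c, c', hc, hc', hcc, heq⟩ : ∃ c c' : ℝ, 0 ≤ c ∧ 0 ≤ c' ∧ 0 < c + c' ∧
        c * f (φ (indVec D)) = c' * f (φ (indVec D')) := by
      set a := f (φ (indVec D))
      set b := f (φ (indVec D'))
      by_cases hab : 0 < |a| + |b|
      · refine ⟨|b|, |a|, abs_nonneg _, abs_nonneg _, by linarith, ?_⟩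
        rcases abs_cases a with h1 | h1 <;> rcases abs_cases b with h2 | h2 <;> rw [h1.1, h2.1] <;>
          nlinarith
      · have h1 := abs_nonneg a
        have h2 := abs_nonneg b
        have h3 : a = 0 := abs_eq_zero.1 (by linarith)
        have h4 : b = 0 := abs_eq_zero.1 (by linarith)
        exact ⟨1, 1, zero_le_one, zero_le_one, by norm_num, by rw [h3, h4]⟩
    have hmem : φ (c' • indVec D' - c • indVec D) ∈ T := by
      rw [hker, map_sub, map_smul, map_smul]
      refine ⟨?_, U.sub_mem (U.smul_mem _ (hu _ hD')) (U.smul_mem _ (hu _ hD))⟩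
      simp [heq]
    obtain ⟨t, ht, hte⟩ := hmem
    have hD1 := mem_coversIn.1 hD
    have hD1' := mem_coversIn.1 hD'
    have h1 := add_smul_mem_berg_locRank hr hx.1 hD1.2.1 hD1.2.2.1 hD1.1
      (orderSpan x).zero_mem hc
    have h2 := add_smul_mem_berg_locRank hr hx.1 hD1'.2.1 hD1'.2.2.1 hD1'.1 ht hc'
    have h3 := injOn_berg_locRank hr hφ hx.1 h1 h2 (by
      rw [map_add, map_add, hte]; simp only [map_sub, map_smul, map_neg, map_zero]; module)
    obtain ⟨i, hi, hiF⟩ := exists_mem_of_mem_coversIn hD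
    obtain ⟨j, hj, hjF⟩ := exists_mem_of_mem_coversIn hD'
    have hxi : ∀ k ∈ sublevel x (x i₀), k ∉ strictSublevel x (x i₀) → x k = x i₀ :=
      fun k hk hk' => le_antisymm (mem_sublevel.1 hk)
        (not_lt.1 fun h => hk' (mem_strictSublevel.2 h))
    have hij := ht i j ((hxi i (hD1.1 hi) hiF).trans (hxi j (hD1'.1 hj) hjF).symm)
    have hiD' : i ∉ D' := fun h =>
      hne (coversIn_eq_of_mem hr (flatIn_strictSublevel hx.1 _) hD hD' hi h hiF)
    have hjD : j ∉ D := fun h =>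
      hne (coversIn_eq_of_mem hr (flatIn_strictSublevel hx.1 _) hD hD' h hj hjF)
    have h4 := congrFun h3 i
    have h5 := congrFun h3 j
    simp [hi, hj, hiD', hjD] at h4 h5
    linarith
  have h1 := key A hA B hB hAB
  have h2 := key A hA C hC hAC
  have h3 := key B hB C hC hBC
  push Not at h1 h2 h3
  set a := f (φ (indVec A))
  set b := f (φ (indVec B))
  set c := f (φ (indVec C))
  have h4 : 0 < (a * b) * (a * c) := mul_pos_of_neg_of_neg h1 h2
  nlinarith [sq_nonneg a]

/-- A Bergman fan that is mapped bijectively to a linear space by a linear map is linear itself. -/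
theorem neg_mem_berg_of_image_eq {W : Type*} [AddCommGroup W] [Module ℝ W]
    [Module.Finite ℝ W] (hr : IsRankFn r) {φ : (α → ℝ) →ₗ[ℝ] W} (hφ : Set.InjOn φ (berg r))
    {U : Submodule ℝ W} (hU : φ '' berg r = U) (hdim : r ∅ + Module.finrank ℝ U = r Finset.univ)
    {v : α → ℝ} (hv : v ∈ berg r) : -v ∈ berg r := by
  have h0 := flatIn_empty_of_mem_berg hv
  -- There are at most as many flats of rank one above `∅` as the dimension of `U`, and their
  -- indicators span the fan. So `φ` maps the span of the fan onto `U` without kernel.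
  have h1 := card_coversIn_le hr (fun F G hF hG hFG hrk =>
    card_coversIn_le_two_of_image_eq hr hφ hU.subset hdim h0 hF hG hFG hrk) h0
  set S := Submodule.span ℝ (berg r) with hS
  have h2 : Module.finrank ℝ S ≤ (coversIn Finset.univ r ∅ Finset.univ).card := by
    refine (Submodule.finrank_mono (span_berg_le hr)).trans ?_
    rw [← Finset.coe_image]
    exact (finrank_span_finset_le_card _).trans Finset.card_image_le
  have h3 : U ≤ LinearMap.range (φ.domRestrict S) := by
    intro w hw
    obtain ⟨y, hy, rfl⟩ := hU.superset hw
    exact ⟨⟨y, Submodule.subset_span hy⟩, rfl⟩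
  have h4 := LinearMap.finrank_range_add_finrank_ker (φ.domRestrict S)
  have h5 := Submodule.finrank_mono h3
  have h6 : LinearMap.ker (φ.domRestrict S) = ⊥ := Submodule.finrank_eq_zero.1 (by omega)
  obtain ⟨y, hy, hyv⟩ := hU.superset (U.neg_mem (hU.subset ⟨v, hv, rfl⟩))
  have h7 : (⟨y + v, S.add_mem (Submodule.subset_span hy) (Submodule.subset_span hv)⟩ : S) ∈
      LinearMap.ker (φ.domRestrict S) := by
    rw [LinearMap.mem_ker, LinearMap.domRestrict_apply, map_add, hyv, neg_add_cancel]
  rw [h6, Submodule.mem_bot] at h7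
  have h8 : y = -v := eq_neg_of_add_eq_zero_left (congrArg Subtype.val h7)
  exact h8 ▸ hy

end LinearImage

/-! ### The inverse of a linear bijection of Bergman fans -/

section Inverse

set_option linter.unusedSectionVars false

/-- The derivative exists and is locally constant, hence constant on the half-line. -/
theorem exists_eq_add_smul_of_locally_affine {V : Type*} [NormedAddCommGroup V] [NormedSpace ℝ V]
    {f : ℝ → V} (h : ∀ t : ℝ, 0 < t → ∃ w : V, ∃ δ : ℝ, 0 < δ ∧ ∀ ε, |ε| ≤ δ →
      f (t + ε) = f t + ε • w) :
    ∃ a w : V, ∀ t : ℝ, 0 < t → f t = a + t • w := by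
  choose! w δ hδ hw using h
  have hnear : ∀ t : ℝ, 0 < t → ∀ᶠ u in nhds t, f u = f t + (u - t) • w t := fun t ht => by
    filter_upwards [Metric.ball_mem_nhds t (hδ t ht)] with u hu
    have := hw t ht (u - t) (by rw [Metric.mem_ball, Real.dist_eq] at hu; exact hu.le)
    rwa [add_sub_cancel] at this
  have hder : ∀ t : ℝ, 0 < t → HasDerivAt f (w t) t := fun t ht => by
    have h1 : HasDerivAt (fun u : ℝ => f t + (u - t) • w t) ((1 : ℝ) • w t) t :=
      (((hasDerivAt_id t).sub_const t).smul_const (w t)).const_add (f t)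
    rw [one_smul] at h1
    exact h1.congr_of_eventuallyEq (hnear t ht)
  have hwc : ∀ t : ℝ, 0 < t → ∀ᶠ u in nhds t, w u = w t := fun t ht => by
    filter_upwards [(hnear t ht).eventually_nhds, lt_mem_nhds ht] with u hu hu0
    have h1 : HasDerivAt (fun u : ℝ => f t + (u - t) • w t) ((1 : ℝ) • w t) u :=
      (((hasDerivAt_id u).sub_const t).smul_const (w t)).const_add (f t)
    rw [one_smul] at h1
    exact (hder u hu0).unique (h1.congr_of_eventuallyEq hu)
  have hconst : ∀ g : ℝ → V, (∀ t : ℝ, 0 < t → HasDerivAt g 0 t) → ∀ t : ℝ, 0 < t → g t = g 1 :=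
    fun g hg t ht => isOpen_Ioi.is_const_of_deriv_eq_zero isPreconnected_Ioi
      (fun u hu => (hg u hu).differentiableAt.differentiableWithinAt)
      (fun u hu => (hg u hu).deriv) ht (Set.mem_Ioi.2 one_pos)
  have hw1 : ∀ t : ℝ, 0 < t → w t = w 1 := hconst w fun t ht =>
    (hasDerivAt_const t (w t)).congr_of_eventuallyEq (hwc t ht)
  refine ⟨f 1 - (1 : ℝ) • w 1, w 1, fun t ht => ?_⟩
  have := hconst (fun t => f t - t • w 1) (fun t ht => by
    have h1 := (hder t ht).sub ((hasDerivAt_id t).smul_const (w 1))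
    rw [hw1 t ht, one_smul, sub_self] at h1
    exact h1) t ht
  rw [← this, sub_add_cancel]

theorem eq_of_add_smul_eq {V : Type*} [AddCommGroup V] [Module ℝ V] {a b v w : V} {δ : ℝ}
    (hδ : 0 < δ) (h : ∀ t : ℝ, 0 < t → t ≤ δ → a + t • v = b + t • w) : a = b ∧ v = w := by
  have h1 := h δ hδ le_rfl
  have h2 := h (δ / 2) (by linarith) (by linarith)
  have h3 : (δ / 2) • v = (δ / 2) • w := by
    have h4 : a + δ • v - (a + (δ / 2) • v) = b + δ • w - (b + (δ / 2) • w) := by rw [h1, h2]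
    have h5 : a + δ • v - (a + (δ / 2) • v) = (δ / 2) • v := by module
    have h6 : b + δ • w - (b + (δ / 2) • w) = (δ / 2) • w := by module
    rwa [h5, h6] at h4
  refine ⟨?_, smul_right_injective V (by linarith : δ / 2 ≠ 0) h3⟩
  rw [h3] at h2
  exact add_right_cancel h2

variable {α β : Type*} [DecidableEq α] [Fintype α] [DecidableEq β] [Fintype β]
  {r : Finset α → ℕ} {s : Finset β → ℕ} {φ : (α → ℝ) →ₗ[ℝ] (β → ℝ)} {ψ : (β → ℝ) → α → ℝ}

theorem inverse_eq (hψ : Set.InvOn ψ φ (berg r) (berg s)) {y : α → ℝ} (hy : y ∈ berg r) {x : β → ℝ}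
    (h : φ y = x) : ψ x = y := h ▸ hψ.1 hy

theorem inverse_mem (hφ : Set.BijOn φ (berg r) (berg s)) (hψ : Set.InvOn ψ φ (berg r) (berg s))
    {x : β → ℝ} (hx : x ∈ berg s) : ψ x ∈ berg r := by
  obtain ⟨y, hy, rfl⟩ := hφ.surjOn hx
  rwa [hψ.1 hy]

theorem inverse_smul (hφ : Set.BijOn φ (berg r) (berg s))
    (hψ : Set.InvOn ψ φ (berg r) (berg s)) {x : β → ℝ} (hx : x ∈ berg s) {c : ℝ} (hc : 0 ≤ c) :
    ψ (c • x) = c • ψ x :=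
  inverse_eq hψ (smul_mem_berg (inverse_mem hφ hψ hx) hc) (by rw [map_smul, hψ.2 hx])

/-- The inverse is affine along short segments. -/
theorem inverse_add_smul (hr : IsRankFn r) (hφ : Set.BijOn φ (berg r) (berg s))
    (hψ : Set.InvOn ψ φ (berg r) (berg s)) {a : β → ℝ} (ha : a ∈ berg s) {w : α → ℝ}
    (hw : w ∈ berg (locRank r (ψ a))) :
    ∃ δ : ℝ, 0 < δ ∧ ∀ ε, 0 ≤ ε → ε ≤ δ → ψ (a + ε • φ w) = ψ a + ε • w := by
  obtain ⟨δ, hδ, h⟩ := exists_forall_mem_berg hr (inverse_mem hφ hψ ha) hw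
  exact ⟨δ, hδ, fun ε h0 hε => inverse_eq hψ (h ε h0 hε) (by rw [map_add, map_smul, hψ.2 ha])⟩

theorem exists_inverse_add_smul (hr : IsRankFn r) (hs : IsRankFn s)
    (hφ : Set.BijOn φ (berg r) (berg s)) (hψ : Set.InvOn ψ φ (berg r) (berg s)) {a u : β → ℝ}
    (ha : a ∈ berg s) (hu : u ∈ berg (locRank s a)) :
    ∃ w, ∃ δ : ℝ, 0 < δ ∧ ∀ ε, 0 ≤ ε → ε ≤ δ → ψ (a + ε • u) = ψ a + ε • w := by
  have hb := bijOn_berg_locRank hr hs hφ (inverse_mem hφ hψ ha)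
  rw [hψ.2 ha] at hb
  obtain ⟨w, hw, rfl⟩ := hb.surjOn hu
  exact ⟨w, inverse_add_smul hr hφ hψ ha hw⟩

/-- The inverse is affine near the points of the maximal cones. -/
theorem IsFull.exists_inverse_add_smul (hr : IsRankFn r) (hs : IsRankFn s)
    (hφ : Set.BijOn φ (berg r) (berg s)) (hψ : Set.InvOn ψ φ (berg r) (berg s)) {z u : β → ℝ}
    (hz : IsFull s z) (hu : u ∈ orderSpan z) :
    ∃ w, ∃ δ : ℝ, 0 < δ ∧ ∀ ε : ℝ, |ε| ≤ δ → ψ (z + ε • u) = ψ z + ε • w := by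
  have hy := inverse_mem hφ hψ hz.1
  have hb := bijOn_berg_locRank hr hs hφ hy
  rw [hψ.2 hz.1, hz.berg_locRank hs] at hb
  obtain ⟨w, hw, rfl⟩ := hb.surjOn hu
  -- The tangent cone at the full point `z` is linear. So is the one at `ψ z`, which maps to it
  -- bijectively and has matching rank. This makes the inverse affine in both directions along the
  -- line.
  have hneg : -w ∈ berg (locRank r (ψ z)) := by
    refine neg_mem_berg_of_image_eq (isRankFn_locRank hr _) hb.injOn hb.image_eq ?_ hw
    rw [finrank_orderSpan]
    have h1 := hz.card_values hs
    have h2 := rank_le_of_injOn hr hs hφ.mapsTo hφ.injOn ⟨_, hy⟩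
    have h3 := rank_le_of_surjOn hr hs hφ.surjOn ⟨_, hz.1⟩
    have h4 := locRank_univ hr (ψ z)
    omega
  obtain ⟨δ, hδ, h1⟩ := inverse_add_smul hr hφ hψ hz.1 hw
  obtain ⟨η, hη, h2⟩ := inverse_add_smul hr hφ hψ hz.1 hneg
  refine ⟨w, min δ η, by positivity, fun ε hε => ?_⟩
  rcases le_total 0 ε with h0 | h0
  · rw [abs_of_nonneg h0] at hε
    exact h1 ε h0 (hε.trans (min_le_left _ _))
  · rw [abs_of_nonpos h0] at hε
    have := h2 (-ε) (by linarith) (hε.trans (min_le_right _ _))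
    rwa [map_neg, neg_smul_neg, neg_smul_neg] at this

theorem add_smul_mem_orderCone_congr {x a z : β → ℝ} (ha : a ∈ orderCone x) (hz : z ∈ orderCone x)
    (hxz : x ∈ orderCone z) {t : ℝ} (ht : 0 < t) :
    a + t • z ∈ orderCone x ∧ x ∈ orderCone (a + t • z) := by
  refine ⟨add_mem_orderCone ha (smul_mem_orderCone ht.le hz), self_mem_orderCone_of_lt
    fun i j hij => ?_⟩
  have h1 := ha i j hij.le
  have h2 : z i < z j := lt_of_not_ge fun h => (hxz j i h).not_gt hij
  simp only [Pi.add_apply, Pi.smul_apply, smul_eq_mul]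
  have := mul_lt_mul_of_pos_left h2 ht
  linarith

/-- Along the ray of points `a + t • z` with `t > 0` all points are full, so `ψ` is affine there.
Its constant term is read off at `t = 0` as `ψ a`, and its slope at infinity, by homogeneity, as `ψ
z`. -/
theorem inverse_add_of_isFull (hr : IsRankFn r) (hs : IsRankFn s)
    (hφ : Set.BijOn φ (berg r) (berg s)) (hψ : Set.InvOn ψ φ (berg r) (berg s)) {a z : β → ℝ}
    (hz : IsFull s z) (ha : a ∈ orderCone z) : ψ (a + z) = ψ a + ψ z := by
  have hz0 := self_mem_orderCone z
  have hcong := fun (t : ℝ) (ht : 0 < t) => add_smul_mem_orderCone_congr ha hz0 hz0 ht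
  have hab : a ∈ berg s := orderCone_subset_berg hz.1 ha
  obtain ⟨b, w, hbw⟩ := exists_eq_add_smul_of_locally_affine (f := fun t => ψ (a + t • z))
    fun t ht => by
      obtain ⟨w, δ, hδ, h⟩ := (hz.congr (hcong t ht).1 (hcong t ht).2).exists_inverse_add_smul hr hs
        hφ hψ (u := z) (by
          rw [← orderSpan_congr (hcong t ht).2 (hcong t ht).1]
          exact orderCone_subset_orderSpan _ hz0)
      refine ⟨w, δ, hδ, fun ε hε => ?_⟩
      rw [← h ε hε, add_assoc, ← add_smul]
  have hzloc : z ∈ berg (locRank s a) := (mem_berg_locRank_iff hs hab).2 ⟨1, one_pos,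
    fun ε h0 _ => orderCone_subset_berg hz.1 (add_mem_orderCone ha (smul_mem_orderCone h0 hz0))⟩
  have haloc : a ∈ berg (locRank s z) := (mem_berg_locRank_iff hs hz.1).2 ⟨1, one_pos,
    fun ε h0 _ => orderCone_subset_berg hz.1 (add_mem_orderCone hz0 (smul_mem_orderCone h0 ha))⟩
  obtain ⟨w₁, δ₁, hδ₁, h₁⟩ := exists_inverse_add_smul hr hs hφ hψ hab hzloc
  obtain ⟨w₂, δ₂, hδ₂, h₂⟩ := exists_inverse_add_smul hr hs hφ hψ hz.1 haloc
  obtain ⟨hba, -⟩ := eq_of_add_smul_eq hδ₁ fun t ht htδ => (hbw t ht).symm.trans (h₁ t ht.le htδ)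
  obtain ⟨hwz, -⟩ := eq_of_add_smul_eq (a := w) (v := b) (b := ψ z) (w := w₂) hδ₂
    fun t ht htδ => by
      rw [← h₂ t ht.le htδ]
      have h3 : z + t • a = t • (a + t⁻¹ • z) := by
        rw [smul_add, smul_inv_smul₀ ht.ne', add_comm]
      rw [h3, inverse_smul hφ hψ (orderCone_subset_berg hz.1 (hcong _ (inv_pos.2 ht)).1) ht.le,
        hbw _ (inv_pos.2 ht), smul_add, smul_inv_smul₀ ht.ne', add_comm]
  have := hbw 1 one_pos
  rwa [one_smul, one_smul, hba, hwz] at this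

/-- The inverse is additive on the cones of the fine subdivision. -/
theorem inverse_add (hr : IsRankFn r) (hs : IsRankFn s)
    (hφ : Set.BijOn φ (berg r) (berg s)) (hψ : Set.InvOn ψ φ (berg r) (berg s)) {x a b : β → ℝ}
    (hx : x ∈ berg s) (ha : a ∈ orderCone x) (hb : b ∈ orderCone x) : ψ (a + b) = ψ a + ψ b := by
  obtain ⟨z, hz, hxz⟩ := exists_isFull hs hx
  replace ha := orderCone_trans hxz ha
  replace hb := orderCone_trans hxz hb
  -- `ψ (a + b + z)` is expanded in two ways, with `z` and with `b + z` as the full point; then `ψ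
  -- z` is cancelled.
  have h1 := inverse_add_of_isFull hr hs hφ hψ hz (add_mem_orderCone ha hb)
  have hc := add_smul_mem_orderCone_congr hb (self_mem_orderCone z) (self_mem_orderCone z) one_pos
  rw [one_smul] at hc
  have h2 := inverse_add_of_isFull hr hs hφ hψ (hz.congr hc.1 hc.2) (orderCone_trans hc.2 ha)
  rw [inverse_add_of_isFull hr hs hφ hψ hz hb, ← add_assoc, ← add_assoc] at h2
  exact add_right_cancel (h1.symm.trans h2)

theorem inverse_eq_of_mem_locRank (hr : IsRankFn r) (hs : IsRankFn s)
    (hφ : Set.BijOn φ (berg r) (berg s)) (hψ : Set.InvOn ψ φ (berg r) (berg s)) {x v : β → ℝ}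
    {y w : α → ℝ} (hy : y ∈ berg r) (hx : x ∈ berg s) (hyx : φ y ∈ orderCone x)
    (hv : v ∈ orderCone x) (hw : w ∈ berg (locRank r y)) (hwv : φ w = v) : ψ v = w := by
  obtain ⟨δ, hδ, h⟩ := inverse_add_smul hr hφ hψ (hφ.mapsTo hy) (w := w) (by rwa [hψ.1 hy])
  have h1 := h δ hδ.le le_rfl
  rw [hwv, inverse_add hr hs hφ hψ hx hyx (smul_mem_orderCone hδ.le hv),
    inverse_smul hφ hψ (orderCone_subset_berg hx hv) hδ.le] at h1
  exact smul_right_injective _ hδ.ne' (add_left_cancel h1)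

end Inverse

/-! ### Linearity of the inverse -/

section LinearInverse

set_option linter.unusedSectionVars false

variable {α β : Type*} [DecidableEq α] [Fintype α] [DecidableEq β] [Fintype β]
  {r : Finset α → ℕ} {s : Finset β → ℕ} {φ : (α → ℝ) →ₗ[ℝ] (β → ℝ)} {ψ : (β → ℝ) → α → ℝ}

theorem neg_indVec_strictSublevel_mem_orderCone (x : α → ℝ) (t : ℝ) :
    -indVec (strictSublevel x t) ∈ orderCone x := by
  intro i j h
  simp only [Pi.neg_apply, indVec_apply, mem_strictSublevel]
  split_ifs with h1 h2 h2 <;> linarith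

theorem IsAlmostFull.congr {x y : α → ℝ} {i₀ : α} (hx : IsAlmostFull r x i₀)
    (h1 : y ∈ orderCone x) (h2 : x ∈ orderCone y) : IsAlmostFull r y i₀ := by
  refine ⟨orderCone_subset_berg hx.1 h1, ?_, fun i hi => ?_⟩
  · rw [← (sublevel_congr h1 h2 i₀).1, ← (sublevel_congr h1 h2 i₀).2]; exact hx.2.1
  · rw [← (sublevel_congr h1 h2 i).1, ← (sublevel_congr h1 h2 i).2]
    exact hx.2.2 i fun h => hi (le_antisymm (h1 _ _ h.le) (h1 _ _ h.ge))

/-- The flats of the gap are disjoint outside the strict sublevel set, so a coordinate in just one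
of them picks out its coefficient. Membership in the order span makes such coordinates equal. -/
theorem eq_of_sum_smul_indVec_mem_orderSpan (hr : IsRankFn r) {x : α → ℝ} (hx : x ∈ berg r) {c : ℝ}
    {C : Finset α → ℝ}
    (h : ∑ A ∈ coversIn Finset.univ r (strictSublevel x c) (sublevel x c), C A • indVec A ∈
      orderSpan x) {A B : Finset α}
    (hA : A ∈ coversIn Finset.univ r (strictSublevel x c) (sublevel x c))
    (hB : B ∈ coversIn Finset.univ r (strictSublevel x c) (sublevel x c)) : C A = C B := by
  have key : ∀ D ∈ coversIn Finset.univ r (strictSublevel x c) (sublevel x c), ∃ i, x i = c ∧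
      (∑ A ∈ coversIn Finset.univ r (strictSublevel x c) (sublevel x c), C A • indVec A) i =
        C D := by
    intro D hD
    obtain ⟨i, hi, hiF⟩ := exists_mem_of_mem_coversIn hD
    refine ⟨i, le_antisymm (mem_sublevel.1 ((mem_coversIn.1 hD).1 hi))
      (not_lt.1 fun h => hiF (mem_strictSublevel.2 h)), ?_⟩
    rw [Finset.sum_apply, Finset.sum_eq_single_of_mem D hD]
    · simp [hi]
    · intro D' hD' hne
      have : i ∉ D' := fun h => hne (coversIn_eq_of_mem hr (flatIn_strictSublevel hx _) hD' hD h hi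
        hiF)
      simp [this]
  obtain ⟨i, hi, hiA⟩ := key A hA
  obtain ⟨j, hj, hjB⟩ := key B hB
  rw [← hiA, ← hjB]
  exact h i j (hi.trans hj.symm)

theorem indVec_notMem_orderSpan {x : α → ℝ} {i₀ : α} (hx : IsAlmostFull r x i₀) {A : Finset α}
    (hA : A ∈ coversIn Finset.univ r (strictSublevel x (x i₀)) (sublevel x (x i₀))) :
    indVec A ∉ orderSpan x := by
  intro h
  obtain ⟨i, hi, hiF⟩ := exists_mem_of_mem_coversIn hA
  have hA' := mem_coversIn.1 hA
  obtain ⟨j, hj, hjA⟩ : ∃ j ∈ sublevel x (x i₀), j ∉ A := by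
    by_contra! hn
    have h1 : sublevel x (x i₀) = A := subset_antisymm hn hA'.1
    have h2 := hx.2.1
    rw [h1] at h2
    omega
  have hxi : ∀ k ∈ sublevel x (x i₀), k ∉ strictSublevel x (x i₀) → x k = x i₀ :=
    fun k hk hk' => le_antisymm (mem_sublevel.1 hk) (not_lt.1 fun h => hk' (mem_strictSublevel.2 h))
  have := h i j ((hxi i (hA'.1 hi) hiF).trans (hxi j hj fun h => hjA (hA'.2.2.1 h)).symm)
  simp [hi, hjA] at this

/-- The relations between the flats in an interval of rank two are preserved by the inverse. -/
theorem sum_inverse_coversIn (hr : IsRankFn r) (hs : IsRankFn s)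
    (hφ : Set.BijOn φ (berg r) (berg s)) (hψ : Set.InvOn ψ φ (berg r) (berg s))
    (h0 : FlatIn Finset.univ s ∅) {F G : Finset β} (hF : FlatIn Finset.univ s F)
    (hG : FlatIn Finset.univ s G) (hFG : F ⊆ G) (hrk : s G = s F + 2) :
    ∑ A ∈ coversIn Finset.univ s F G, (ψ (-indVec A) - ψ (-indVec F)) =
      ψ (-indVec G) - ψ (-indVec F) := by
  obtain ⟨x, i₀, hx, rfl, rfl⟩ := exists_isAlmostFull hs h0 hF hG hFG hrk
  -- The almost full point is moved inside its open cone to `φ y`, so that the span of the cone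
  -- lifts to `orderSpan y`. By ranks, `y` is then full or almost full.
  obtain ⟨y, hy, hyx, hxy, hle⟩ := exists_orderSpan_le_map hφ.surjOn hx.1
  rw [(sublevel_congr hyx hxy i₀).1, (sublevel_congr hyx hxy i₀).2] at *
  replace hx := hx.congr hyx hxy
  rw [orderSpan_congr hxy hyx] at hle
  clear hyx hxy
  clear! x
  set x := φ y with hxdef
  have hcov : ∀ A ∈ coversIn Finset.univ s (strictSublevel x (x i₀)) (sublevel x (x i₀)),
      ψ (-indVec A) ∈ berg (locRank r y) ∧ φ (ψ (-indVec A)) = -indVec A := by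
    intro A hA
    have hA' := mem_coversIn.1 hA
    have h1 := add_smul_mem_berg_locRank hs hx.1 hA'.2.1 hA'.2.2.1 hA'.1 (orderSpan x).zero_mem
      zero_le_one
    rw [zero_add, one_smul] at h1
    obtain ⟨w, hw, hwA⟩ := (bijOn_berg_locRank hr hs hφ hy).surjOn h1
    obtain ⟨z, hz, hxz, hAz⟩ := exists_refine_flat hx.1 hA'.2.1 hA'.2.2.1 hA'.1
    have := inverse_eq_of_mem_locRank hr hs hφ hψ hy hz hxz hAz hw hwA
    rw [this]
    exact ⟨hw, hwA⟩
  have hspan : ∀ v ∈ orderCone x, ψ v ∈ orderSpan y ∧ φ (ψ v) = v := by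
    intro v hv
    obtain ⟨w, hw, hwv⟩ := hle (orderCone_subset_orderSpan x hv)
    have := inverse_eq_of_mem_locRank hr hs hφ hψ hy hx.1 (self_mem_orderCone x) hv
      (orderSpan_subset_berg_locRank hr hy hw) hwv
    rw [this]
    exact ⟨hw, hwv⟩
  have hspF := hspan _ (neg_indVec_strictSublevel_mem_orderCone x (x i₀))
  have hspG := hspan _ (neg_indVec_sublevel_mem_orderCone x (x i₀))
  -- The two sides of the claim have the same image under `φ`, which is injective on `orderSpan y`;
  -- it suffices that their difference lies there.
  suffices hsum : ∑ A ∈ coversIn Finset.univ s (strictSublevel x (x i₀)) (sublevel x (x i₀)),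
      ψ (-indVec A) ∈ orderSpan y by
    rw [← sub_eq_zero]
    refine map_eq_zero_of_injOn hφ.injOn hy ((orderSpan y).sub_mem ?_
      ((orderSpan y).sub_mem hspG.1 hspF.1)) ?_
    · rw [Finset.sum_sub_distrib]
      exact (orderSpan y).sub_mem hsum ((orderSpan y).sum_mem fun _ _ => hspF.1)
    · have h1 := sum_coversIn_indVec hs hF hG hFG
      rw [map_sub, map_sub, hspF.2, hspG.2, map_sum]
      have h2 : ∑ A ∈ coversIn Finset.univ s (strictSublevel x (x i₀)) (sublevel x (x i₀)),
          φ (ψ (-indVec A) - ψ (-indVec (strictSublevel x (x i₀)))) =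
          -∑ A ∈ coversIn Finset.univ s (strictSublevel x (x i₀)) (sublevel x (x i₀)),
            (indVec A - indVec (strictSublevel x (x i₀))) := by
        rw [← Finset.sum_neg_distrib]
        refine Finset.sum_congr rfl fun A hA => ?_
        rw [map_sub, (hcov A hA).2, hspF.2]
        abel
      rw [h2, h1]
      abel
  have hrank := rank_le_of_injOn hr hs hφ.mapsTo hφ.injOn ⟨_, hy⟩
  have hrank' := rank_le_of_surjOn hr hs hφ.surjOn ⟨_, hx.1⟩
  have hcvx := hx.card_values hs
  have hcvy := card_values_le hr hy
  have hTdim := finrank_map_orderSpan hφ.injOn hy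
  have hTle := Submodule.finrank_mono hle
  rw [hTdim, finrank_orderSpan] at hTle
  -- If `y` is full, its tangent cone is `orderSpan y` and contains the lifts of all the rays.
  by_cases hfull : r Finset.univ ≤ r ∅ + (values y).card
  · have hyf := isFull_of_card hr hy hfull
    refine Submodule.sum_mem _ fun A hA => ?_
    have := (hcov A hA).1
    rwa [hyf.berg_locRank hr] at this
  obtain ⟨j₀, hya⟩ := isAlmostFull_of_card hr hy (by omega)
  have hT : (orderSpan y).map φ = orderSpan x := by
    refine (Submodule.eq_of_le_of_finrank_le hle ?_).symm
    rw [hTdim, finrank_orderSpan]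
    omega
  have hinj := injOn_berg_locRank hr hφ.injOn hy
  -- Otherwise each ray at `y` corresponds, modulo the span, to a positive multiple of the lift of a
  -- ray at `x`. The balancing relation at `y` then becomes a relation `hsumC` between these lifts.
  have hdec : ∀ B ∈ coversIn Finset.univ r (strictSublevel y (y j₀)) (sublevel y (y j₀)),
      ∃ A ∈ coversIn Finset.univ s (strictSublevel x (x i₀)) (sublevel x (x i₀)), ∃ c : ℝ, 0 < c ∧
        -indVec B - c • ψ (-indVec A) ∈ orderSpan y := by
    intro B hB
    have hB' := mem_coversIn.1 hB
    have hBt : ∀ t ∈ orderSpan y, t + -indVec B ∈ berg (locRank r y) := fun t ht => by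
      have h1 := add_smul_mem_berg_locRank hr hy hB'.2.1 hB'.2.2.1 hB'.1 ht zero_le_one
      rwa [one_smul] at h1
    have hBloc : -indVec B ∈ berg (locRank r y) := by simpa using hBt 0 (Submodule.zero_mem _)
    rcases hx.decomp hs ((bijOn_berg_locRank hr hs hφ hy).mapsTo hBloc) with h1 | ⟨A, hA, c, hc, h1⟩
    · exfalso
      rw [← hT] at h1
      obtain ⟨t, ht, htB⟩ := h1
      have := hinj (orderSpan_subset_berg_locRank hr hy ht) hBloc htB
      refine indVec_notMem_orderSpan hya hB ?_
      rw [← Submodule.neg_mem_iff, ← this]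
      exact ht
    · refine ⟨A, hA, c, hc, ?_⟩
      rw [← hT] at h1
      obtain ⟨t, ht, htB⟩ := h1
      have := hinj (hBt (-t) (Submodule.neg_mem _ ht)) (smul_mem_berg (hcov A hA).1 hc.le) (by
        rw [map_add, map_neg, htB, map_smul, (hcov A hA).2]; module)
      rw [← this]
      have h2 : -indVec B - (-t + -indVec B) = t := by abel
      rw [h2]
      exact ht
  choose! m hm c hc hmc using hdec
  set C : Finset β → ℝ := fun A =>
    ∑ B ∈ (coversIn Finset.univ r (strictSublevel y (y j₀)) (sublevel y (y j₀))).filter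
      (fun B => m B = A), c B with hC
  have hsumB : ∑ B ∈ coversIn Finset.univ r (strictSublevel y (y j₀)) (sublevel y (y j₀)),
      -indVec B ∈ orderSpan y := by
    have hFy := orderCone_subset_orderSpan y (neg_indVec_strictSublevel_mem_orderCone y (y j₀))
    have hGy := orderCone_subset_orderSpan y (neg_indVec_sublevel_mem_orderCone y (y j₀))
    have h1 := sum_coversIn_indVec hr (flatIn_strictSublevel hy (y j₀)) (hy (y j₀))
      (strictSublevel_subset y (y j₀))
    rw [Finset.sum_sub_distrib, sub_eq_iff_eq_add] at h1
    rw [Finset.sum_neg_distrib, Submodule.neg_mem_iff, h1]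
    have hFy' := (Submodule.neg_mem_iff _).1 hFy
    have hGy' := (Submodule.neg_mem_iff _).1 hGy
    exact Submodule.add_mem _ (Submodule.sub_mem _ hGy' hFy') (Submodule.sum_mem _ fun _ _ => hFy')
  have hsumC : ∑ A ∈ coversIn Finset.univ s (strictSublevel x (x i₀)) (sublevel x (x i₀)),
      C A • ψ (-indVec A) ∈ orderSpan y := by
    have h1 := Submodule.sub_mem _ hsumB (Submodule.sum_mem _ hmc)
    rw [← Finset.sum_sub_distrib] at h1
    simp only [sub_sub_cancel] at h1
    rw [← Finset.sum_fiberwise_of_maps_to hm] at h1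
    convert h1 using 2 with A hA
    rw [hC, Finset.sum_smul]
    refine Finset.sum_congr rfl fun B hB => ?_
    rw [(Finset.mem_filter.1 hB).2]
  have hsumC' : ∑ A ∈ coversIn Finset.univ s (strictSublevel x (x i₀)) (sublevel x (x i₀)),
      C A • indVec A ∈ orderSpan x := by
    have h1 : φ _ ∈ (orderSpan y).map φ := Submodule.mem_map_of_mem hsumC
    rw [hT, map_sum, ← Submodule.neg_mem_iff, ← Finset.sum_neg_distrib] at h1
    convert h1 using 2 with A hA
    rw [map_smul, (hcov A hA).2, smul_neg, neg_neg]
  obtain ⟨B, hB⟩ : (coversIn Finset.univ r (strictSublevel y (y j₀)) (sublevel y (y j₀))).Nonempty := by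
    obtain ⟨i, hi, hi'⟩ : ∃ i ∈ sublevel y (y j₀), i ∉ strictSublevel y (y j₀) :=
      ⟨j₀, mem_sublevel.2 le_rfl, fun h => lt_irrefl _ (mem_strictSublevel.1 h)⟩
    exact ⟨_, clIn_insert_mem_coversIn hr (flatIn_strictSublevel hy _) (hy _)
      (strictSublevel_subset _ _) hi hi'⟩
  have hpos : 0 < C (m B) := Finset.sum_pos (fun D hD => hc D (Finset.mem_filter.1 hD).1)
    ⟨B, Finset.mem_filter.2 ⟨hB, rfl⟩⟩
  -- Applying `φ` shows that all coefficients `C A` agree, since the relation at `x` is unique up to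
  -- scaling. The common value is positive and can be divided out.
  rw [Finset.sum_congr rfl fun A hA => by
    rw [eq_of_sum_smul_indVec_mem_orderSpan hs hx.1 hsumC' hA (hm B hB)], ← Finset.smul_sum] at hsumC
  exact (Submodule.smul_mem_iff _ hpos.ne').1 hsumC

theorem exists_flatIn_rank_eq (hr : IsRankFn r) {G : Finset α} (h0 : FlatIn Finset.univ r ∅)
    (hG : FlatIn Finset.univ r G) : ∀ k : ℕ, r ∅ + k ≤ r G →
      ∃ F, FlatIn Finset.univ r F ∧ F ⊆ G ∧ r F = r ∅ + k := by
  intro k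
  induction k with
  | zero => exact fun _ => ⟨∅, h0, Finset.empty_subset _, rfl⟩
  | succ k ih =>
    intro hk
    obtain ⟨F, hF, hFG, hFk⟩ := ih (by omega)
    obtain ⟨i, hi, hiF⟩ : ∃ i ∈ G, i ∉ F := by
      by_contra! hn
      have : G = F := subset_antisymm hn hFG
      rw [this] at hk
      omega
    have h1 := mem_coversIn.1 (clIn_insert_mem_coversIn hr hF hG hFG hi hiF)
    exact ⟨_, h1.2.1, h1.1, by omega⟩

/-- A linear map that restricts to a bijection of Bergman fans has a linear left inverse on the
Bergman fan. -/
theorem exists_linear_leftInverse (hr : IsRankFn r) (hs : IsRankFn s)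
    (hφ : Set.BijOn φ (berg r) (berg s)) :
    ∃ g : (β → ℝ) →ₗ[ℝ] (α → ℝ), ∀ v ∈ berg r, g (φ v) = v := by
  rcases (berg r).eq_empty_or_nonempty with he | ⟨y₀, hy₀⟩
  · exact ⟨0, by simp [he]⟩
  have hψ := hφ.invOn_invFunOn
  set ψ := Function.invFunOn φ (berg r)
  have h0 := flatIn_empty_of_mem_berg (hφ.mapsTo hy₀)
  have hu : ∀ F, FlatIn Finset.univ s F → -indVec F ∈ berg s := fun F hF => by
    simpa using neg_smul_indVec_mem_berg h0 hF one_pos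
  have hz : (0 : β → ℝ) ∈ berg s := by simpa using smul_mem_berg (hφ.mapsTo hy₀) le_rfl
  have hψ0 : ψ 0 = 0 := by simpa using inverse_smul hφ hψ hz le_rfl
  have hat : ∀ A ∈ coversIn Finset.univ s ∅ Finset.univ, ∃ i, i ∈ A := fun A hA =>
    let ⟨i, hi, _⟩ := exists_mem_of_mem_coversIn hA
    ⟨i, hi⟩
  choose e he using hat
  -- `g` is prescribed on the flats of rank one above `∅`. Reading `v` at one representative of each
  -- works because these flats are disjoint.
  let g : (β → ℝ) →ₗ[ℝ] (α → ℝ) :=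
    -∑ A : {A // A ∈ coversIn Finset.univ s ∅ Finset.univ},
      (LinearMap.proj (e A.1 A.2) : (β → ℝ) →ₗ[ℝ] ℝ).smulRight (ψ (-indVec A.1))
  have hg : ∀ v, g v = -∑ A : {A // A ∈ coversIn Finset.univ s ∅ Finset.univ},
      v (e A.1 A.2) • ψ (-indVec A.1) := fun v => by
    simp [g, LinearMap.sum_apply]
  have hflat : ∀ n : ℕ, ∀ F, FlatIn Finset.univ s F → s F = n →
      g (-indVec F) = ψ (-indVec F) := by
    intro n
    induction n using Nat.strong_induction_on with
    | _ n ih =>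
    intro F hF hn
    have hmono : s ∅ ≤ s F := hs.mono (Finset.empty_subset _)
    rcases Nat.lt_or_ge (s F) (s ∅ + 2) with hlt | hge
    · rcases Nat.lt_or_ge (s F) (s ∅ + 1) with hlt' | hge'
      · have : ∅ = F := h0.eq_of_rank_le hs (Finset.subset_univ _) (Finset.empty_subset _) (by omega)
        rw [← this, indVec_empty, neg_zero, map_zero, hψ0]
      · have hFc : F ∈ coversIn Finset.univ s ∅ Finset.univ :=
          mem_coversIn.2 ⟨Finset.subset_univ _, hF, Finset.empty_subset _, by omega⟩
        rw [hg, Finset.sum_eq_single (⟨F, hFc⟩ : {A // A ∈ coversIn Finset.univ s ∅ Finset.univ})]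
        · simp [he F hFc]
        · rintro ⟨A, hA⟩ - hne
          have : e A hA ∉ F := fun h => hne (Subtype.ext
            (coversIn_eq_of_mem hs h0 hA hFc (he A hA) h (Finset.notMem_empty _)))
          simp [this]
        · simp
    -- With `F₀` of rank two below `F`, the relation of this interval expresses the indicator of `F`
    -- by flats of smaller rank, in the source and after applying `ψ`.
    · obtain ⟨F₀, hF₀, hsub, hrk⟩ := exists_flatIn_rank_eq hs h0 hF (s F - s ∅ - 2) (by omega)
      have h1 := sum_inverse_coversIn hr hs hφ hψ h0 hF₀ hF hsub (by omega)
      have h2 := congrArg (fun v => g (-v)) (sum_coversIn_indVec hs hF₀ hF hsub)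
      simp only [← Finset.sum_neg_distrib, map_sum, neg_sub', map_sub] at h2
      rw [ih _ (by omega) F₀ hF₀ rfl] at h2
      have h3 : ∀ A ∈ coversIn Finset.univ s F₀ F, g (-indVec A) = ψ (-indVec A) := fun A hA => by
        have hA := mem_coversIn.1 hA
        exact ih _ (by omega) A hA.2.1 rfl
      rw [Finset.sum_congr rfl fun A hA => by rw [h3 A hA], h1] at h2
      exact (sub_left_injective h2).symm
  have hneg : ∀ c : ℝ, 0 < c → ∀ F, FlatIn Finset.univ s F →
      g (-(c • indVec F)) = ψ (-(c • indVec F)) := fun c hc F hF => by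
    rw [← smul_neg, map_smul, hflat _ F hF rfl, inverse_smul hφ hψ (hu F hF) hc.le]
  have huniv : ∀ c : ℝ, c < 0 → g (fun _ => c) = ψ fun _ => c := fun c hc => by
    have h1 : (fun _ : β => c) = -((-c) • indVec Finset.univ) := by ext i; simp
    rw [h1]
    exact hneg _ (by linarith) _ FlatIn.ground
  refine ⟨g, fun v hv => ?_⟩
  have key : ∀ w ∈ orderCone (φ v), g w = ψ w := by
    refine orderCone_induction _ (fun a ha b hb h1 h2 => ?_) (fun c => ?_) fun c hc t =>
      hneg c hc _ (hφ.mapsTo hv t)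
    · rw [map_add, h1, h2, inverse_add hr hs hφ hψ (hφ.mapsTo hv) ha hb]
    · rcases lt_trichotomy c 0 with hc | rfl | hc
      · exact huniv c hc
      · exact (map_zero g).trans hψ0.symm
      -- Positive constants are not nonnegative multiples of a negative indicator; they are reached
      -- through `ψ c + ψ (-c) = ψ 0 = 0`.
      · have h1 := inverse_add hr hs hφ hψ hz (const_mem_orderCone 0 c) (const_mem_orderCone 0 (-c))
        have h2 : ((fun _ => c) + fun _ => -c : β → ℝ) = 0 := by ext i; simp
        have h3 : (fun _ => c : β → ℝ) = -fun _ => -c := by ext i; simp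
        rw [h2, hψ0, ← huniv (-c) (by linarith)] at h1
        rw [eq_neg_of_add_eq_zero_left h1.symm, ← map_neg, ← h3]
  rw [key _ (self_mem_orderCone _), hψ.1 hv]

end LinearInverse

/-! ### Weights from the characteristic polynomial -/

section Weights

set_option linter.unusedSectionVars false

variable {α : Type*} [DecidableEq α] [Fintype α] {r : Finset α → ℕ}

-- Multiplicativity for direct sums: a subset is the same as the family of its parts in the levels
-- of `x`.
open Polynomial in
theorem charPolyIn_locRank (hr : IsRankFn r) (x : α → ℝ) :
    charPolyIn Finset.univ (locRank r x) = ∏ c ∈ values x,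
      charPolyIn (Finset.univ.filter fun i => x i = c) fun S => r (strictSublevel x c ∪ S) := by
  unfold charPolyIn
  rw [← Finset.prod_coe_sort, Finset.prod_univ_sum]
  refine Finset.sum_nbij' (fun S c => S.filter fun i => x i = c) (fun p => Finset.univ.biUnion p)
    ?_ ?_ ?_ ?_ ?_
  · intro S _
    refine Fintype.mem_piFinset.2 fun c => Finset.mem_powerset.2 ?_
    exact Finset.filter_subset_filter _ (Finset.subset_univ S)
  · intro p _
    exact Finset.mem_powerset.2 (Finset.subset_univ _)
  · intro S _
    ext i
    simp only [Finset.mem_biUnion, Finset.mem_univ, true_and, Finset.mem_filter]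
    exact ⟨fun ⟨_, h, _⟩ => h, fun h => ⟨⟨x i, mem_values.2 ⟨i, rfl⟩⟩, h, rfl⟩⟩
  · intro p hp
    have hp' : ∀ c : values x, ∀ i ∈ p c, x i = c := fun c i hi =>
      (Finset.mem_filter.1 (Finset.mem_powerset.1 (Fintype.mem_piFinset.1 hp c) hi)).2
    funext c
    ext i
    simp only [Finset.mem_biUnion, Finset.mem_univ, true_and, Finset.mem_filter]
    refine ⟨fun ⟨⟨d, h⟩, hi⟩ => ?_, fun h => ⟨⟨c, h⟩, hp' c i h⟩⟩
    rwa [← Subtype.ext ((hp' d i h).symm.trans hi)]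
  · intro S _
    rw [Finset.prod_mul_distrib, Finset.prod_pow_eq_pow_sum, Finset.prod_pow_eq_pow_sum]
    congr 2
    · rw [Finset.card_eq_sum_card_fiberwise (s := S) (t := values x) (f := x)
        fun i _ => mem_values.2 ⟨i, rfl⟩]
      exact (Finset.sum_coe_sort (values x) fun c => (S.filter fun i => x i = c).card).symm
    · have h : ∀ c : ℝ, levelPart x c ∅ = strictSublevel x c ∪ ∅ := fun c => by simp [levelPart]
      simp only [locRank, h]
      rw [← Finset.sum_tsub_distrib]
      · exact (Finset.sum_coe_sort (values x) fun c =>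
          r (levelPart x c S) - r (strictSublevel x c ∪ ∅)).symm
      · exact fun c _ => hr.mono (Finset.union_subset_union subset_rfl (Finset.empty_subset _))

/-- The coefficients of the shifted characteristic polynomial of the localization at `x`. -/
noncomputable def cycleWeight (r : Finset α → ℕ) (x : α → ℝ) (k : ℕ) : ℤ :=
  ((charPolyIn Finset.univ (locRank r x)).comp (Polynomial.X - 1)).coeff (k + 1)

/-- At `X = -1` the rank disappears from the sum and the signs of the subsets cancel. So in the
product over the levels each factor contributes a factor `X`. -/
theorem charPolyIn_comp_coeff_zero {E : Finset α} (hE : E.Nonempty) :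
    ((charPolyIn E r).comp (Polynomial.X - 1)).coeff 0 = 0 := by
  rw [Polynomial.coeff_zero_eq_eval_zero, Polynomial.eval_comp]
  simp [charPolyIn, Polynomial.eval_finsetSum, Finset.sum_powerset_neg_one_pow_card_of_nonempty hE]

/-- The derivative at `X = -1` brings down the rank as a factor. Up to sign this is the sum that
defines the beta invariant. -/
theorem charPolyIn_comp_coeff_one (E : Finset α) (r : Finset α → ℕ) :
    ((charPolyIn E r).comp (Polynomial.X - 1)).coeff 1 =
      -∑ S ∈ E.powerset, (-1) ^ S.card * ((r S - r ∅ : ℕ) : ℤ) := by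
  have h : ∀ p : Polynomial ℤ, p.coeff 1 = p.derivative.eval 0 := fun p => by
    rw [← Polynomial.coeff_zero_eq_eval_zero, Polynomial.coeff_derivative]; simp
  rw [h, Polynomial.derivative_comp, Polynomial.eval_mul, Polynomial.eval_comp, charPolyIn,
    Polynomial.derivative_sum, Polynomial.eval_finsetSum, ← Finset.sum_neg_distrib]
  simp only [Polynomial.derivative_sub, Polynomial.derivative_X, Polynomial.derivative_one, sub_zero,
    Polynomial.eval_one, one_mul]
  refine Finset.sum_congr rfl fun S _ => ?_
  have h2 : ((-1 : Polynomial ℤ) ^ S.card) = Polynomial.C ((-1) ^ S.card) := by simp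
  rw [h2, Polynomial.derivative_C_mul, Polynomial.eval_C_mul, Polynomial.derivative_pow]
  simp

theorem coeff_prod_of_coeff_zero {ι R : Type*} [CommRing R] (s : Finset ι) (p : ι → Polynomial R)
    (h : ∀ i ∈ s, (p i).coeff 0 = 0) :
    (∀ m < s.card, (∏ i ∈ s, p i).coeff m = 0) ∧
      (∏ i ∈ s, p i).coeff s.card = ∏ i ∈ s, (p i).coeff 1 := by
  have h1 : ∏ i ∈ s, p i = (∏ i ∈ s, (p i).divX) * Polynomial.X ^ s.card := by
    rw [← Finset.prod_const, ← Finset.prod_mul_distrib]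
    refine Finset.prod_congr rfl fun i hi => ?_
    have := (p i).divX_mul_X_add
    rw [h i hi, map_zero, add_zero] at this
    exact this.symm
  refine ⟨fun m hm => ?_, ?_⟩
  · rw [h1, Polynomial.coeff_mul_X_pow', if_neg (not_le.2 hm)]
  · rw [h1, Polynomial.coeff_mul_X_pow', if_pos le_rfl, Nat.sub_self, Polynomial.coeff_zero_prod]
    simp [Polynomial.coeff_divX]

theorem values_nonempty_fiber {x : α → ℝ} {c : ℝ} (hc : c ∈ values x) :
    (Finset.univ.filter fun i => x i = c).Nonempty := by
  obtain ⟨i, hi⟩ := mem_values.1 hc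
  exact ⟨i, by simpa using hi⟩

theorem cycleWeight_eq_zero (hr : IsRankFn r) {x : α → ℝ} {k : ℕ} (h : k + 1 < (values x).card) :
    cycleWeight r x k = 0 := by
  rw [cycleWeight, charPolyIn_locRank hr, Polynomial.prod_comp]
  exact (coeff_prod_of_coeff_zero _ _ fun c hc =>
    charPolyIn_comp_coeff_zero (values_nonempty_fiber hc)).1 _ h

theorem cycleWeight_eq_prod (hr : IsRankFn r) {x : α → ℝ} {k : ℕ} (h : (values x).card = k + 1) :
    cycleWeight r x k = ∏ c ∈ values x, -∑ S ∈ (Finset.univ.filter fun i => x i = c).powerset,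
      (-1) ^ S.card * ((r (strictSublevel x c ∪ S) - r (strictSublevel x c) : ℕ) : ℤ) := by
  rw [cycleWeight, charPolyIn_locRank hr, Polynomial.prod_comp, ← h,
    (coeff_prod_of_coeff_zero _ _ fun c hc =>
      charPolyIn_comp_coeff_zero (values_nonempty_fiber hc)).2]
  refine Finset.prod_congr rfl fun c _ => ?_
  rw [charPolyIn_comp_coeff_one, Finset.union_empty]

end Weights

/-! ### Rank functions of matroids -/

section MatroidRank

set_option linter.unusedSectionVars false

/-- A basis of `C` is completed to one of `S ∪ C`; the added elements are a basis of `S` in the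
contraction. -/
theorem contract_eRk_add {α : Type*} (M : Matroid α) {C S : Set α} (h : Disjoint S C) :
    (M ／ C).eRk S + M.eRk C = M.eRk (S ∪ C) := by
  obtain ⟨J, hJ⟩ := M.exists_isBasis' C
  refine le_antisymm ?_ ?_
  · obtain ⟨K, hK⟩ := (M ／ C).exists_isBasis' S
    have h1 := hJ.contract_indep_iff.1 hK.indep
    rw [hK.eRk_eq_encard, hJ.eRk_eq_encard,
      ← Set.encard_union_eq (h.mono hK.subset hJ.subset)]
    exact h1.1.encard_le_eRk_of_subset (Set.union_subset_union hK.subset hJ.subset)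
  · obtain ⟨I, hI, hJI⟩ := hJ.indep.subset_isBasis'_of_subset
      (hJ.subset.trans (Set.subset_union_right (s := S)))
    have hIC : I ∩ C = J := (hJ.eq_of_subset_indep (hI.indep.subset Set.inter_subset_left)
      (Set.subset_inter hJI hJ.subset) Set.inter_subset_right).symm
    have hd : Disjoint C (I \ J) := by
      rw [Set.disjoint_left]
      exact fun i hi hiI => hiI.2 (hIC ▸ ⟨hiI.1, hi⟩)
    have h1 : (M ／ C).Indep (I \ J) := hJ.contract_indep_iff.2
      ⟨by rw [Set.sdiff_union_of_subset hJI]; exact hI.indep, hd⟩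
    have h2 : I \ J ⊆ S := fun i hi => (hI.subset hi.1).resolve_right fun hiC =>
      Set.disjoint_left.1 hd hiC hi
    rw [hI.eRk_eq_encard, hJ.eRk_eq_encard, ← Set.encard_sdiff_add_encard_of_subset hJI]
    gcongr
    exact h1.encard_le_eRk_of_subset h2

variable {α : Type*} [DecidableEq α] [Fintype α]

/-- The rank function of a matroid on a finite type, with values in the natural numbers. -/
noncomputable def natRank (M : Matroid α) (S : Finset α) : ℕ := (M.eRk (S : Set α)).toNat

theorem coe_natRank (M : Matroid α) (S : Finset α) : (natRank M S : ℕ∞) = M.eRk (S : Set α) :=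
  ENat.natCast_toNat ((M.eRk_le_encard _).trans_lt S.finite_toSet.encard_lt_top).ne

theorem isRankFn_natRank (M : Matroid α) : IsRankFn (natRank M) where
  mono := fun S T h => by
    rw [← ENat.natCast_le_natCast, coe_natRank, coe_natRank]
    exact M.eRk_mono (Finset.coe_subset.2 h)
  insert_le := fun i S => by
    rw [← ENat.natCast_le_natCast, ENat.natCast_add, coe_natRank, coe_natRank, Finset.coe_insert]
    exact M.eRk_insert_le_add_one i S
  submod := fun S T => by
    rw [← ENat.natCast_le_natCast, ENat.natCast_add, ENat.natCast_add]
    simp only [coe_natRank, Finset.coe_union, Finset.coe_inter]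
    rw [add_comm]
    exact M.eRk_inter_add_eRk_union_le S T

@[simp] theorem natRank_empty (M : Matroid α) : natRank M ∅ = 0 := by simp [natRank]

theorem natRank_univ {M : Matroid α} : natRank M Finset.univ = M.eRank.toNat := by
  simp [natRank]

theorem flatIn_natRank_iff {M : Matroid α} (hM : M.E = Set.univ) {F : Finset α} :
    FlatIn Finset.univ (natRank M) F ↔ M.IsFlat (F : Set α) := by
  have hlt : ∀ i, natRank M F < natRank M (insert i F) ↔ i ∉ M.closure (F : Set α) := fun i => by
    rw [← ENat.natCast_lt_natCast, coe_natRank, coe_natRank, Finset.coe_insert]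
    constructor
    · intro h hi
      rw [← M.eRk_insert_closure_eq, Set.insert_eq_of_mem hi, M.eRk_closure_eq] at h
      exact lt_irrefl _ h
    · intro h
      rw [Matroid.eRk_insert_eq_add_one ⟨hM ▸ Set.mem_univ i, h⟩]
      refine (ENat.lt_add_one_iff ?_).2 le_rfl
      rw [← coe_natRank]; exact ENat.natCast_ne_top _
  rw [Matroid.isFlat_iff_closure_eq]
  constructor
  · rintro ⟨-, h⟩
    refine subset_antisymm (fun i hi => ?_) (M.subset_closure _ (hM ▸ Set.subset_univ _))
    by_contra hiF
    exact (hlt i).1 (h i (Finset.mem_univ i) (fun h' => hiF (Finset.mem_coe.2 h'))) hi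
  · intro h
    exact ⟨Finset.subset_univ _, fun i _ hi => (hlt i).2 (by
      rw [h]; exact fun h' => hi (Finset.mem_coe.1 h'))⟩

theorem natRank_minor (M : Matroid α) {F G S : Finset α} (hFG : F ⊆ G) (hS : S ⊆ G \ F) :
    natRank ((M ↾ (G : Set α)) ／ (F : Set α)) S = natRank M (F ∪ S) - natRank M F := by
  have hSG : S ⊆ G := hS.trans Finset.sdiff_subset
  have hd : Disjoint (S : Set α) F := by
    rw [Finset.disjoint_coe]
    exact Finset.disjoint_of_subset_left hS Finset.sdiff_disjoint
  have h := contract_eRk_add (M ↾ (G : Set α)) hd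
  rw [Matroid.restrict_eRk_eq _ (Finset.coe_subset.2 hFG), Matroid.restrict_eRk_eq _
    (Set.union_subset (Finset.coe_subset.2 hSG) (Finset.coe_subset.2 hFG)), ← Finset.coe_union,
    ← coe_natRank, ← coe_natRank, ← coe_natRank, ← ENat.natCast_add, ENat.natCast_inj, Finset.union_comm] at h
  omega

theorem betaInvariant_minor (M : Matroid α) {F G : Finset α} (hFG : F ⊆ G) :
    betaInvariant ((M ↾ (G : Set α)) ／ (F : Set α)) = (-1) ^ (natRank M G - natRank M F) *
      ∑ S ∈ (G \ F).powerset, (-1) ^ S.card * ((natRank M (F ∪ S) - natRank M F : ℕ) : ℤ) := by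
  have hE : ((M ↾ (G : Set α)) ／ (F : Set α)).E = ((G \ F : Finset α) : Set α) := by
    rw [Matroid.contract_ground, Matroid.restrict_ground_eq, Finset.coe_sdiff]
  unfold betaInvariant
  congr 1
  · congr 1
    rw [Matroid.eRank_def, hE]
    refine (natRank_minor M hFG subset_rfl).trans ?_
    rw [Finset.union_sdiff_of_subset hFG]
  · have h1 : (Finset.univ.filter fun S : Finset α =>
        (S : Set α) ⊆ ((M ↾ (G : Set α)) ／ (F : Set α)).E) = (G \ F).powerset := by
      ext S
      rw [Finset.mem_filter, hE, Finset.coe_subset, Finset.mem_powerset]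
      simp
    rw [h1]
    refine Finset.sum_congr rfl fun S hS => ?_
    rw [← natRank_minor M hFG (Finset.mem_powerset.1 hS), natRank]

end MatroidRank

/-! ### Flags of flats and points of the Bergman fan -/

section Flags

set_option linter.unusedSectionVars false

variable {α : Type*} [DecidableEq α] [Fintype α] {M : Matroid α} {k : ℕ}

theorem sublevel_eq (x : α → ℝ) (t : ℝ) :
    sublevel x t = ∅ ∨ ∃ i, sublevel x t = sublevel x (x i) := by
  rcases (sublevel x t).eq_empty_or_nonempty with h | h
  · exact Or.inl h
  · obtain ⟨i, hi, hmax⟩ := Finset.exists_max_image _ x h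
    refine Or.inr ⟨i, ?_⟩
    ext j
    exact ⟨fun hj => mem_sublevel.2 (hmax j hj),
      fun hj => mem_sublevel.2 ((mem_sublevel.1 hj).trans (mem_sublevel.1 hi))⟩

/-- The number of flats of a flag that do not contain a given element. -/
noncomputable def FlagOfFlats.height (F : FlagOfFlats M k) (i : α) : ℝ :=
  ∑ m, if i ∈ F.flat m then 0 else 1

theorem FlagOfFlats.height_le_iff (F : FlagOfFlats M k) {i j : α} :
    F.height i ≤ F.height j ↔ ∀ m, j ∈ F.flat m → i ∈ F.flat m := by
  constructor
  · intro h m hj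
    by_contra hi
    refine h.not_gt (Finset.sum_lt_sum (fun m' _ => ?_) ⟨m, Finset.mem_univ _, by simp [hi, hj]⟩)
    by_cases hi' : i ∈ F.flat m'
    · have hm : m ≤ m' := by
        by_contra! hlt
        exact hi ((F.strictMono hlt).subset hi')
      simp [hi', F.strictMono.monotone hm hj]
    · rw [if_neg hi']; split_ifs <;> norm_num
  · intro h
    refine Finset.sum_le_sum fun m _ => ?_
    by_cases hj : j ∈ F.flat m
    · simp [hj, h m hj]
    · rw [if_neg hj]; split_ifs <;> norm_num

/-- The height vector lies in the relative interior of the lifted cone: its sublevel sets are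
precisely the flats of the flag. Cones of flags thus become order cones. -/
theorem FlagOfFlats.mem_range_flat (hM : M.E = Set.univ) (F : FlagOfFlats M k) {S : Set α} :
    S ∈ Set.range F.flat ↔ S = ∅ ∨ ∃ i, S = (sublevel F.height (F.height i) : Set α) := by
  constructor
  · rintro ⟨m, rfl⟩
    rcases (F.flat m).eq_empty_or_nonempty with h | h
    · exact Or.inl h
    · obtain ⟨i, hi, hmax⟩ := Set.exists_max_image _ F.height (F.flat m).toFinite h
      refine Or.inr ⟨i, Set.ext fun j => ?_⟩
      rw [Finset.mem_coe, mem_sublevel]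
      exact ⟨hmax j, fun hj => F.height_le_iff.1 hj m hi⟩
  · rintro (rfl | ⟨i, rfl⟩)
    · exact ⟨0, F.first⟩
    · have hne : (Finset.univ.filter fun m => i ∈ F.flat m).Nonempty :=
        ⟨Fin.last _, by simp [F.last, hM]⟩
      obtain ⟨m, hm, hmin⟩ := Finset.exists_min_image _ id hne
      refine ⟨m, Set.ext fun j => ?_⟩
      rw [Finset.mem_coe, mem_sublevel, F.height_le_iff]
      refine ⟨fun hj m' hi => ?_, fun h => h m (Finset.mem_filter.1 hm).2⟩
      exact F.strictMono.monotone (hmin m' (by simpa using hi)) hj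

theorem FlagOfFlats.height_mem_berg (hM : M.E = Set.univ) (F : FlagOfFlats M k) :
    F.height ∈ berg (natRank M) := by
  intro t
  rw [flatIn_natRank_iff hM]
  have : (sublevel F.height t : Set α) ∈ Set.range F.flat := by
    rw [F.mem_range_flat hM]
    rcases sublevel_eq F.height t with h | ⟨i, h⟩
    · exact Or.inl (by rw [h, Finset.coe_empty])
    · exact Or.inr ⟨i, by rw [h]⟩
  obtain ⟨m, hm⟩ := this
  exact hm ▸ F.isFlat m

theorem FlagOfFlats.card_values_height (hM : M.E = Set.univ) (F : FlagOfFlats M k) :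
    (values F.height).card = k + 1 := by
  have h1 : Set.range F.flat =
      insert ∅ ((fun c => (sublevel F.height c : Set α)) '' (values F.height : Set ℝ)) := by
    ext S
    rw [F.mem_range_flat hM, Set.mem_insert_iff]
    refine or_congr_right ⟨fun ⟨i, hi⟩ => ⟨_, mem_values.2 ⟨i, rfl⟩, hi.symm⟩, ?_⟩
    rintro ⟨c, hc, rfl⟩
    obtain ⟨i, rfl⟩ := mem_values.1 hc
    exact ⟨i, rfl⟩
  have h2 : (Set.range F.flat).ncard = k + 2 := by
    rw [← Set.image_univ, Set.ncard_image_of_injective _ F.strictMono.injective, Set.ncard_univ]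
    simp
  have hle : ∀ i d, sublevel F.height (F.height i) = sublevel F.height d → F.height i ≤ d :=
    fun i d h => mem_sublevel.1 (h ▸ mem_sublevel.2 le_rfl)
  rw [h1, Set.ncard_insert_of_notMem, Set.InjOn.ncard_image, Set.ncard_coe_finset] at h2
  · omega
  · intro c hc d hd hcd
    obtain ⟨i, rfl⟩ := mem_values.1 hc
    obtain ⟨j, rfl⟩ := mem_values.1 hd
    have h := Finset.coe_injective hcd
    exact le_antisymm (hle i _ h) (hle j _ h.symm)
  · rintro ⟨c, hc, h⟩
    obtain ⟨i, rfl⟩ := mem_values.1 hc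
    have : i ∈ (sublevel F.height (F.height i) : Set α) := Finset.mem_coe.2 (mem_sublevel.2 le_rfl)
    simp only at h
    rw [h] at this
    exact this

theorem mkQ_const (c : ℝ) : (Submodule.Quotient.mk (fun _ => c) : TropAmbient α) = 0 := by
  rw [Submodule.Quotient.mk_eq_zero, Submodule.mem_span_singleton]
  exact ⟨c, by ext i; simp⟩

theorem exists_eq_add_const {x y : α → ℝ}
    (h : (Submodule.Quotient.mk x : TropAmbient α) = Submodule.Quotient.mk y) :
    ∃ t : ℝ, ∀ i, x i = y i + t := by
  rw [Submodule.Quotient.eq, Submodule.mem_span_singleton] at h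
  obtain ⟨t, ht⟩ := h
  refine ⟨t, fun i => ?_⟩
  have := congrFun ht i
  simp only [Pi.smul_apply, Pi.one_apply, Pi.sub_apply, smul_eq_mul, mul_one] at this
  linarith

theorem neg_sum_smul_indicatorClass (F : FlagOfFlats M k) (c : Fin k → ℝ) :
    -∑ i : Fin k, c i • indicatorClass (F.flat i.succ.castSucc) =
      (Submodule.Quotient.mk (-∑ i : Fin k, c i • (F.flat i.succ.castSucc).indicator (1 : α → ℝ)) :
        TropAmbient α) := by
  rw [Submodule.Quotient.mk_neg]
  congr 1
  exact (map_sum (Submodule.mkQ (Submodule.span ℝ {(1 : α → ℝ)})) _ _).symm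

theorem FlagOfFlats.mem_cone_iff (hM : M.E = Set.univ) (F : FlagOfFlats M k) {x : α → ℝ} :
    Submodule.Quotient.mk x ∈ F.cone ↔ x ∈ orderCone F.height := by
  constructor
  · rintro ⟨c, hc, hx⟩ i j hij
    rw [neg_sum_smul_indicatorClass] at hx
    obtain ⟨t, ht⟩ := exists_eq_add_const hx
    rw [ht i, ht j]
    refine add_le_add_left ?_ t
    simp only [Pi.neg_apply, Finset.sum_apply, Pi.smul_apply, smul_eq_mul]
    refine neg_le_neg (Finset.sum_le_sum fun m _ => mul_le_mul_of_nonneg_left ?_ (hc m))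
    by_cases hj : j ∈ F.flat m.succ.castSucc
    · rw [Set.indicator_of_mem hj, Set.indicator_of_mem (F.height_le_iff.1 hij _ hj)]; rfl
    · rw [Set.indicator_of_notMem hj]
      exact Set.indicator_nonneg (fun _ _ => zero_le_one) i
  · have hzero : (0 : TropAmbient α) ∈ F.cone := ⟨0, fun _ => le_rfl, by simp⟩
    refine orderCone_induction (P := fun v => Submodule.Quotient.mk v ∈ F.cone) _ ?_ ?_ ?_ x
    · rintro v - w - ⟨c, hc, hv⟩ ⟨d, hd, hw⟩
      refine ⟨c + d, fun i => add_nonneg (hc i) (hd i), ?_⟩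
      rw [Submodule.Quotient.mk_add, hv, hw, ← neg_add, ← Finset.sum_add_distrib]
      simp only [Pi.add_apply, add_smul]
    · intro c
      rw [mkQ_const]
      exact hzero
    · intro c hc t
      have hS : (sublevel F.height t : Set α) ∈ Set.range F.flat := by
        rw [F.mem_range_flat hM]
        rcases sublevel_eq F.height t with h | ⟨i, h⟩
        · exact Or.inl (by rw [h, Finset.coe_empty])
        · exact Or.inr ⟨i, by rw [h]⟩
      obtain ⟨m, hm⟩ := hS
      -- The flats `∅` and `M.E` contribute zero modulo constants; only the intermediate flats give
      -- generators of the cone.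
      induction m using Fin.cases with
      | zero =>
        rw [F.first] at hm
        have : sublevel F.height t = ∅ := Finset.coe_eq_empty.1 hm.symm
        rw [this, indVec_empty]
        simpa using hzero
      | succ m =>
        induction m using Fin.lastCases with
        | last =>
          rw [Fin.succ_last, F.last, hM] at hm
          have h1 : sublevel F.height t = Finset.univ := Finset.coe_eq_univ.1 hm.symm
          have h2 : (-(c • indVec (sublevel F.height t)) : α → ℝ) = fun _ => -c := by
            rw [h1]; ext i; simp
          rw [h2, mkQ_const]
          exact hzero
        | cast m =>
          refine ⟨Pi.single m c, fun i => ?_, ?_⟩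
          · by_cases h : i = m
            · subst h; simp [hc.le]
            · simp [h]
          · rw [neg_sum_smul_indicatorClass, Finset.sum_eq_single m]
            · congr 2
              rw [Pi.single_eq_same]
              congr 1
              ext i
              rw [← Fin.succ_castSucc, hm]
              simp [Set.indicator_apply]
            · intro i _ hne
              simp [hne]
            · simp

theorem FlagOfFlats.eq_of_height (hM : M.E = Set.univ) {F G : FlagOfFlats M k}
    (h1 : F.height ∈ orderCone G.height) (h2 : G.height ∈ orderCone F.height) : F = G := by
  refine FlagOfFlats.ext ((StrictMono.range_inj F.strictMono G.strictMono).1 ?_)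
  ext S
  rw [F.mem_range_flat hM, G.mem_range_flat hM]
  simp only [(sublevel_congr h2 h1 _).1]

theorem exists_orderEmbOfFin_eq {x : α → ℝ} (hk : (values x).card = k + 1) (i : α) :
    ∃ m, (values x).orderEmbOfFin hk m = x i := by
  have h1 : x i ∈ Set.range ((values x).orderEmbOfFin hk) := by
    rw [Finset.range_orderEmbOfFin]
    exact Finset.mem_coe.2 (mem_values.2 ⟨i, rfl⟩)
  exact h1

/-- The flag of sublevel sets of a point of the Bergman fan. -/
theorem exists_flag (hM : M.E = Set.univ) {x : α → ℝ} (hx : x ∈ berg (natRank M))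
    (hk : (values x).card = k + 1) : ∃ F : FlagOfFlats M k, ∀ m : Fin (k + 1),
      F.flat m.succ = sublevel x ((values x).orderEmbOfFin hk m) ∧
      F.flat m.castSucc = strictSublevel x ((values x).orderEmbOfFin hk m) := by
  set e := (values x).orderEmbOfFin hk
  have hval : ∀ i, ∃ m, e m = x i := exists_orderEmbOfFin_eq hk
  have hval' : ∀ m, ∃ i, x i = e m := fun m => mem_values.1 (Finset.orderEmbOfFin_mem _ hk m)
  refine ⟨{ flat := Fin.cons ∅ fun m => (sublevel x (e m) : Set α)
            isFlat := fun m => ?_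
            strictMono := ?_
            first := rfl
            last := ?_ }, fun m => ⟨rfl, ?_⟩⟩
  · induction m using Fin.cases with
    | zero =>
      have := (flatIn_natRank_iff hM).1 (flatIn_empty_of_mem_berg hx)
      rwa [Finset.coe_empty] at this
    | succ m => exact (flatIn_natRank_iff hM).1 (hx (e m))
  · have hlt : ∀ m (S : Finset α), S ⊆ sublevel x (e m) → (∀ i ∈ S, x i < e m) →
        (S : Set α) < (sublevel x (e m) : Set α) := fun m S hS h => by
      refine lt_of_le_of_ne (Finset.coe_subset.2 hS) fun heq => ?_
      obtain ⟨i, hi⟩ := hval' m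
      have : i ∈ S := by rw [Finset.coe_injective heq]; exact mem_sublevel.2 hi.le
      exact (h i this).ne hi
    refine Fin.strictMono_iff_lt_succ.2 fun m => ?_
    induction m using Fin.cases with
    | zero =>
      have := hlt 0 ∅ (Finset.empty_subset _) (by simp)
      rwa [Finset.coe_empty] at this
    | succ m =>
      rw [← Fin.succ_castSucc, Fin.cons_succ, Fin.cons_succ]
      have he : e m.castSucc < e m.succ := e.strictMono Fin.castSucc_lt_succ
      exact hlt m.succ _ (sublevel_mono x he.le) fun i hi => (mem_sublevel.1 hi).trans_lt he
  · rw [← Fin.succ_last, Fin.cons_succ, hM, Finset.coe_eq_univ]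
    ext i
    obtain ⟨m, hm⟩ := hval i
    simp only [mem_sublevel, Finset.mem_univ, iff_true]
    rw [← hm]
    exact e.monotone (Fin.le_last m)
  · induction m using Fin.cases with
    | zero =>
      refine (Finset.coe_eq_empty.2 (Finset.eq_empty_of_forall_notMem fun i hi => ?_)).symm
      obtain ⟨m, hm⟩ := hval i
      rw [mem_strictSublevel, ← hm, e.lt_iff_lt] at hi
      exact Fin.not_lt_zero _ hi
    | succ m =>
      rw [← Fin.succ_castSucc]
      change (sublevel x (e m.castSucc) : Set α) = _
      congr 1
      ext i
      obtain ⟨l, hl⟩ := hval i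
      rw [mem_sublevel, mem_strictSublevel, ← hl, e.le_iff_le, e.lt_iff_lt, Fin.le_castSucc_iff]

theorem FlagOfFlats.orderCone_of_flat_eq {F : FlagOfFlats M k} {x : α → ℝ} {e : Fin (k + 1) → ℝ}
    (he : ∀ i, ∃ m, e m = x i) (hF : ∀ m : Fin (k + 1), F.flat m.succ = sublevel x (e m)) :
    x ∈ orderCone F.height ∧ F.height ∈ orderCone x := by
  have hmem : ∀ (m : Fin (k + 1)) i, i ∈ F.flat m.succ ↔ x i ≤ e m := fun m i => by
    rw [hF]; simp
  constructor
  · intro i j hij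
    obtain ⟨m, hm⟩ := he j
    rw [← hm, ← hmem]
    exact F.height_le_iff.1 hij _ ((hmem _ _).2 hm.ge)
  · intro i j hij
    rw [F.height_le_iff]
    intro m
    induction m using Fin.cases with
    | zero => rw [F.first]; exact fun h => h.elim
    | succ m => rw [hmem, hmem]; exact hij.trans

/-- The level sets of `x` are the ground sets of the minors of the flag, so both sides are products
of the same sums up to sign. -/
theorem csmWeight_eq_cycleWeight {x : α → ℝ} (hx : x ∈ berg (natRank M))
    (hk : (values x).card = k + 1) {F : FlagOfFlats M k} (hF : ∀ m : Fin (k + 1),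
      F.flat m.succ = sublevel x ((values x).orderEmbOfFin hk m) ∧
      F.flat m.castSucc = strictSublevel x ((values x).orderEmbOfFin hk m)) :
    F.csmWeight = cycleWeight (natRank M) x k := by
  have hr := isRankFn_natRank M
  have hreindex : ∀ f : ℝ → ℤ,
      ∏ m : Fin (k + 1), f ((values x).orderEmbOfFin hk m) = ∏ c ∈ values x, f c := fun f =>
    (Equiv.prod_comp ((values x).orderIsoOfFin hk).toEquiv fun c => f c).trans
      (Finset.prod_coe_sort (values x) f)
  have hdiff : ∀ c : ℝ, sublevel x c \ strictSublevel x c = Finset.univ.filter fun i => x i = c :=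
    fun c => by
      ext i
      simp only [Finset.mem_sdiff, mem_sublevel, mem_strictSublevel, not_lt, Finset.mem_filter,
        Finset.mem_univ, true_and]
      exact ⟨fun h => le_antisymm h.1 h.2, fun h => ⟨h.le, h.ge⟩⟩
  rw [FlagOfFlats.csmWeight, cycleWeight_eq_prod hr hk]
  let f : ℝ → ℤ := fun c => (-1) ^ (natRank M (sublevel x c) - natRank M (strictSublevel x c)) *
    ∑ S ∈ (Finset.univ.filter fun i => x i = c).powerset, (-1) ^ S.card *
      ((natRank M (strictSublevel x c ∪ S) - natRank M (strictSublevel x c) : ℕ) : ℤ)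
  have h1 : ∀ m : Fin (k + 1), betaInvariant ((M ↾ F.flat m.succ) ／ F.flat m.castSucc) =
      f ((values x).orderEmbOfFin hk m) := fun m => by
    rw [(hF m).1, (hF m).2, betaInvariant_minor M (strictSublevel_subset _ _), hdiff]
  rw [Finset.prod_congr rfl fun m _ => h1 m, hreindex f, Finset.prod_mul_distrib,
    Finset.prod_pow_eq_pow_sum, Finset.prod_neg, hk, ← mul_assoc]
  congr 1
  have h2 := sum_gaps hr x
  rw [natRank_empty, zero_add] at h2
  have h3 := card_values_le hr hx
  rw [← h2, ← natRank_univ, ← pow_add]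
  rw [natRank_empty] at h3
  -- With `ρ` the rank, the signs are `(-1)^(ρ - 1 - k)` from the definition, `(-1)^ρ` from the beta
  -- invariants and `(-1)^(k + 1)` from the linear coefficients. The truncated subtraction is exact
  -- because `k + 1 ≤ ρ`.
  refine neg_one_pow_congr ?_
  rw [Nat.even_add, Nat.even_sub (by omega), Nat.even_sub (by omega), Nat.even_add_one (n := k)]
  have : ¬ Even 1 := by decide
  tauto

theorem weightAt_csmCycle (M : Matroid α) (k : ℕ) (p : TropAmbient α) :
    (csmCycle M k).weightAt p =
      ∑ F : FlagOfFlats M k, if p ∈ F.cone then F.csmWeight else 0 := by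
  unfold WeightedCells.weightAt csmCycle
  rw [← Finsupp.sum_finsetSum_index]
  · exact Finset.sum_congr rfl fun F _ => Finsupp.sum_single_index (by simp)
  · simp
  · intro σ a b; split_ifs <;> simp

/-- With `k + 1` values, `x` lies in the cone of its own flag and in no other cone of dimension `k`.
With more values it lies in none of them, and the coefficient vanishes too. -/
theorem weightAt_csmCycle_mk (hM : M.E = Set.univ) {x : α → ℝ} (hx : x ∈ berg (natRank M))
    (hk : k + 1 ≤ (values x).card) :
    (csmCycle M k).weightAt (Submodule.Quotient.mk x) = cycleWeight (natRank M) x k := by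
  have hcard : ∀ F : FlagOfFlats M k, x ∈ orderCone F.height →
      Module.finrank ℝ (orderSpan F.height) ≤ Module.finrank ℝ (orderSpan x) := fun F hF => by
    rwa [finrank_orderSpan, finrank_orderSpan, F.card_values_height hM]
  have hspan : ∀ F : FlagOfFlats M k, x ∈ orderCone F.height → orderSpan x = orderSpan F.height :=
    fun F hF => Submodule.eq_of_le_of_finrank_le (orderSpan_mono hF) (hcard F hF)
  rw [weightAt_csmCycle]
  rcases hk.eq_or_lt with hk | hk
  · obtain ⟨F, hF⟩ := exists_flag hM hx hk.symm
    obtain ⟨h1, h2⟩ := F.orderCone_of_flat_eq (x := x)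
      (e := (values x).orderEmbOfFin hk.symm) (exists_orderEmbOfFin_eq hk.symm) fun m => (hF m).1
    rw [Finset.sum_eq_single F, if_pos ((F.mem_cone_iff hM).2 h1),
      csmWeight_eq_cycleWeight hx hk.symm hF]
    · intro G _ hne
      refine if_neg fun hG => hne ?_
      rw [G.mem_cone_iff hM] at hG
      have h3 : G.height ∈ orderSpan x := by
        rw [hspan G hG]; exact orderCone_subset_orderSpan _ (self_mem_orderCone _)
      have h4 : G.height ∈ orderCone x := by
        intro i j hij
        rcases hij.eq_or_lt with h | h
        · exact (h3 i j h).le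
        · exact le_of_not_gt fun h' => (hG j i h'.le).not_gt h
      exact FlagOfFlats.eq_of_height hM (orderCone_trans h1 h4) (orderCone_trans hG h2)
    · simp
  · rw [cycleWeight_eq_zero (isRankFn_natRank M) hk]
    refine Finset.sum_eq_zero fun F _ => if_neg fun hF => ?_
    rw [F.mem_cone_iff hM] at hF
    have := Submodule.finrank_mono (orderSpan_mono hF)
    rw [finrank_orderSpan, finrank_orderSpan, F.card_values_height hM] at this
    omega

theorem mk_mem_bergmanSupport_iff [Nonempty α] (hM : M.E = Set.univ) {x : α → ℝ} :
    Submodule.Quotient.mk x ∈ bergmanSupport M ↔ x ∈ berg (natRank M) := by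
  simp only [bergmanSupport, Set.mem_iUnion]
  constructor
  · rintro ⟨k, F, hF⟩
    exact orderCone_subset_berg (F.height_mem_berg hM) ((F.mem_cone_iff hM).1 hF)
  · intro hx
    have h1 : 0 < (values x).card :=
      Finset.card_pos.2 ⟨x (Classical.arbitrary α), mem_values.2 ⟨_, rfl⟩⟩
    have hk : (values x).card = (values x).card - 1 + 1 := by omega
    obtain ⟨F, hF⟩ := exists_flag hM hx hk
    refine ⟨_, F, (F.mem_cone_iff hM).2 (F.orderCone_of_flat_eq
      (e := (values x).orderEmbOfFin hk) (exists_orderEmbOfFin_eq hk) fun m => (hF m).1).1⟩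

end Flags

/-! ### Invariance of the CSM cycles -/

section Main

set_option linter.unusedSectionVars false

theorem finite_orderSpans (α : Type*) [Fintype α] : (Set.range (orderSpan : (α → ℝ) → _)).Finite := by
  let f : (α → α → Prop) → Submodule ℝ (α → ℝ) := fun R =>
    { carrier := {v | ∀ i j, R i j → v i = v j}
      zero_mem' := by simp
      add_mem' := fun h1 h2 i j h => by simp [h1 i j h, h2 i j h]
      smul_mem' := fun c v h1 i j h => by simp [h1 i j h] }
  refine (Set.finite_range f).subset ?_
  rintro _ ⟨x, rfl⟩
  exact ⟨fun i j => x i = x j, rfl⟩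

/-- The linear subspaces of the ambient space that contain the cones of dimension less than `k`. -/
theorem exists_exceptional (α : Type*) [Fintype α] [DecidableEq α] [Nonempty α] (k : ℕ) :
    ∃ A : Finset (Submodule ℝ (TropAmbient α)), (∀ a ∈ A, Module.finrank ℝ a < k) ∧
      ∀ x : α → ℝ, (∀ a ∈ A, (Submodule.Quotient.mk x : TropAmbient α) ∉ a) →
        k + 1 ≤ (values x).card := by
  let q : (α → ℝ) →ₗ[ℝ] TropAmbient α := Submodule.mkQ _
  have hfin : {S : Submodule ℝ (TropAmbient α) | ∃ x : α → ℝ, (values x).card ≤ k ∧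
      S = (orderSpan x).map q}.Finite := by
    refine ((finite_orderSpans α).image (Submodule.map q)).subset ?_
    rintro _ ⟨x, -, rfl⟩
    exact ⟨_, ⟨x, rfl⟩, rfl⟩
  refine ⟨hfin.toFinset, fun a ha => ?_, fun x hx => ?_⟩
  · obtain ⟨x, hk, rfl⟩ := hfin.mem_toFinset.1 ha
    -- The order span contains the constants, so its dimension drops in the quotient.
    refine lt_of_lt_of_le ?_ hk
    rw [← finrank_orderSpan, ← LinearMap.range_domRestrict]
    have h1 := LinearMap.finrank_range_add_finrank_ker (q.domRestrict (orderSpan x))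
    have h2 : 0 < Module.finrank ℝ (LinearMap.ker (q.domRestrict (orderSpan x))) := by
      refine Nat.pos_of_ne_zero fun h => ?_
      refine (Submodule.ne_bot_iff _).2 ?_ (Submodule.finrank_eq_zero.1 h)
      refine ⟨⟨fun _ => 1, fun _ _ _ => rfl⟩, mkQ_const 1, fun h => ?_⟩
      exact one_ne_zero (congrFun (congrArg Subtype.val h) (Classical.arbitrary α))
    omega
  · by_contra! hlt
    refine hx _ (hfin.mem_toFinset.2 ⟨x, by omega, rfl⟩) ⟨x, ?_, rfl⟩
    exact orderCone_subset_orderSpan _ (self_mem_orderCone _)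

variable {α β : Type*} [DecidableEq α] [Fintype α] [DecidableEq β] [Fintype β]

/-- An affine bijection between matroidal cycles lifts to the affine Bergman fans. -/
theorem exists_lift [Nonempty α] [Nonempty β] {M' : Matroid α} {M : Matroid β}
    (hM' : M'.E = Set.univ) (hM : M.E = Set.univ) {φ : TropAmbient α →ᵃ[ℝ] TropAmbient β}
    (hφ : Set.BijOn φ (bergmanSupport M') (bergmanSupport M)) :
    ∃ Φ : (α → ℝ) →ᵃ[ℝ] (β → ℝ), Set.BijOn Φ (berg (natRank M')) (berg (natRank M)) ∧
      ∀ x, (Submodule.Quotient.mk (Φ x) : TropAmbient β) = φ (Submodule.Quotient.mk x) := by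
  let q : (α → ℝ) →ₗ[ℝ] TropAmbient α := Submodule.mkQ _
  let p : (β → ℝ) →ₗ[ℝ] TropAmbient β := Submodule.mkQ _
  obtain ⟨s, hs⟩ := p.exists_rightInverse_of_surjective
    (LinearMap.range_eq_top.2 (Submodule.mkQ_surjective _))
  have hs' : ∀ y, p (s y) = y := fun y => LinearMap.congr_fun hs y
  obtain ⟨i₀⟩ := ‹Nonempty α›
  let c : (α → ℝ) →ₗ[ℝ] (β → ℝ) := (LinearMap.proj i₀ : (α → ℝ) →ₗ[ℝ] ℝ).smulRight (fun _ => (1 : ℝ))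
  have hc : ∀ x, c x = fun _ => x i₀ := fun x => by ext j; simp [c]
  -- The second summand carries the constants of the source bijectively to those of the target,
  -- which makes `Φ` bijective on the fibres as well.
  let Φ : (α → ℝ) →ᵃ[ℝ] (β → ℝ) :=
    (s.toAffineMap.comp (φ.comp q.toAffineMap)) + c.toAffineMap
  have hΦ : ∀ x, Φ x = s (φ (q x)) + fun _ => x i₀ := fun x => by
    rw [← hc]; rfl
  have hpΦ : ∀ x, p (Φ x) = φ (q x) := fun x => by
    rw [hΦ, map_add, hs']
    exact (congrArg _ (mkQ_const (x i₀))).trans (add_zero _)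
  have : Nonempty α := ⟨i₀⟩
  have hb' : ∀ {x}, q x ∈ bergmanSupport M' ↔ x ∈ berg (natRank M') := mk_mem_bergmanSupport_iff hM'
  have hb : ∀ {x}, p x ∈ bergmanSupport M ↔ x ∈ berg (natRank M) := mk_mem_bergmanSupport_iff hM
  refine ⟨Φ, ⟨fun x hx => ?_, fun x hx y hy h => ?_, fun y hy => ?_⟩, hpΦ⟩
  · rw [← hb, hpΦ]
    exact hφ.mapsTo (hb'.2 hx)
  · have h1 : q x = q y := hφ.injOn (hb'.2 hx) (hb'.2 hy) (by rw [← hpΦ, ← hpΦ, h])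
    rw [hΦ, hΦ, h1] at h
    obtain ⟨j⟩ := ‹Nonempty β›
    have h2 : x i₀ = y i₀ := congrFun (add_left_cancel h) j
    obtain ⟨t, ht⟩ := exists_eq_add_const h1
    have h3 := ht i₀
    ext i
    rw [ht i]
    linarith
  · obtain ⟨a, ha, hay⟩ := hφ.surjOn (hb.2 hy)
    obtain ⟨x, rfl⟩ := Submodule.mkQ_surjective _ a
    have h1 : p y = p (s (φ (q x))) := by rw [hs']; exact hay.symm
    obtain ⟨t, ht⟩ := exists_eq_add_const h1
    have h2 : q (x + fun _ => t - x i₀) = q x := by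
      rw [map_add]
      exact (congrArg _ (mkQ_const _)).trans (add_zero _)
    refine ⟨x + fun _ => t - x i₀, hb'.1 (h2 ▸ ha), ?_⟩
    rw [hΦ, h2]
    ext j
    simp [ht j]

/-- All coefficients of the polynomial of the localization are tangent ranks. These are preserved,
since the linear part has a linear left inverse on the fan. -/
theorem cycleWeight_eq_of_bijOn {r : Finset α → ℕ} {s : Finset β → ℕ} (hr : IsRankFn r)
    (hs : IsRankFn s) {Φ : (α → ℝ) →ᵃ[ℝ] (β → ℝ)} (hΦ : Set.BijOn Φ (berg r) (berg s)) {x : α → ℝ}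
    (hx : x ∈ berg r) (k : ℕ) : cycleWeight r x k = cycleWeight s (Φ x) k := by
  obtain ⟨g, hg⟩ := exists_linear_leftInverse hr hs (bijOn_linear_of_affine hΦ)
  have h : charPolyIn Finset.univ (locRank r x) = charPolyIn Finset.univ (locRank s (Φ x)) := by
    ext p
    rw [← tangentRank_berg hr hx, ← tangentRank_berg hs (hΦ.mapsTo hx),
      tangentRank_eq_of_affine Φ hΦ g (fun a ha b hb => by
        rw [map_sub, map_sub, hg a ha, hg b hb]) hx]
  rw [cycleWeight, cycleWeight, h]

theorem csmCycle_image {V : Type*} (M : Matroid α) (k : ℕ) (φ : TropAmbient α → V) :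
    (csmCycle M k).image φ =
      ∑ F : FlagOfFlats M k, Finsupp.single (φ '' F.cone) F.csmWeight := by
  rw [WeightedCells.image, csmCycle, Finsupp.mapDomain_finsetSum]
  simp only [Finsupp.mapDomain_single]

theorem FlagOfFlats.cone_subset {M : Matroid α} {k : ℕ} (F : FlagOfFlats M k) :
    F.cone ⊆ bergmanSupport M := fun _ hp => Set.mem_iUnion₂.2 ⟨k, F, hp⟩

/-- The exceptional set consists of the subspaces for `M` and the images of those for `M'`.
Elsewhere on the support both weights are the coefficient of the same polynomial, and off the
support both are zero. -/
theorem sameCycle_image [Nonempty α] [Nonempty β] {M' : Matroid α} {M : Matroid β}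
    (hM' : M'.E = Set.univ) (hM : M.E = Set.univ) {φ : TropAmbient α →ᵃ[ℝ] TropAmbient β}
    (hφ : Set.BijOn φ (bergmanSupport M') (bergmanSupport M)) (k : ℕ) :
    SameCycle k ((csmCycle M' k).image φ) (csmCycle M k) := by
  obtain ⟨A', hA', hx'⟩ := exists_exceptional α k
  obtain ⟨A, hA, hx⟩ := exists_exceptional β k
  obtain ⟨Φ, hΦ, hΦφ⟩ := exists_lift hM' hM hφ
  have himage : ∀ y, ((csmCycle M' k).image φ).weightAt y =
      ∑ F : FlagOfFlats M' k, if y ∈ φ '' F.cone then F.csmWeight else 0 := fun y => by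
    rw [csmCycle_image]
    unfold WeightedCells.weightAt
    rw [← Finsupp.sum_finsetSum_index]
    · exact Finset.sum_congr rfl fun F _ => Finsupp.sum_single_index (by simp)
    · simp
    · intro σ a b; split_ifs <;> simp
  refine ⟨A.image Submodule.toAffineSubspace ∪
    A'.image fun S => S.toAffineSubspace.map φ, fun a ha => ?_, fun y hy => ?_⟩
  · rcases Finset.mem_union.1 ha with ha | ha
    · obtain ⟨S, hS, rfl⟩ := Finset.mem_image.1 ha
      rw [Submodule.toAffineSubspace_direction]
      exact hA S hS
    · obtain ⟨S, hS, rfl⟩ := Finset.mem_image.1 ha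
      rw [AffineSubspace.map_direction, Submodule.toAffineSubspace_direction]
      exact (Submodule.finrank_map_le _ _).trans_lt (hA' S hS)
  · by_cases hyM : y ∈ bergmanSupport M
    · obtain ⟨a, ha, rfl⟩ := hφ.surjOn hyM
      obtain ⟨x, rfl⟩ := Submodule.mkQ_surjective _ a
      have hxb : x ∈ berg (natRank M') := (mk_mem_bergmanSupport_iff hM').1 ha
      have h1 : k + 1 ≤ (values x).card := hx' x fun S hS hxS => hy _
        (Finset.mem_union_right _ (Finset.mem_image_of_mem _ hS)) ⟨_, hxS, rfl⟩
      have h2 : k + 1 ≤ (values (Φ x)).card := hx (Φ x) fun S hS hxS => hy _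
        (Finset.mem_union_left _ (Finset.mem_image_of_mem _ hS)) (hΦφ x ▸ hxS)
      have h3 : ((csmCycle M' k).image φ).weightAt (φ (Submodule.Quotient.mk x)) =
          (csmCycle M' k).weightAt (Submodule.Quotient.mk x) := by
        rw [himage, weightAt_csmCycle]
        refine Finset.sum_congr rfl fun F _ => ?_
        exact if_congr (hφ.injOn.mem_image_iff F.cone_subset ha) rfl rfl
      refine h3.trans ?_
      rw [weightAt_csmCycle_mk hM' hxb h1, cycleWeight_eq_of_bijOn (isRankFn_natRank M')
        (isRankFn_natRank M) hΦ hxb, ← weightAt_csmCycle_mk hM (hΦ.mapsTo hxb) h2, hΦφ]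
      rfl
    · rw [himage, weightAt_csmCycle, Finset.sum_eq_zero, Finset.sum_eq_zero]
      · exact fun F _ => if_neg fun h => hyM (F.cone_subset h)
      · rintro F -
        refine if_neg ?_
        rintro ⟨a, ha, rfl⟩
        exact hyM (hφ.mapsTo (F.cone_subset ha))

/-- The linear part of `ψ` inverts that of `φ` on the span of the cell, and both preserve the
lattices. So lattice points of the image cell come from lattice points of the cell. -/
theorem latticeIndex_eq_one {α β : Type*} {X : Set (TropAmbient α)}
    {φ : TropAmbient α →ᵃ[ℝ] TropAmbient β} {ψ : TropAmbient β →ᵃ[ℝ] TropAmbient α}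
    (hφ : IsIntegerAffine φ) (hψ : IsIntegerAffine ψ) (hinv : Set.LeftInvOn ψ φ X)
    {σ : Set (TropAmbient α)} (hσ : σ ⊆ X) : latticeIndex φ σ = 1 := by
  have hspan : vectorSpan ℝ (φ '' σ) = (vectorSpan ℝ σ).map φ.linear :=
    (AffineMap.map_vectorSpan φ).symm
  have hlin : ∀ u ∈ vectorSpan ℝ σ, ψ.linear (φ.linear u) = u := by
    have : vectorSpan ℝ σ ≤ LinearMap.eqLocus (ψ.linear ∘ₗ φ.linear) LinearMap.id := by
      refine Submodule.span_le.2 ?_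
      rintro _ ⟨a, ha, b, hb, rfl⟩
      change ψ.linear (φ.linear (a -ᵥ b)) = a -ᵥ b
      rw [φ.linearMap_vsub, ψ.linearMap_vsub, hinv (hσ ha), hinv (hσ hb)]
    exact this
  have heq : (cellLattice σ).map φ.linear.toAddMonoidHom = cellLattice (φ '' σ) := by
    ext v
    constructor
    · rintro ⟨u, ⟨hu1, hu2⟩, rfl⟩
      refine ⟨hφ u hu1, ?_⟩
      change φ.linear u ∈ vectorSpan ℝ (φ '' σ)
      rw [hspan]
      exact Submodule.mem_map_of_mem hu2
    · rintro ⟨hv1, hv2⟩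
      change v ∈ vectorSpan ℝ (φ '' σ) at hv2
      rw [hspan] at hv2
      obtain ⟨u, hu, rfl⟩ := hv2
      refine ⟨u, ⟨?_, hu⟩, rfl⟩
      have := hψ _ hv1
      rwa [hlin u hu] at this
  rw [latticeIndex, heq, AddSubgroup.relIndex_self]

theorem csmCycle_pushforward (M : Matroid α) (k : ℕ)
    (φ : TropAmbient α →ᵃ[ℝ] TropAmbient β) (h : ∀ F : FlagOfFlats M k, latticeIndex φ F.cone = 1) :
    (csmCycle M k).pushforward φ = (csmCycle M k).image φ := by
  rw [csmCycle_image, WeightedCells.pushforward, csmCycle, ← Finsupp.sum_finsetSum_index]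
  · refine Finset.sum_congr rfl fun F _ => ?_
    rw [Finsupp.sum_single_index (by simp), h, Nat.cast_one, mul_one]
  · simp
  · intro σ a b
    rw [add_mul, Finsupp.single_add]

end Main

theorem proposition3p2 {n' n : ℕ}
    (M' : Matroid (Fin (n' + 1))) (M : Matroid (Fin (n + 1)))
    (hM' : M'.E = Set.univ) (hM : M.E = Set.univ)
    (φ : TropAmbient (Fin (n' + 1)) →ᵃ[ℝ] TropAmbient (Fin (n + 1)))
    (hφ : Set.BijOn φ (bergmanSupport M') (bergmanSupport M)) (k : ℕ) :
    SameCycle k ((csmCycle M' k).image φ) (csmCycle M k) ∧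
    (IsIntegerAffine φ →
      (∃ ψ : TropAmbient (Fin (n + 1)) →ᵃ[ℝ] TropAmbient (Fin (n' + 1)),
        IsIntegerAffine ψ ∧ Set.InvOn ψ φ (bergmanSupport M') (bergmanSupport M)) →
      SameCycle k ((csmCycle M' k).pushforward φ) (csmCycle M k)) := by
  have h := sameCycle_image hM' hM hφ k
  refine ⟨h, ?_⟩
  rintro hint ⟨ψ, hψ, hinv⟩
  rwa [csmCycle_pushforward M' k φ fun F => latticeIndex_eq_one hint hψ hinv.1 F.cone_subset]
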